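/- Model of computation. Programs run on a deterministic real RAM: registers and array cells hold real numbers; copying a register, writing a natural-number constant, each operation $+,-,\times,\div$ on reals, each comparison of two reals, and each read or write of an array cell (whose address is a natural number held in a register) costs one step. There is no rounding. Programs may use (recursive) procedures with local memory that is initially zero, scalars being passed by value and arrays by reference; a call costs one step, plus one for each register or array that is passed, plus the steps of the procedure. Sorting. Let $D_m\subseteq\mathbb{R}$ ($m\ge 0$) be any classes of admissible keys. A program $\mathcal A$ sorts keys from $(D_m)$ in time $\mathrm{Sort}:\mathbb{N}\to\mathbb{N}$ if for all $m$, when given $m$ keys from $D_m$ (the rest of the memory being zero), it outputs within $\mathrm{Sort}(m)$ steps a permutation of the positions $0,\dots,m-1$ that lists the keys in decreasing order. Update. A summary $\mathcal S$ of size $b$ is a set of at most $b$ positions $(i,j)$, $0\le i,j<n$ (called entries), each with a nonnegative weight; it is stored as a list sorted by $in+j$. For a finite set of weighted entries, the entry of rank $k$ is the $k$-th heaviest; its weight is taken to be $0$ if there are fewer than $k$ entries. For $u,v\in\mathbb{R}_{\ge 0}^n$ let $R$ be the outer product, $R_{i,j}=u_iv_j$. The update of $\mathcal S$ with $R$ is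 as follows. Let $w$ be the weight of the entry of rank $b+1$ in $R$, and let $\mathcal L$ consist of the $b$ heaviest entries of $R$ (of all entries, if there are fewer), each with its weight decreased by $w$. Let $\mathcal S\cup\mathcal L$ be the union, where an entry that occurs in both gets the sum of its two weights, and let $w'$ be the weight of the entry of rank $b+1$ in $\mathcal S\cup\mathcal L$. The updated summary consists of the $b$ heaviest entries of $\mathcal S\cup\mathcal L$ (of all of them, if there are at most $b$), each with its weight decreased by $w'$. Ties are resolved arbitrarily. Lemma. There is an absolute constant $C$ such that for every program $\mathcal A$ there is a program $P$ with the following property. Whenever $\mathcal A$ sorts keys from $(D_m)$ in time $\mathrm{Sort}$, then for all $n,b\ge 0$, all $u,v\in\mathbb{R}_{\ge 0}^n$ with entries in $D_n$, and every summary $\mathcal S$ of size $b$, the program $P$, given $n,b,u,v$ and $\mathcal S$ (the rest of the memory being arbitrary), replaces $\mathcal S$ by a summary of size $b$ that results from updating $\mathcal S$ with the outer product $uv$, in at most $C\,(b+\mathrm{Sort}(n))$ steps. That is, a summary can be updated with an outer product in time $O(b+\mathrm{Sort}(n))$. -/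

import Mathlib

/-! # A real RAM with unit costs

Registers and array cells hold real numbers. The machine can add, subtract, multiply and divide
reals, compare two reals, and use a register that holds a natural number as an array address.
There is no rounding operation and no sorting primitive. Programs may be split
into (possibly recursive) procedures with local memory. -/

/-- A memory frame: registers `reg x` and arrays `arr a`, where `arr a k` is the cell of address
`k` in array `a`. -/
structure Mem where
  reg : ℕ → ℝ
  arr : ℕ → ℕ → ℝ

/-- The four arithmetic operations of the machine. -/
inductive ArithOp where
  | add
  | sub
  | mul
  | div

/-- The value of an arithmetic operation. -/
noncomputable def ArithOp.eval : ArithOp → ℝ → ℝ → ℝ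
  | .add, p, q => p + q
  | .sub, p, q => p - q
  | .mul, p, q => p * q
  | .div, p, q => p / q

/-- Programs. Registers and arrays are named by natural numbers. -/
inductive Cmd where
  /-- do nothing -/
  | skip
  /-- `x := k`, for a natural number `k` written in the program -/
  | const (x : ℕ) (k : ℕ)
  /-- `x := y` -/
  | move (x y : ℕ)
  /-- `x := y ∘ z` for an arithmetic operation `∘` -/
  | arith (o : ArithOp) (x y z : ℕ)
  /-- `x := a[i]`, the address being the content of register `i` -/
  | load (x a i : ℕ)
  /-- `a[i] := x`, the address being the content of register `i` -/
  | store (a i x : ℕ)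
  /-- `c; d` -/
  | seq (c d : Cmd)
  /-- `if x < y then c else d` -/
  | ite (x y : ℕ) (c d : Cmd)
  /-- `while x < y do c` -/
  | loop (x y : ℕ) (c : Cmd)
  /-- `y := p(xs; as)`: run the procedure with body `p` in a new frame, the registers `xs` being
  passed by value and the arrays `as` by reference -/
  | call (p : Cmd) (xs as : List ℕ) (y : ℕ)
  /-- `y := self(xs; as)`: the same for the procedure that is being executed (recursion) -/
  | self (xs as : List ℕ) (y : ℕ)

/-- Write `r` into register `x`. -/
noncomputable def Mem.setReg (m : Mem) (x : ℕ) (r : ℝ) : Mem where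
  reg := Function.update m.reg x r
  arr := m.arr

/-- Write `r` into cell `k` of array `a`. -/
noncomputable def Mem.setArr (m : Mem) (a k : ℕ) (r : ℝ) : Mem where
  reg := m.reg
  arr := Function.update m.arr a (Function.update (m.arr a) k r)

/-- The frame in which a called procedure starts: its register `k` holds the `k`-th argument, its
array `k` is the `k`-th array that is passed, and everything else is zero. -/
noncomputable def Mem.enter (m : Mem) (xs as : List ℕ) : Mem where
  reg k := (xs[k]?).elim 0 m.reg
  arr k := (as[k]?).elim (fun _ => 0) m.arr

/-- The caller's frame `m` after a call that ended in the frame `m'`: register `y` receives the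
callee's register `0`, and the arrays that were passed have the contents the callee gave them. -/
noncomputable def Mem.leave (m m' : Mem) (as : List ℕ) (y : ℕ) : Mem where
  reg := Function.update m.reg y (m'.reg 0)
  arr a := if a ∈ as then m'.arr (as.idxOf a) else m.arr a

/-- `Exec p c m t m'`: inside the procedure with body `p`, the command `c` started in the frame `m`
terminates in the frame `m'` after exactly `t` steps. An instruction and the evaluation of a test
cost one step each; a call costs one step, plus one for each register or array that is passed, plus
the steps of the callee. A program that divides by zero, uses an address that is not a natural
number, or passes an array twice in the same call, has no terminating execution. -/
inductive Exec : Cmd → Cmd → Mem → ℕ → Mem → Prop where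
  | skip (p : Cmd) (m : Mem) : Exec p .skip m 1 m
  | const (p : Cmd) (x k : ℕ) (m : Mem) : Exec p (.const x k) m 1 (m.setReg x (k : ℝ))
  | move (p : Cmd) (x y : ℕ) (m : Mem) : Exec p (.move x y) m 1 (m.setReg x (m.reg y))
  | arith (p : Cmd) (o : ArithOp) (x y z : ℕ) (m : Mem) (h : o = .div → m.reg z ≠ 0) :
      Exec p (.arith o x y z) m 1 (m.setReg x (o.eval (m.reg y) (m.reg z)))
  | load (p : Cmd) (x a i : ℕ) (m : Mem) (k : ℕ) (h : m.reg i = (k : ℝ)) :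
      Exec p (.load x a i) m 1 (m.setReg x (m.arr a k))
  | store (p : Cmd) (a i x : ℕ) (m : Mem) (k : ℕ) (h : m.reg i = (k : ℝ)) :
      Exec p (.store a i x) m 1 (m.setArr a k (m.reg x))
  | seq (p c d : Cmd) (m m₁ m₂ : Mem) (t₁ t₂ : ℕ) (h₁ : Exec p c m t₁ m₁)
      (h₂ : Exec p d m₁ t₂ m₂) : Exec p (.seq c d) m (t₁ + t₂) m₂
  | iteTrue (p : Cmd) (x y : ℕ) (c d : Cmd) (m m₁ : Mem) (t : ℕ) (h : m.reg x < m.reg y)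
      (h₁ : Exec p c m t m₁) : Exec p (.ite x y c d) m (t + 1) m₁
  | iteFalse (p : Cmd) (x y : ℕ) (c d : Cmd) (m m₁ : Mem) (t : ℕ) (h : ¬ m.reg x < m.reg y)
      (h₁ : Exec p d m t m₁) : Exec p (.ite x y c d) m (t + 1) m₁
  | loopTrue (p : Cmd) (x y : ℕ) (c : Cmd) (m m₁ m₂ : Mem) (t₁ t₂ : ℕ) (h : m.reg x < m.reg y)
      (h₁ : Exec p c m t₁ m₁) (h₂ : Exec p (.loop x y c) m₁ t₂ m₂) :
      Exec p (.loop x y c) m (t₁ + t₂ + 1) m₂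
  | loopFalse (p : Cmd) (x y : ℕ) (c : Cmd) (m : Mem) (h : ¬ m.reg x < m.reg y) :
      Exec p (.loop x y c) m 1 m
  | call (p q : Cmd) (xs as : List ℕ) (y : ℕ) (m m₁ : Mem) (t : ℕ) (h : as.Nodup)
      (h₁ : Exec q q (m.enter xs as) t m₁) :
      Exec p (.call q xs as y) m (t + xs.length + as.length + 1) (m.leave m₁ as y)
  | self (p : Cmd) (xs as : List ℕ) (y : ℕ) (m m₁ : Mem) (t : ℕ) (h : as.Nodup)
      (h₁ : Exec p p (m.enter xs as) t m₁) :
      Exec p (.self xs as y) m (t + xs.length + as.length + 1) (m.leave m₁ as y)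

/-- The machine is deterministic: the result and the number of steps are determined by the program
and the initial memory. -/
theorem Exec.deterministic {p c : Cmd} {m m₁ m₂ : Mem} {t₁ t₂ : ℕ} (h₁ : Exec p c m t₁ m₁)
    (h₂ : Exec p c m t₂ m₂) : t₁ = t₂ ∧ m₁ = m₂ := by
  induction h₁ generalizing t₂ m₂ with
  | skip | const | move | arith => cases h₂; exact ⟨rfl, rfl⟩
  | load p x a i m k h =>
    cases h₂ with
    | load _ _ _ _ _ k' h' =>
      rw [h] at h'
      obtain rfl := Nat.cast_injective h'
      exact ⟨rfl, rfl⟩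
  | store p a i x m k h =>
    cases h₂ with
    | store _ _ _ _ _ k' h' =>
      rw [h] at h'
      obtain rfl := Nat.cast_injective h'
      exact ⟨rfl, rfl⟩
  | seq _ _ _ _ _ _ _ _ _ _ ih₁ ih₂ =>
    cases h₂ with
    | seq _ _ _ _ _ _ _ _ h h' =>
      obtain ⟨rfl, rfl⟩ := ih₁ h
      obtain ⟨rfl, rfl⟩ := ih₂ h'
      exact ⟨rfl, rfl⟩
  | iteTrue _ _ _ _ _ _ _ _ hc _ ih =>
    cases h₂ with
    | iteTrue _ _ _ _ _ _ _ _ _ h => obtain ⟨rfl, rfl⟩ := ih h; exact ⟨rfl, rfl⟩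
    | iteFalse _ _ _ _ _ _ _ _ hn _ => exact absurd hc hn
  | iteFalse _ _ _ _ _ _ _ _ hn _ ih =>
    cases h₂ with
    | iteTrue _ _ _ _ _ _ _ _ hc _ => exact absurd hc hn
    | iteFalse _ _ _ _ _ _ _ _ _ h => obtain ⟨rfl, rfl⟩ := ih h; exact ⟨rfl, rfl⟩
  | loopTrue _ _ _ _ _ _ _ _ _ hc _ _ ih₁ ih₂ =>
    cases h₂ with
    | loopTrue _ _ _ _ _ _ _ _ _ _ h h' =>
      obtain ⟨rfl, rfl⟩ := ih₁ h
      obtain ⟨rfl, rfl⟩ := ih₂ h'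
      exact ⟨rfl, rfl⟩
    | loopFalse _ _ _ _ _ hn => exact absurd hc hn
  | loopFalse _ _ _ _ _ hn =>
    cases h₂ with
    | loopTrue _ _ _ _ _ _ _ _ _ hc _ _ => exact absurd hc hn
    | loopFalse => exact ⟨rfl, rfl⟩
  | call _ _ _ _ _ _ _ _ _ _ ih =>
    cases h₂ with
    | call _ _ _ _ _ _ _ _ _ h => obtain ⟨rfl, rfl⟩ := ih h; exact ⟨rfl, rfl⟩
  | self _ _ _ _ _ _ _ _ _ ih =>
    cases h₂ with
    | self _ _ _ _ _ _ _ _ h => obtain ⟨rfl, rfl⟩ := ih h; exact ⟨rfl, rfl⟩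

/-- The program `p`, started in the memory `m`, terminates in the memory `m'` after exactly `t`
steps. -/
def Runs (p : Cmd) (m : Mem) (t : ℕ) (m' : Mem) : Prop := Exec p p m t m'

/-! # Sorting algorithms -/

/-- The memory on which a sorting program is started: register `0` holds the number `k` of keys,
array `0` the keys, and everything else is zero. -/
noncomputable def sortInput {k : ℕ} (key : Fin k → ℝ) : Mem where
  reg x := if x = 0 then (k : ℝ) else 0
  arr a i := if a = 0 then (if h : i < k then key ⟨i, h⟩ else 0) else 0

/-- `p` is a sorting program with running time at most `T`, for keys from the classes `D`: it puts
any `k` keys from `D k` into decreasing order within `T k` steps. The order is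
reported in array `1`, whose `i`-th cell receives the original position of the key
that comes `i`-th. -/
def SortsInTime (D : ℕ → Set ℝ) (p : Cmd) (T : ℕ → ℕ) : Prop :=
  ∀ (k : ℕ) (key : Fin k → ℝ), (∀ i, key i ∈ D k) →
    ∃ (t : ℕ) (m' : Mem), Runs p (sortInput key) t m' ∧ t ≤ T k ∧
      ∃ σ : Equiv.Perm (Fin k), Antitone (fun i => key (σ i)) ∧
        ∀ i : Fin k, m'.arr 1 (i : ℕ) = (((σ i : Fin k) : ℕ) : ℝ)

/-! # Summaries and their update -/

/-- The weight of the entry of rank `k` (the `k`-th largest weight, counted with multiplicity)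
among the entries in `A`; it is `0` if `A` has fewer than `k` entries. Ranks start at `1`. -/
noncomputable def rankWeight {E : Type*} (A : Finset E) (w : E → ℝ) (k : ℕ) : ℝ :=
  ((A.val.map w).sort (· ≥ ·)).getD (k - 1) 0

/-- `L` consists of the `b` heaviest entries of `A` (of all entries, if there are at most `b`),
with ties resolved in some way. -/
def IsHeaviest {E : Type*} (b : ℕ) (A : Finset E) (w : E → ℝ) (L : Finset E) : Prop :=
  L ⊆ A ∧ L.card = min b A.card ∧ ∀ e ∈ L, ∀ f ∈ A, f ∉ L → w f ≤ w e

/-- A set of entries (positions in an `n × n` matrix) with a weight for each of them; the values of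
`weight` outside `entries` are irrelevant. -/
structure Summary (n : ℕ) where
  entries : Finset (Fin n × Fin n)
  weight : Fin n × Fin n → ℝ

/-- A summary of size `b`: at most `b` entries, with nonnegative weights. -/
def Summary.HasSize {n : ℕ} (S : Summary n) (b : ℕ) : Prop :=
  S.entries.card ≤ b ∧ ∀ e ∈ S.entries, 0 ≤ S.weight e

/-- The weight of an entry according to the summary, `0` if the entry is not in the summary. -/
def Summary.estimate {n : ℕ} (S : Summary n) (e : Fin n × Fin n) : ℝ :=
  if e ∈ S.entries then S.weight e else 0

/-- The outer product of two vectors. -/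
def outer {n : ℕ} (u v : Fin n → ℝ) (e : Fin n × Fin n) : ℝ := u e.1 * v e.2

/-- The weights after the `b` heaviest entries `L` of `R`, decreased by the weight of the entry of
rank `b + 1` in `R`, have been added to the summary. -/
noncomputable def mergedWeight {n : ℕ} (b : ℕ) (R : Fin n × Fin n → ℝ) (L : Finset (Fin n × Fin n))
    (S : Summary n) (e : Fin n × Fin n) : ℝ :=
  S.estimate e + if e ∈ L then R e - rankWeight Finset.univ R (b + 1) else 0

/-- `S'` results from `S` by the update with the outer product `R`. -/
def IsUpdate {n : ℕ} (b : ℕ) (R : Fin n × Fin n → ℝ) (S S' : Summary n) : Prop :=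
  ∃ L : Finset (Fin n × Fin n), IsHeaviest b Finset.univ R L ∧
    IsHeaviest b (S.entries ∪ L) (mergedWeight b R L S) S'.entries ∧
    ∀ e ∈ S'.entries, S'.weight e = mergedWeight b R L S e -
      rankWeight (S.entries ∪ L) (mergedWeight b R L S) (b + 1)

/-! # Representation in memory -/

/-- The memory `m` holds the summary `S`: register `2` holds the number of entries, and the arrays
`2`, `3`, `4` hold the row, the column and the weight of the entries, sorted by position. Nothing is
said about the rest of the memory. -/
def StoresSummary {n : ℕ} (m : Mem) (S : Summary n) : Prop :=
  m.reg 2 = (S.entries.card : ℝ) ∧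
    ∃ e : Fin S.entries.card → Fin n × Fin n, (∀ k, e k ∈ S.entries) ∧
      StrictMono (fun k => ((e k).1 : ℕ) * n + ((e k).2 : ℕ)) ∧
      ∀ k : Fin S.entries.card, m.arr 2 (k : ℕ) = (((e k).1 : ℕ) : ℝ) ∧
        m.arr 3 (k : ℕ) = (((e k).2 : ℕ) : ℝ) ∧ m.arr 4 (k : ℕ) = S.weight (e k)

/-- The memory `m` holds the input of an update: `n` in register `0`, `b` in register `1`, the
vectors `u` and `v` in the arrays `0` and `1`, and the summary `S`. Nothing is said about the rest
of the memory. -/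
def StoresInput {n : ℕ} (m : Mem) (b : ℕ) (u v : Fin n → ℝ) (S : Summary n) : Prop :=
  m.reg 0 = (n : ℝ) ∧ m.reg 1 = (b : ℝ) ∧ (∀ i : Fin n, m.arr 0 (i : ℕ) = u i) ∧
    (∀ i : Fin n, m.arr 1 (i : ℕ) = v i) ∧ StoresSummary m S

/-!
Sort both vectors in decreasing order. In the sorted outer product an entry `(i, j)` is at most
every entry to the upper left of it, so an entry with many entries to the upper left is irrelevant.
To find the `B = b + 1` heaviest entries in time `O(B)`, every row `i` is cut into the blocks of
columns `p ≤ j + 1 < 2 * p`, for the powers of two `p`, and only the `O(B)` blocks with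
`(i + 1) * p ≤ 4 * B` are listed (`length_blockList_le`). The key of a block is its greatest entry,
and its weight is `p - p / 2`, the number of columns from `p / 2` to `p - 1`. These lie in the
block and in the block before it, and their entries are at least the key.

Let `x` be the key of weighted rank `B` among the blocks, found by weighted selection in linear
time with the median of medians of groups of five as the pivot (`selectCorrect`). The blocks of key
greater than `x`, and as many of key `x` as are needed to reach the weight `B`, contain `O(B)`
entries (`sum_takenBlocks_le`). At least `B` of them are at least `x`, unless there are no other
entries (`enough_candidates`), and the entries outside these blocks are at most `x`
(`le_of_not_mem_candidateList`): for a block that was not listed the reason is that the listed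
blocks to the upper left of it have a total weight of at least `B` (`exists_listed_blocks`). So the
entry of rank `B` and the `b` heaviest entries can be selected among these candidates
(`exists_heaviest_outer`).

The entries found are appended to the summary. Two stable passes of bucket sort, by column and by
row, sort the entries by position in time `O(b + n)`; entries at the same position become
neighbours and are merged; another selection finds the heaviest ones (`wp_mergeSummary`), which
stay in the order of their positions. A sorter writes `n` distinct numbers into cells that are zero
at the start, and therefore `n` is at most twice its running time (`SortsInTime.le_two_mul`). This
absorbs the `O(n)` for copying the vectors and for the buckets.

The running time of a program is treated together with its correctness, in the style of weakest
preconditions (`Wp`). A loop is handled by an invariant with a potential that pays for the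
remaining rounds (`wp_loop`), and everything that a command does not write is unchanged after it
(`Wp.frame`).
-/

/-! ### Reasoning about programs -/

infixr:60 " ;; " => Cmd.seq

/-- Total correctness: inside the procedure with body `p`, the command `c` started in `m`
terminates, and the number of steps and the final frame satisfy `Q`. -/
def Wp (p c : Cmd) (Q : ℕ → Mem → Prop) (m : Mem) : Prop :=
  ∃ t m', Exec p c m t m' ∧ Q t m'

namespace Mem

@[simp] theorem setReg_reg (m : Mem) (x y : ℕ) (r : ℝ) :
    (m.setReg x r).reg y = if y = x then r else m.reg y := by
  simp [setReg, Function.update_apply]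

@[simp] theorem setReg_arr (m : Mem) (x : ℕ) (r : ℝ) : (m.setReg x r).arr = m.arr := rfl

@[simp] theorem setArr_reg (m : Mem) (a k : ℕ) (r : ℝ) : (m.setArr a k r).reg = m.reg := rfl

@[simp] theorem setArr_arr (m : Mem) (a b k : ℕ) (r : ℝ) :
    (m.setArr a k r).arr b = if b = a then Function.update (m.arr a) k r else m.arr b := by
  simp [setArr, Function.update_apply]

@[simp] theorem enter_reg (m : Mem) (xs as : List ℕ) (k : ℕ) :
    (m.enter xs as).reg k = (xs[k]?).elim 0 m.reg := rfl

@[simp] theorem enter_arr (m : Mem) (xs as : List ℕ) (k : ℕ) :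
    (m.enter xs as).arr k = (as[k]?).elim (fun _ => 0) m.arr := rfl

@[simp] theorem leave_reg (m m' : Mem) (as : List ℕ) (y z : ℕ) :
    (m.leave m' as y).reg z = if z = y then m'.reg 0 else m.reg z := by
  simp [leave, Function.update_apply]

@[simp] theorem leave_arr (m m' : Mem) (as : List ℕ) (y a : ℕ) :
    (m.leave m' as y).arr a = if a ∈ as then m'.arr (as.idxOf a) else m.arr a := rfl

end Mem

section WpRules

variable {p : Cmd} {Q : ℕ → Mem → Prop} {m : Mem}

theorem Wp.mono {c : Cmd} {Q' : ℕ → Mem → Prop} (h : Wp p c Q m)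
    (hQ : ∀ t m', Q t m' → Q' t m') : Wp p c Q' m := by
  obtain ⟨t, m', he, hq⟩ := h
  exact ⟨t, m', he, hQ _ _ hq⟩

@[simp] theorem wp_skip : Wp p .skip Q m ↔ Q 1 m :=
  ⟨by rintro ⟨_, _, ⟨⟩, h⟩; exact h, fun h => ⟨_, _, .skip .., h⟩⟩

@[simp] theorem wp_const {x k : ℕ} : Wp p (.const x k) Q m ↔ Q 1 (m.setReg x k) :=
  ⟨by rintro ⟨_, _, ⟨⟩, h⟩; exact h, fun h => ⟨_, _, .const .., h⟩⟩

@[simp] theorem wp_move {x y : ℕ} : Wp p (.move x y) Q m ↔ Q 1 (m.setReg x (m.reg y)) :=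
  ⟨by rintro ⟨_, _, ⟨⟩, h⟩; exact h, fun h => ⟨_, _, .move .., h⟩⟩

@[simp] theorem wp_add {x y z : ℕ} :
    Wp p (.arith .add x y z) Q m ↔ Q 1 (m.setReg x (m.reg y + m.reg z)) :=
  ⟨by rintro ⟨_, _, ⟨⟩, h⟩; exact h, fun h => ⟨_, _, .arith _ _ _ _ _ _ nofun, h⟩⟩

@[simp] theorem wp_sub {x y z : ℕ} :
    Wp p (.arith .sub x y z) Q m ↔ Q 1 (m.setReg x (m.reg y - m.reg z)) :=
  ⟨by rintro ⟨_, _, ⟨⟩, h⟩; exact h, fun h => ⟨_, _, .arith _ _ _ _ _ _ nofun, h⟩⟩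

@[simp] theorem wp_mul {x y z : ℕ} :
    Wp p (.arith .mul x y z) Q m ↔ Q 1 (m.setReg x (m.reg y * m.reg z)) :=
  ⟨by rintro ⟨_, _, ⟨⟩, h⟩; exact h, fun h => ⟨_, _, .arith _ _ _ _ _ _ nofun, h⟩⟩

@[simp] theorem wp_div {x y z : ℕ} :
    Wp p (.arith .div x y z) Q m ↔ m.reg z ≠ 0 ∧ Q 1 (m.setReg x (m.reg y / m.reg z)) :=
  ⟨by rintro ⟨_, _, h', h⟩; cases h' with | arith _ _ _ _ _ _ h0 => exact ⟨h0 rfl, h⟩,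
    fun h => ⟨_, _, .arith _ _ _ _ _ _ fun _ => h.1, h.2⟩⟩

@[simp] theorem wp_load {x a i : ℕ} :
    Wp p (.load x a i) Q m ↔ ∃ k : ℕ, m.reg i = k ∧ Q 1 (m.setReg x (m.arr a k)) :=
  ⟨by rintro ⟨_, _, h', h⟩; cases h' with | load _ _ _ _ _ k h0 => exact ⟨k, h0, h⟩,
    fun ⟨_, h0, h⟩ => ⟨_, _, .load _ _ _ _ _ _ h0, h⟩⟩

@[simp] theorem wp_store {x a i : ℕ} :
    Wp p (.store a i x) Q m ↔ ∃ k : ℕ, m.reg i = k ∧ Q 1 (m.setArr a k (m.reg x)) :=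
  ⟨by rintro ⟨_, _, h', h⟩; cases h' with | store _ _ _ _ _ k h0 => exact ⟨k, h0, h⟩,
    fun ⟨_, h0, h⟩ => ⟨_, _, .store _ _ _ _ _ _ h0, h⟩⟩

@[simp] theorem wp_seq {c d : Cmd} :
    Wp p (c ;; d) Q m ↔ Wp p c (fun t m' => Wp p d (fun t' => Q (t + t')) m') m :=
  ⟨by rintro ⟨_, _, h', h⟩; cases h' with | seq _ _ _ _ _ _ _ _ h1 h2 =>
      exact ⟨_, _, h1, _, _, h2, h⟩,
    fun ⟨_, _, h1, _, _, h2, h⟩ => ⟨_, _, .seq _ _ _ _ _ _ _ _ h1 h2, h⟩⟩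

theorem wp_ite {x y : ℕ} {c d : Cmd} :
    Wp p (.ite x y c d) Q m ↔
      if m.reg x < m.reg y then Wp p c (fun t => Q (t + 1)) m
      else Wp p d (fun t => Q (t + 1)) m := by
  constructor
  · rintro ⟨_, _, h', h⟩
    cases h' with
    | iteTrue _ _ _ _ _ _ _ _ hc h1 => rw [if_pos hc]; exact ⟨_, _, h1, h⟩
    | iteFalse _ _ _ _ _ _ _ _ hc h1 => rw [if_neg hc]; exact ⟨_, _, h1, h⟩
  · split_ifs with hc
    · rintro ⟨_, _, h1, h⟩; exact ⟨_, _, .iteTrue _ _ _ _ _ _ _ _ hc h1, h⟩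
    · rintro ⟨_, _, h1, h⟩; exact ⟨_, _, .iteFalse _ _ _ _ _ _ _ _ hc h1, h⟩

theorem wp_call {q : Cmd} {xs as : List ℕ} {y : ℕ} (has : as.Nodup)
    (h : Wp q q (fun t m' => Q (t + xs.length + as.length + 1) (m.leave m' as y)) (m.enter xs as)) :
    Wp p (.call q xs as y) Q m := by
  obtain ⟨t, m', he, hq⟩ := h
  exact ⟨_, _, .call _ _ _ _ _ _ _ _ has he, hq⟩

theorem wp_self {xs as : List ℕ} {y : ℕ} (has : as.Nodup)
    (h : Wp p p (fun t m' => Q (t + xs.length + as.length + 1) (m.leave m' as y)) (m.enter xs as)) :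
    Wp p (.self xs as y) Q m := by
  obtain ⟨t, m', he, hq⟩ := h
  exact ⟨_, _, .self _ _ _ _ _ _ _ has he, hq⟩

end WpRules

/-! The addresses that occur in the programs are natural numbers by one of the following. -/

@[simp] theorem exists_cast_eq_cast {P : ℕ → Prop} {n : ℕ} :
    (∃ k : ℕ, (n : ℝ) = k ∧ P k) ↔ P n := by simp

@[simp] theorem exists_zero_eq_cast {P : ℕ → Prop} :
    (∃ k : ℕ, (0 : ℝ) = k ∧ P k) ↔ P 0 := by
  simpa using exists_cast_eq_cast (P := P) (n := 0)

@[simp] theorem exists_cast_add_one_eq_cast {P : ℕ → Prop} {n : ℕ} :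
    (∃ k : ℕ, (n : ℝ) + 1 = k ∧ P k) ↔ P (n + 1) := by
  simpa using exists_cast_eq_cast (P := P) (n := n + 1)

/-! The registers and arrays that a command may write. -/

/-- Whether the command mentions the register `x` as a destination. -/
def Cmd.writesReg (x : ℕ) : Cmd → Bool
  | .skip => false
  | .const y _ => x == y
  | .move y _ => x == y
  | .arith _ y _ _ => x == y
  | .load y _ _ => x == y
  | .store _ _ _ => false
  | .seq c d => c.writesReg x || d.writesReg x
  | .ite _ _ c d => c.writesReg x || d.writesReg x
  | .loop _ _ c => c.writesReg x
  | .call _ _ _ y => x == y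
  | .self _ _ y => x == y

/-- Whether the command stores into the array `a` or passes it to a procedure. -/
def Cmd.writesArr (a : ℕ) : Cmd → Bool
  | .skip => false
  | .const _ _ => false
  | .move _ _ => false
  | .arith _ _ _ _ => false
  | .load _ _ _ => false
  | .store b _ _ => a == b
  | .seq c d => c.writesArr a || d.writesArr a
  | .ite _ _ c d => c.writesArr a || d.writesArr a
  | .loop _ _ c => c.writesArr a
  | .call _ _ as _ => as.contains a
  | .self _ as _ => as.contains a

/-- The frames `m` and `m'` agree on everything that `c` does not write. -/
def AgreeOff (c : Cmd) (m m' : Mem) : Prop :=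
  (∀ x, c.writesReg x = false → m'.reg x = m.reg x) ∧
    ∀ a, c.writesArr a = false → m'.arr a = m.arr a

theorem AgreeOff.refl (c : Cmd) (m : Mem) : AgreeOff c m m := ⟨fun _ _ => rfl, fun _ _ => rfl⟩

theorem AgreeOff.trans {c : Cmd} {m m₁ m₂ : Mem} (h : AgreeOff c m m₁) (h' : AgreeOff c m₁ m₂) :
    AgreeOff c m m₂ :=
  ⟨fun x hx => (h'.1 x hx).trans (h.1 x hx), fun a ha => (h'.2 a ha).trans (h.2 a ha)⟩

theorem Exec.agreeOff {p c : Cmd} {m m' : Mem} {t : ℕ} (h : Exec p c m t m') : AgreeOff c m m' := by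
  induction h with
  | skip => exact .refl _ _
  | const | move | arith | load | store =>
    constructor <;> intro x hx <;> simp_all [Cmd.writesReg, Cmd.writesArr]
  | seq _ _ _ _ _ _ _ _ _ _ ih₁ ih₂ =>
    constructor
    · intro x hx
      simp only [Cmd.writesReg, Bool.or_eq_false_iff] at hx
      rw [ih₂.1 x hx.2, ih₁.1 x hx.1]
    · intro x hx
      simp only [Cmd.writesArr, Bool.or_eq_false_iff] at hx
      rw [ih₂.2 x hx.2, ih₁.2 x hx.1]
  | iteTrue _ _ _ _ _ _ _ _ _ _ ih =>
    constructor
    · intro x hx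
      simp only [Cmd.writesReg, Bool.or_eq_false_iff] at hx
      exact ih.1 x hx.1
    · intro x hx
      simp only [Cmd.writesArr, Bool.or_eq_false_iff] at hx
      exact ih.2 x hx.1
  | iteFalse _ _ _ _ _ _ _ _ _ _ ih =>
    constructor
    · intro x hx
      simp only [Cmd.writesReg, Bool.or_eq_false_iff] at hx
      exact ih.1 x hx.2
    · intro x hx
      simp only [Cmd.writesArr, Bool.or_eq_false_iff] at hx
      exact ih.2 x hx.2
  | loopTrue _ _ _ _ _ _ _ _ _ _ _ _ ih₁ ih₂ =>
    exact ⟨fun x hx => (ih₂.1 x hx).trans (ih₁.1 x hx), fun x hx => (ih₂.2 x hx).trans (ih₁.2 x hx)⟩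
  | loopFalse => exact .refl _ _
  | call | self =>
    constructor <;> intro x hx <;> simp_all [Cmd.writesReg, Cmd.writesArr]

theorem Wp.frame {p c : Cmd} {Q : ℕ → Mem → Prop} {m : Mem} (h : Wp p c Q m) :
    Wp p c (fun t m' => Q t m' ∧ AgreeOff c m m') m := by
  obtain ⟨t, m', he, hq⟩ := h
  exact ⟨t, m', he, hq, he.agreeOff⟩

/-- The rule for loops. The invariant `I` has a ghost state `s`, and every round is paid for by
the potential `Φ`. -/
theorem wp_loop {p c : Cmd} {x y : ℕ} {Q : ℕ → Mem → Prop} {m₀ : Mem} {σ : Type*}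
    (I : σ → Mem → Prop) (Φ : σ → ℕ) (s₀ : σ) (h₀ : I s₀ m₀)
    (hstep : ∀ s m, I s m → AgreeOff c m₀ m → m.reg x < m.reg y →
      Wp p c (fun t m' => ∃ s', I s' m' ∧ t + 1 + Φ s' ≤ Φ s) m)
    (hpost : ∀ s m t, I s m → AgreeOff c m₀ m → ¬ m.reg x < m.reg y → t + Φ s ≤ Φ s₀ + 1 →
      Q t m) :
    Wp p (.loop x y c) Q m₀ := by
  suffices H : ∀ N s m t₀, Φ s = N → I s m → AgreeOff c m₀ m → t₀ + Φ s ≤ Φ s₀ →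
      Wp p (.loop x y c) (fun t => Q (t₀ + t)) m by
    simpa using H _ s₀ m₀ 0 rfl h₀ (.refl _ _) (by simp)
  intro N
  induction N using Nat.strong_induction_on with
  | _ N ih =>
    intro s m t₀ hN hI ha ht
    by_cases hc : m.reg x < m.reg y
    · obtain ⟨t, m', he, s', hI', hΦ⟩ := hstep s m hI ha hc
      obtain ⟨t', m'', he', hQ⟩ := ih (Φ s') (by omega) s' m' (t₀ + t + 1) rfl hI'
        (ha.trans he.agreeOff) (by omega)
      refine ⟨_, _, .loopTrue _ _ _ _ _ _ _ _ _ hc he he', ?_⟩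
      convert hQ using 1
      ring
    · exact ⟨1, m, .loopFalse _ _ _ _ _ hc, hpost s m _ hI ha hc (by omega)⟩

/-- A loop that runs `k` through the numbers below `N`, at cost at most `K` per round. -/
theorem wp_loop_count {p c : Cmd} {x y : ℕ} {Q : ℕ → Mem → Prop} {m₀ : Mem}
    (I : ℕ → Mem → Prop) (N K : ℕ) (h₀ : I 0 m₀)
    (hstep : ∀ k m, I k m → AgreeOff c m₀ m → k < N → m.reg x < m.reg y →
      Wp p c (fun t m' => I (k + 1) m' ∧ t + 1 ≤ K) m)
    (hguard : ∀ k m, I k m → AgreeOff c m₀ m → (m.reg x < m.reg y ↔ k < N))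
    (hpost : ∀ m t, I N m → AgreeOff c m₀ m → t ≤ K * N + 1 → Q t m) :
    Wp p (.loop x y c) Q m₀ := by
  refine wp_loop (fun k m => k ≤ N ∧ I k m) (fun k => K * (N - k)) 0 ⟨Nat.zero_le _, h₀⟩ ?_ ?_
  · rintro k m ⟨-, hI⟩ ha hc
    have hk := (hguard k m hI ha).1 hc
    refine (hstep k m hI ha hk hc).mono ?_
    rintro t m' ⟨hI', ht⟩
    refine ⟨k + 1, ⟨hk, hI'⟩, ?_⟩
    have : N - k = (N - (k + 1)) + 1 := by omega
    rw [this, mul_add]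
    omega
  · rintro k m t ⟨hk, hI⟩ ha hc ht
    have : k = N := le_antisymm hk (not_lt.1 fun h => hc ((hguard k m hI ha).2 h))
    subst this
    exact hpost m t hI ha (by simp at ht; omega)

/-! Arrays that hold a list. -/

/-- The array `a` begins with the values of `f` on the list `l`. -/
def Holds {α : Type*} (a : ℕ → ℝ) (f : α → ℝ) (l : List α) : Prop :=
  ∀ i (h : i < l.length), a i = f l[i]

section Holds

variable {α : Type*} {a : ℕ → ℝ} {f : α → ℝ} {l : List α}

theorem Holds.nil : Holds a f [] := by intro i h; simp at h

theorem Holds.append (h : Holds a f l) {k : ℕ} {y : ℝ} {x : α} (hk : k = l.length) (hy : y = f x) :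
    Holds (Function.update a k y) f (l ++ [x]) := by
  subst hk hy
  intro i hi
  rcases Nat.lt_succ_iff_lt_or_eq.1 (by simpa using hi : i < l.length + 1) with h' | rfl
  · rw [Function.update_of_ne h'.ne, List.getElem_append_left h', h i h']
  · simp

end Holds

/-! A program has to spend a step on every array cell that it changes. -/

theorem Exec.encard_changed_le {p c : Cmd} {m m' : Mem} {t : ℕ} (h : Exec p c m t m') :
    {e : ℕ × ℕ | m'.arr e.1 e.2 ≠ m.arr e.1 e.2}.encard ≤ t := by
  have hcall : ∀ (m m₁ : Mem) (xs as : List ℕ) (y t : ℕ),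
      {e : ℕ × ℕ | m₁.arr e.1 e.2 ≠ (m.enter xs as).arr e.1 e.2}.encard ≤ t →
      {e : ℕ × ℕ | (m.leave m₁ as y).arr e.1 e.2 ≠ m.arr e.1 e.2}.encard ≤
        ((t + xs.length + as.length + 1 : ℕ) : ℕ∞) := by
    intro m m₁ xs as y t ih
    refine le_trans ?_ (ih.trans (Nat.cast_le.2 (by omega)))
    have hmem : ∀ e : ℕ × ℕ, (m.leave m₁ as y).arr e.1 e.2 ≠ m.arr e.1 e.2 → e.1 ∈ as := by
      intro e he
      by_contra hc
      simp [hc] at he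
    refine Set.encard_le_encard_of_injOn (f := fun e : ℕ × ℕ => (as.idxOf e.1, e.2)) ?_ ?_
    · intro e he
      have h1 := hmem e he
      simp only [Set.mem_ofPred_eq, Mem.leave_arr, h1, if_true, Mem.enter_arr] at he ⊢
      rw [List.getElem?_eq_getElem (List.idxOf_lt_length_iff.2 h1), List.getElem_idxOf]
      exact he
    · intro e he e' he' hee
      simp only [Prod.mk.injEq] at hee
      exact Prod.ext ((List.idxOf_inj (hmem e he)).1 hee.1) hee.2
  induction h with
  | skip | const | move | arith | load | loopFalse => simp
  | store p a i x m k h =>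
    refine le_trans (Set.encard_le_encard (t := {(a, k)}) ?_) (by simp)
    rintro ⟨b, j⟩ he
    by_contra hc
    apply he
    by_cases hb : b = a
    · subst hb
      have : j ≠ k := by rintro rfl; exact hc rfl
      simp [this]
    · simp [hb]
  | seq _ _ _ m m₁ m₂ t₁ t₂ _ _ ih₁ ih₂ =>
    refine le_trans (Set.encard_le_encard (t := _ ∪ _) ?_) ((Set.encard_union_le _ _).trans
      (by push_cast; exact add_le_add ih₁ ih₂))
    intro e he
    by_contra hc
    simp only [Set.mem_union, Set.mem_ofPred_eq, not_or, not_not] at hc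
    exact he (hc.2.trans hc.1)
  | iteTrue _ _ _ _ _ _ _ _ _ _ ih | iteFalse _ _ _ _ _ _ _ _ _ _ ih =>
    exact ih.trans (by push_cast; exact le_self_add)
  | loopTrue _ _ _ _ m m₁ m₂ t₁ t₂ _ _ _ ih₁ ih₂ =>
    refine le_trans (Set.encard_le_encard (t := _ ∪ _) ?_) ((Set.encard_union_le _ _).trans
      ((add_le_add ih₁ ih₂).trans (by push_cast; exact le_self_add)))
    intro e he
    by_contra hc
    simp only [Set.mem_union, Set.mem_ofPred_eq, not_or, not_not] at hc
    exact he (hc.2.trans hc.1)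
  | call p q xs as y m m₁ t h _ ih => exact hcall _ _ _ _ _ _ ih
  | self p xs as y m m₁ t h _ ih => exact hcall _ _ _ _ _ _ ih

theorem Exec.one_le {p c : Cmd} {m m' : Mem} {t : ℕ} (h : Exec p c m t m') : 1 ≤ t := by
  induction h <;> omega

/-! ### Calling the sorter -/

/-- A sorter needs time for writing the order into an array that is zero at the start. -/
theorem SortsInTime.le_two_mul {D : ℕ → Set ℝ} {p : Cmd} {T : ℕ → ℕ} (h : SortsInTime D p T)
    {n : ℕ} (u : Fin n → ℝ) (hu : ∀ i, u i ∈ D n) : 1 ≤ T n ∧ n ≤ 2 * T n := by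
  obtain ⟨t, m', hr, ht, σ, -, hσ⟩ := h n u hu
  have h1 : 1 ≤ t := hr.one_le
  have h3 : n ≤ t + 1 := by
    -- all cells of array `1` that receive a nonzero position have been changed
    have hcard : ((Finset.univ.filter fun i : Fin n => (σ i : ℕ) ≠ 0).card : ℕ∞) ≤ t := by
      rw [← Set.encard_coe_eq_coe_finsetCard]
      refine le_trans (Set.encard_le_encard_of_injOn (f := fun i : Fin n => (1, (i : ℕ))) ?_ ?_)
        hr.encard_changed_le
      · intro i hi
        simpa [sortInput, hσ] using hi
      · intro i _ j _ hij
        exact Fin.ext (by simpa using hij)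
    have hcard' := Nat.cast_le.1 hcard
    have hsplit := Finset.card_filter_add_card_filter_not
      (s := (Finset.univ : Finset (Fin n))) (fun i => (σ i : ℕ) ≠ 0)
    have hone : (Finset.univ.filter fun i : Fin n => ¬ (σ i : ℕ) ≠ 0).card ≤ 1 := by
      refine Finset.card_le_one.2 fun i hi j hj => σ.injective (Fin.ext ?_)
      simp only [ne_eq, not_not, Finset.mem_filter, Finset.mem_univ, true_and] at hi hj
      omega
    simp only [Finset.card_univ, Fintype.card_fin] at hsplit
    omega
  omega

/-- Sort the vector in array `0`, of the length in register `0`: array `1` (zero at the start)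
receives the order, and array `2` the sorted vector. The sorter is called with a copy of the vector
in array `3`: the frame it starts in has to be zero outside the keys, and it may overwrite them. -/
def sortVector (sorter : Cmd) : Cmd :=
  .const 1 1 ;; .const 2 0 ;;
  .loop 2 0 (.load 3 0 2 ;; .store 3 2 3 ;; .arith .add 2 2 1) ;;
  .call sorter [0] [3, 1] 3 ;;
  .const 2 0 ;;
  .loop 2 0 (.load 3 1 2 ;; .load 3 0 3 ;; .store 2 2 3 ;; .arith .add 2 2 1)

theorem wp_sortVector {D : ℕ → Set ℝ} {sorter : Cmd} {T : ℕ → ℕ} (h : SortsInTime D sorter T)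
    {n : ℕ} (u : Fin n → ℝ) (hu : ∀ i, u i ∈ D n) (m : Mem) (h0 : m.reg 0 = n)
    (ha0 : ∀ i : Fin n, m.arr 0 i = u i) (ha1 : m.arr 1 = fun _ => 0)
    (ha3 : m.arr 3 = fun _ => 0) :
    Wp (sortVector sorter) (sortVector sorter) (fun t m' => t ≤ 40 * T n ∧
      ∃ σ : Equiv.Perm (Fin n), Antitone (u ∘ σ) ∧ (∀ i : Fin n, m'.arr 1 i = (σ i : ℕ)) ∧
        ∀ i : Fin n, m'.arr 2 i = u (σ i)) m := by
  have hn := h.le_two_mul u hu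
  unfold sortVector
  simp only [wp_seq, wp_const]
  refine wp_loop_count (fun k m' => m'.reg 2 = k ∧ m'.arr 3 =
    fun i => if h : i < n ∧ i < k then u ⟨i, h.1⟩ else 0) n 4 ?_ ?_ ?_ ?_
  · simp [ha3]
  · rintro k m1 ⟨h2, h3⟩ ha hk -
    have e1 : m1.reg 1 = 1 := by simp [ha.1 1 rfl]
    have e0 := ha.2 0 rfl
    simp at e0
    simp [h2, h3, e1, e0]
    ext i
    by_cases hi : i = k
    · subst hi
      simp [hk, ha0 ⟨i, hk⟩]
    · rw [Function.update_of_ne hi]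
      have : i < k ↔ i < k + 1 := by omega
      simp [this]
  · rintro k m1 ⟨h2, -⟩ ha
    have e0 : m1.reg 0 = n := by simp [ha.1 0 rfl, h0]
    simp [h2, e0]
  rintro m1 t1 ⟨-, h3⟩ ha ht1
  obtain ⟨t, m', hr, ht, σ, hs, hσ⟩ := h n u hu
  have hin : m1.enter [0] [3, 1] = sortInput u := by
    have e0 : m1.reg 0 = n := by simp [ha.1 0 rfl, h0]
    have e1 := ha.2 1 rfl
    simp [ha1] at e1
    unfold Mem.enter sortInput
    congr 1
    · ext k
      rcases k with _ | k <;> simp [e0]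
    · ext k i
      rcases k with _ | _ | k <;> simp [h3, e1]
  refine wp_call (by decide) ?_
  rw [hin]
  refine ⟨t, m', hr, ?_⟩
  refine wp_loop_count (fun k m' => m'.reg 2 = k ∧ ∀ i : Fin n, (i : ℕ) < k →
    m'.arr 2 i = u (σ i)) n 5 ?_ ?_ ?_ ?_
  · simp
  · rintro k m2 ⟨h2, h3⟩ ha' hk -
    have e1 : m2.reg 1 = 1 := by simp [ha'.1 1 rfl, ha.1 1 rfl]
    have e0 := ha'.2 0 rfl
    have e3 := ha'.2 1 rfl
    have e4 := ha.2 0 rfl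
    have e5 := hσ ⟨k, hk⟩
    simp at e0 e3 e4 e5
    simp [h2, e1, e0, e3, e4, e5, ha0]
    intro i hi
    rcases lt_or_eq_of_le hi with hi | hi
    · rw [Function.update_of_ne hi.ne, h3 i hi]
    · subst hi; simp
  · rintro k m2 ⟨h2, -⟩ ha'
    have e0 : m2.reg 0 = n := by simp [ha'.1 0 rfl, ha.1 0 rfl, h0]
    simp [h2, e0]
  rintro m2 t2 ⟨-, h4⟩ ha' ht2
  refine ⟨by simp; omega, σ, hs, ?_, fun i => h4 i i.2⟩
  have e3 := ha'.2 1 rfl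
  simp at e3
  simp [e3, hσ]

/-! ### Weighted selection in linear time -/

/-- The total weight of the items of key greater than `x`; items are pairs of a key and a weight. -/
noncomputable def gtWeight (L : List (ℝ × ℝ)) (x : ℝ) : ℝ :=
  (L.map fun y => if x < y.1 then y.2 else 0).sum

/-- The total weight of the items of key at least `x`. -/
noncomputable def geWeight (L : List (ℝ × ℝ)) (x : ℝ) : ℝ :=
  (L.map fun y => if x ≤ y.1 then y.2 else 0).sum

/-- `x` is the key of weighted rank `T` in decreasing order, or `0` if the total weight is less
than `T`. For nonnegative keys the two cases need not be distinguished. -/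
def IsWeightedRank (L : List (ℝ × ℝ)) (T x : ℝ) : Prop :=
  gtWeight L x < T ∧ 0 ≤ x ∧ (T ≤ geWeight L x ∨ x = 0)

/-- Nonnegative keys with positive weights. -/
def GoodItems (L : List (ℝ × ℝ)) : Prop := ∀ y ∈ L, 0 ≤ y.1 ∧ 0 < y.2

theorem GoodItems.filter {L : List (ℝ × ℝ)} (h : GoodItems L) (P : ℝ × ℝ → Bool) :
    GoodItems (L.filter P) := fun y hy => h y (List.mem_of_mem_filter hy)

@[simp] theorem gtWeight_nil (x : ℝ) : gtWeight [] x = 0 := rfl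
@[simp] theorem geWeight_nil (x : ℝ) : geWeight [] x = 0 := rfl

@[simp] theorem gtWeight_cons (y : ℝ × ℝ) (L : List (ℝ × ℝ)) (x : ℝ) :
    gtWeight (y :: L) x = (if x < y.1 then y.2 else 0) + gtWeight L x := by simp [gtWeight]

@[simp] theorem geWeight_cons (y : ℝ × ℝ) (L : List (ℝ × ℝ)) (x : ℝ) :
    geWeight (y :: L) x = (if x ≤ y.1 then y.2 else 0) + geWeight L x := by simp [geWeight]

@[simp] theorem gtWeight_append (L L' : List (ℝ × ℝ)) (x : ℝ) :
    gtWeight (L ++ L') x = gtWeight L x + gtWeight L' x := by simp [gtWeight]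

@[simp] theorem geWeight_append (L L' : List (ℝ × ℝ)) (x : ℝ) :
    geWeight (L ++ L') x = geWeight L x + geWeight L' x := by simp [geWeight]

theorem gtWeight_of_unit {L : List (ℝ × ℝ)} (h : ∀ y ∈ L, y.2 = 1) (x : ℝ) :
    gtWeight L x = (L.countP fun y => x < y.1 : ℕ) := by
  induction L with
  | nil => simp
  | cons y L ih =>
    rw [gtWeight_cons, ih fun z hz => h z (List.mem_cons_of_mem _ hz), h y List.mem_cons_self,
      List.countP_cons]
    by_cases hc : x < y.1 <;> simp [hc, add_comm]

theorem geWeight_of_unit {L : List (ℝ × ℝ)} (h : ∀ y ∈ L, y.2 = 1) (x : ℝ) :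
    geWeight L x = (L.countP fun y => x ≤ y.1 : ℕ) := by
  induction L with
  | nil => simp
  | cons y L ih =>
    rw [geWeight_cons, ih fun z hz => h z (List.mem_cons_of_mem _ hz), h y List.mem_cons_self,
      List.countP_cons]
    by_cases hc : x ≤ y.1 <;> simp [hc, add_comm]

theorem countP_le_add_countP_lt (L : List (ℝ × ℝ)) (x : ℝ) :
    (L.countP fun y => y.1 ≤ x) + (L.countP fun y => x < y.1) = L.length := by
  induction L with
  | nil => simp
  | cons y L ih =>
    simp only [List.countP_cons, List.length_cons, decide_eq_true_eq]
    by_cases h : y.1 ≤ x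
    · simp [h, not_lt.2 h]; omega
    · simp [h, not_le.1 h]; omega

theorem countP_lt_add_countP_le (L : List (ℝ × ℝ)) (x : ℝ) :
    (L.countP fun y => y.1 < x) + (L.countP fun y => x ≤ y.1) = L.length := by
  induction L with
  | nil => simp
  | cons y L ih =>
    simp only [List.countP_cons, List.length_cons, decide_eq_true_eq]
    by_cases h : y.1 < x
    · simp [h, not_le.2 h]; omega
    · simp [h, not_lt.1 h]; omega

theorem IsWeightedRank.of_unit {L : List (ℝ × ℝ)} (hL : GoodItems L) (h : ∀ y ∈ L, y.2 = 1)
    {T x : ℝ} (hT : T ≤ L.length) (hx : IsWeightedRank L T x) :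
    ((L.countP fun y => x < y.1 : ℕ) : ℝ) < T ∧ T ≤ (L.countP fun y => x ≤ y.1 : ℕ) := by
  obtain ⟨h1, -, h2⟩ := hx
  rw [gtWeight_of_unit h] at h1
  refine ⟨h1, ?_⟩
  rcases h2 with h2 | rfl
  · rwa [geWeight_of_unit h] at h2
  · rwa [List.countP_eq_length.2 fun y hy => by simpa using (hL y hy).1]

theorem gtWeight_filter_gt {L : List (ℝ × ℝ)} {p x : ℝ} :
    gtWeight (L.filter fun y => p < y.1) x = gtWeight L (max p x) := by
  induction L with
  | nil => simp
  | cons y L ih =>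
    by_cases h : p < y.1 <;> simp [h, ih]

theorem geWeight_filter_gt_le {L : List (ℝ × ℝ)} (hL : GoodItems L) {p x : ℝ} :
    geWeight (L.filter fun y => p < y.1) x ≤ geWeight L x := by
  induction L with
  | nil => simp
  | cons y L ih =>
    have h1 := (hL y (by simp)).2
    have := ih fun z hz => hL z (by simp [hz])
    by_cases h : p < y.1 <;> simp [h, this]
    split_ifs <;> linarith

theorem geWeight_filter_lt {L : List (ℝ × ℝ)} {p x : ℝ} (h : x ≤ p) :
    geWeight (L.filter fun y => y.1 < p) x = geWeight L x - geWeight L p := by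
  induction L with
  | nil => simp
  | cons y L ih =>
    by_cases h1 : y.1 < p
    · have h2 := not_le.2 h1
      simp [h1, ih, h2]; ring
    · have h2 := not_lt.1 h1
      simp [h1, ih, h2, h.trans h2]

theorem gtWeight_le_filter_lt {L : List (ℝ × ℝ)} (hL : GoodItems L) {p x : ℝ} :
    gtWeight L x ≤ gtWeight (L.filter fun y => y.1 < p) x + geWeight L p := by
  induction L with
  | nil => simp
  | cons y L ih =>
    have h1 := (hL y (by simp)).2
    have := ih fun z hz => hL z (by simp [hz])
    by_cases h1 : y.1 < p
    · have h2 := not_le.2 h1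
      simp [h1, h2]; linarith
    · have h2 := not_lt.1 h1
      simp [h1, h2]
      split_ifs <;> linarith

theorem geWeight_filter_lt_eq_zero {L : List (ℝ × ℝ)} {p x : ℝ} (h : p ≤ x) :
    geWeight (L.filter fun y => y.1 < p) x = 0 := by
  induction L with
  | nil => simp
  | cons y L ih =>
    by_cases h1 : y.1 < p
    · simp [h1, ih, h1.trans_le h]
    · simp [h1, ih]

/-- If the rank `T` is reached among the items of key greater than the pivot `p`, the selection
goes on with these. -/
theorem IsWeightedRank.of_filter_gt {L : List (ℝ × ℝ)} (hL : GoodItems L) {T p x : ℝ}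
    (hp : T ≤ gtWeight L p) (h : IsWeightedRank (L.filter fun y => p < y.1) T x) :
    IsWeightedRank L T x := by
  obtain ⟨h1, h2, h3⟩ := h
  rw [gtWeight_filter_gt] at h1
  have hpx : p ≤ x := by
    by_contra hc
    rw [max_eq_left (not_le.1 hc).le] at h1
    linarith
  rw [max_eq_right hpx] at h1
  exact ⟨h1, h2, h3.imp_left fun h => h.trans (geWeight_filter_gt_le hL)⟩

/-- If the rank `T` is not reached among the items of key at least the pivot `p`, the selection
goes on with the others, and with the rank that remains. -/
theorem IsWeightedRank.of_filter_lt {L : List (ℝ × ℝ)} (hL : GoodItems L) {T p x : ℝ}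
    (hpT : geWeight L p < T)
    (h : IsWeightedRank (L.filter fun y => y.1 < p) (T - geWeight L p) x) :
    IsWeightedRank L T x := by
  obtain ⟨h1, h2, h3⟩ := h
  have := gtWeight_le_filter_lt hL (p := p) (x := x)
  refine ⟨by linarith, h2, h3.imp_left fun h => ?_⟩
  rcases le_total x p with hx | hx
  · rw [geWeight_filter_lt hx] at h
    linarith
  · rw [geWeight_filter_lt_eq_zero hx] at h
    linarith

/-- Write ones into the first `n` cells of the array `a`; the registers are named by `one`, the
counter `k` (zero at the start), and `n`. -/
def fillOnes (one k n a : ℕ) : Cmd := .loop k n (.store a k one ;; .arith .add k k one)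

theorem wp_fillOnes {p : Cmd} {one k n a N : ℕ} {m : Mem} {Q : ℕ → Mem → Prop} (h1 : k ≠ one)
    (h2 : k ≠ n) (hone : m.reg one = 1) (hk : m.reg k = 0) (hn : m.reg n = N)
    (h : ∀ t m', t ≤ 3 * N + 1 → (∀ x, x ≠ k → m'.reg x = m.reg x) →
      (∀ b, b ≠ a → m'.arr b = m.arr b) → (∀ i < N, m'.arr a i = 1) → Q t m') :
    Wp p (fillOnes one k n a) Q m := by
  have hreg : ∀ m', AgreeOff (.store a k one ;; .arith .add k k one) m m' → ∀ x, x ≠ k →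
      m'.reg x = m.reg x := fun m' h x hx => h.1 x (by simp [Cmd.writesReg, hx])
  refine wp_loop_count (fun i m' => m'.reg k = i ∧ ∀ j < i, m'.arr a j = 1) N 3 ?_ ?_ ?_ ?_
  · simp [hk]
  · rintro i m' ⟨hi, hj⟩ ha hiN -
    have e := hreg m' ha one h1.symm
    simp [hi, e, hone]
    intro j hji
    rcases lt_or_eq_of_le hji with hji | rfl
    · rw [Function.update_of_ne hji.ne, hj j hji]
    · simp
  · rintro i m' ⟨hi, hj⟩ ha
    simp [hi, hreg m' ha n h2.symm, hn]
  · rintro m' t ⟨hi, hj⟩ ha ht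
    exact h t m' ht (hreg m' ha) (fun b hb => ha.2 b (by simp [Cmd.writesArr, hb])) hj

/-- Split the items in the arrays `0` (keys) and `1` (weights) by comparison with the pivot in
register `4`: those of greater key go to the arrays `2` and `3`, those of smaller key to the arrays
`4` and `5`. Registers `7` and `8` count them, and registers `9` and `10` receive the weight
of the items of key greater than the pivot, and of key at least the pivot. -/
def partitionItems : Cmd :=
  .const 6 0 ;; .const 7 0 ;; .const 8 0 ;; .const 9 0 ;; .const 10 0 ;;
  .loop 6 0 (.load 11 0 6 ;; .load 12 1 6 ;;
    .ite 4 11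
      (.store 2 7 11 ;; .store 3 7 12 ;; .arith .add 7 7 2 ;; .arith .add 9 9 12 ;;
        .arith .add 10 10 12)
      (.ite 11 4
        (.store 4 8 11 ;; .store 5 8 12 ;; .arith .add 8 8 2)
        (.arith .add 10 10 12)) ;;
    .arith .add 6 6 2)

theorem wp_partitionItems {P : Cmd} {L : List (ℝ × ℝ)} {p : ℝ} {m : Mem} {Q : ℕ → Mem → Prop}
    (h0 : m.reg 0 = L.length) (h2 : m.reg 2 = 1) (h4 : m.reg 4 = p)
    (ha0 : Holds (m.arr 0) Prod.fst L) (ha1 : Holds (m.arr 1) Prod.snd L)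
    (h : ∀ t m', t ≤ 12 * L.length + 6 → m'.reg 1 = m.reg 1 → m'.reg 4 = p →
      m'.reg 7 = (((L.filter fun y => p < y.1).length : ℕ) : ℝ) →
      m'.reg 8 = (((L.filter fun y => y.1 < p).length : ℕ) : ℝ) →
      m'.reg 9 = gtWeight L p → m'.reg 10 = geWeight L p →
      Holds (m'.arr 2) Prod.fst (L.filter fun y => p < y.1) →
      Holds (m'.arr 3) Prod.snd (L.filter fun y => p < y.1) →
      Holds (m'.arr 4) Prod.fst (L.filter fun y => y.1 < p) →
      Holds (m'.arr 5) Prod.snd (L.filter fun y => y.1 < p) → Q t m') :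
    Wp P partitionItems Q m := by
  unfold partitionItems
  simp only [wp_seq, wp_const]
  refine wp_loop_count (fun k m' => m'.reg 6 = k ∧
      m'.reg 7 = ((((L.take k).filter fun y => p < y.1).length : ℕ) : ℝ) ∧
      m'.reg 8 = ((((L.take k).filter fun y => y.1 < p).length : ℕ) : ℝ) ∧
      m'.reg 9 = gtWeight (L.take k) p ∧ m'.reg 10 = geWeight (L.take k) p ∧
      Holds (m'.arr 2) Prod.fst ((L.take k).filter fun y => p < y.1) ∧
      Holds (m'.arr 3) Prod.snd ((L.take k).filter fun y => p < y.1) ∧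
      Holds (m'.arr 4) Prod.fst ((L.take k).filter fun y => y.1 < p) ∧
      Holds (m'.arr 5) Prod.snd ((L.take k).filter fun y => y.1 < p)) L.length 12 ?_ ?_ ?_ ?_
  · simp [Holds.nil]
  · rintro k m1 ⟨i6, i7, i8, i9, i10, i2, i3, i4, i5⟩ ha hk -
    have e2 : m1.reg 2 = 1 := by simp [ha.1 2 rfl, h2]
    have e4 : m1.reg 4 = p := by simp [ha.1 4 rfl, h4]
    have e0 : m1.arr 0 k = L[k].1 := by rw [ha.2 0 rfl]; exact ha0 k hk
    have e1 : m1.arr 1 k = L[k].2 := by rw [ha.2 1 rfl]; exact ha1 k hk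
    simp only [List.take_succ_eq_append_getElem hk, List.filter_append, gtWeight_append,
      geWeight_append]
    rcases lt_trichotomy p L[k].1 with hlt | heq | hgt
    · have : ¬ L[k].1 < p := hlt.le.not_gt
      simp [i6, i7, e0, e1, e4, e2, wp_ite, hlt, this, i8, i9, i10, hlt.le, i4, i5]
      exact ⟨i2.append rfl rfl, i3.append rfl rfl⟩
    · simp [i6, i7, e0, e1, e4, e2, wp_ite, ← heq, i8, i9, i10, i2, i3, i4, i5]
    · have : ¬ p < L[k].1 := hgt.le.not_gt
      simp [i6, i7, e0, e1, e4, e2, wp_ite, hgt, hgt.not_ge, hgt.le, i8, i9, i10, i2, i3]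
      exact ⟨i4.append rfl rfl, i5.append rfl rfl⟩
  · rintro k m1 ⟨i6, -⟩ ha
    have e0 : m1.reg 0 = L.length := by simp [ha.1 0 rfl, h0]
    simp [i6, e0]
  · rintro m1 t ⟨i6, i7, i8, i9, i10, i2, i3, i4, i5⟩ ha ht
    rw [List.take_length] at *
    refine h _ m1 (by omega) (by simp [ha.1 1 rfl]) (by simp [ha.1 4 rfl, h4]) i7 i8 i9 i10 i2
      i3 i4 i5

/-- Copy the key at the address in register `6`, advancing this address, to the cell of array `7`
whose address is in register `13`, advancing this address too. -/
def copyKey : Cmd :=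
  .load 12 0 6 ;; .store 7 13 12 ;; .arith .add 6 6 2 ;; .arith .add 13 13 2

/-- Compute a pivot in register `4`: the median, found by recursion, of the medians of the groups
of five keys. -/
def medianOfMedians : Cmd :=
  .const 6 0 ;; fillOnes 2 6 0 6 ;;
  .const 6 0 ;; .const 7 0 ;; .const 8 5 ;; .const 9 3 ;; .const 10 4 ;; .arith .sub 10 0 10 ;;
  .loop 6 10 (.const 13 0 ;; copyKey ;; copyKey ;; copyKey ;; copyKey ;; copyKey ;;
    .self [8, 9] [7, 6] 12 ;; .store 8 7 12 ;; .arith .add 7 7 2) ;;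
  .const 11 2 ;; .arith .div 11 7 11 ;; .self [7, 11] [8, 6] 4

/-- Weighted selection among the items in the arrays `0` (keys) and `1` (weights), whose number is
in register `0`: register `0` receives the key of the weighted rank in register `1`. With up to
`40` items the first key is the pivot, so that the recursion on a group of five keys does not itself
compute a median of medians. -/
def select : Cmd :=
  .const 2 1 ;; .const 3 0 ;;
  .ite 3 0
    (.load 4 0 3 ;; .const 5 40 ;; .ite 5 0 medianOfMedians .skip ;;
      partitionItems ;;
      .ite 9 1
        (.ite 10 1 (.arith .sub 1 1 10 ;; .self [8, 1] [4, 5] 0) (.move 0 4))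
        (.self [7, 1] [2, 3] 0))
    (.const 0 0)

/-- `select` works for the list `L` of items. The constant `600` for up to `40` items bounds the
time for a group of five; the constant `10000` is such that `10000 * (N / 5)` for the medians and
`10000 * 7 * N / 10`, up to rounding, for the larger side leave enough for the rest. -/
def SelectCorrect (L : List (ℝ × ℝ)) : Prop :=
  ∀ (T : ℝ) (m : Mem), GoodItems L → 0 < T → m.reg 0 = L.length → m.reg 1 = T →
    Holds (m.arr 0) Prod.fst L → Holds (m.arr 1) Prod.snd L →
    Wp select select (fun t m' => IsWeightedRank L T (m'.reg 0) ∧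
      t ≤ 10000 * L.length + 50 ∧ (L.length ≤ 40 → t ≤ 600 * L.length + 50)) m

theorem select_enter_leave {m m' : Mem} {x y a b z : ℕ} (hab : a ≠ b)
    (h : AgreeOff select (m.enter [x, y] [a, b]) m') :
    m.leave m' [a, b] z = m.setReg z (m'.reg 0) := by
  have h0 := h.2 0 rfl
  have h1 := h.2 1 rfl
  simp at h0 h1
  unfold Mem.leave Mem.setReg
  congr 1
  ext c i
  by_cases hca : c = a
  · subst hca
    simp [h0]
  · by_cases hcb : c = b
    · subst hcb
      simp [hab, h1]
    · simp [hca, hcb]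

theorem SelectCorrect.wp_self {L : List (ℝ × ℝ)} (hS : SelectCorrect L) {T : ℝ} {m : Mem}
    {Q : ℕ → Mem → Prop} {x y a b z : ℕ} (hab : a ≠ b) (hL : GoodItems L) (hT : 0 < T)
    (hx : m.reg x = L.length) (hy : m.reg y = T) (ha : Holds (m.arr a) Prod.fst L)
    (hb : Holds (m.arr b) Prod.snd L)
    (h : ∀ t r, IsWeightedRank L T r → t ≤ 10000 * L.length + 55 →
      (L.length ≤ 40 → t ≤ 600 * L.length + 55) → Q t (m.setReg z r)) :
    Wp select (.self [x, y] [a, b] z) Q m := by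
  refine _root_.wp_self (by simp [hab]) ?_
  refine (hS T _ hL hT (by simpa using hx) (by simpa using hy) ha hb).frame.mono ?_
  rintro t m' ⟨⟨h1, h2, h3⟩, h4⟩
  rw [select_enter_leave hab h4]
  exact h _ _ h1 (by simp; omega) (fun h' => by have := h3 h'; simp; omega)

theorem SelectCorrect.wp_call {L : List (ℝ × ℝ)} (hS : SelectCorrect L) {T : ℝ} {m : Mem} {p : Cmd}
    {Q : ℕ → Mem → Prop} {x y a b z : ℕ} (hab : a ≠ b) (hL : GoodItems L) (hT : 0 < T)
    (hx : m.reg x = L.length) (hy : m.reg y = T) (ha : Holds (m.arr a) Prod.fst L)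
    (hb : Holds (m.arr b) Prod.snd L)
    (h : ∀ t r, IsWeightedRank L T r → t ≤ 10000 * L.length + 55 → Q t (m.setReg z r)) :
    Wp p (.call select [x, y] [a, b] z) Q m := by
  refine _root_.wp_call (by simp [hab]) ?_
  refine (hS T _ hL hT (by simpa using hx) (by simpa using hy) ha hb).frame.mono ?_
  rintro t m' ⟨⟨h1, h2, h3⟩, h4⟩
  rw [select_enter_leave hab h4]
  exact h _ _ h1 (by simp; omega)

/-- At least three of five keys are on either side of their median. -/
theorem IsWeightedRank.median_of_five {X : List (ℝ × ℝ)} (hX : GoodItems X)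
    (h1 : ∀ y ∈ X, y.2 = 1) (h5 : X.length = 5) {x : ℝ} (hx : IsWeightedRank X 3 x) :
    3 ≤ (X.countP fun y => x ≤ y.1) ∧ 3 ≤ (X.countP fun y => y.1 ≤ x) := by
  obtain ⟨h2, h3⟩ := hx.of_unit hX h1 (by rw [h5]; norm_num)
  have := countP_le_add_countP_lt X x
  have h2' : (X.countP fun y => x < y.1) < 3 := by exact_mod_cast h2
  have h3' : 3 ≤ (X.countP fun y => x ≤ y.1) := by exact_mod_cast h3
  exact ⟨h3', by omega⟩

theorem wp_copyKey {p : Cmd} {m : Mem} {Q : ℕ → Mem → Prop} (q j : ℕ) (h6 : m.reg 6 = q)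
    (h13 : m.reg 13 = j) (h2 : m.reg 2 = 1)
    (h : ∀ m', m'.reg 6 = ((q + 1 : ℕ) : ℝ) → m'.reg 13 = ((j + 1 : ℕ) : ℝ) →
      (∀ x, x ≠ 6 → x ≠ 12 → x ≠ 13 → m'.reg x = m.reg x) → (∀ b, b ≠ 7 → m'.arr b = m.arr b) →
      m'.arr 7 = Function.update (m.arr 7) j (m.arr 0 q) → Q 4 m') :
    Wp p copyKey Q m := by
  simp [copyKey, h6, h13, h2]
  refine h _ (by simp) (by simp) ?_ ?_ (by simp)
  · intro x h1 h2 h3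
    simp [h1, h2, h3]
  · intro b hb
    simp [hb]

theorem wp_medianOfMedians {L : List (ℝ × ℝ)} (hL : GoodItems L) (h40 : 40 < L.length)
    (ih : ∀ L' : List (ℝ × ℝ), L'.length < L.length → SelectCorrect L') {m : Mem}
    (h0 : m.reg 0 = L.length) (h2 : m.reg 2 = 1) (ha0 : Holds (m.arr 0) Prod.fst L) :
    Wp select medianOfMedians (fun t m' =>
      t ≤ 10000 * (L.length / 5) + 650 * L.length + 200 ∧ ∃ p, m'.reg 4 = p ∧ 0 ≤ p ∧
      2 * (L.filter fun y => p < y.1).length + 3 * (L.length / 5) ≤ 2 * L.length ∧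
      2 * (L.filter fun y => y.1 < p).length + 3 * (L.length / 5) ≤ 2 * L.length) m := by
  unfold medianOfMedians
  simp only [wp_seq, wp_const]
  refine wp_fillOnes (N := L.length) (by decide) (by decide) (by simp [h2]) (by simp)
    (by simp [h0]) ?_
  intro t1 m1 ht1 hr1 hb1 ho1
  simp only [wp_sub]
  refine wp_loop_count (fun k m' => m'.reg 6 = ((5 * k : ℕ) : ℝ) ∧ m'.reg 7 = k ∧
    (∀ i < L.length, m'.arr 6 i = 1) ∧ ∃ Md : List (ℝ × ℝ), Md.length = k ∧
      Holds (m'.arr 8) Prod.fst Md ∧ GoodItems Md ∧ (∀ y ∈ Md, y.2 = 1) ∧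
      ∀ p : ℝ, 3 * (Md.countP fun y => p ≤ y.1) ≤ ((L.take (5 * k)).countP fun y => p ≤ y.1) ∧
        3 * (Md.countP fun y => y.1 ≤ p) ≤ ((L.take (5 * k)).countP fun y => y.1 ≤ p))
      (L.length / 5) 3200 ?_ ?_ ?_ ?_
  · refine ⟨by simp, by simp, by simpa using ho1, [], rfl, Holds.nil, ?_, ?_, by simp⟩ <;>
      intro y hy <;> simp at hy
  · rintro k m2 ⟨i6, i7, io, Md, hMl, hMh, hMg, hM1, hMp⟩ ha hk -
    have h5k : 5 * k + 5 ≤ L.length := by omega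
    have e2 : m2.reg 2 = 1 := by simp [ha.1 2 rfl, hr1, h2]
    have e8 : m2.reg 8 = 5 := by simp [ha.1 8 rfl]
    have e9 : m2.reg 9 = 3 := by simp [ha.1 9 rfl]
    have ea : m2.arr 0 = m.arr 0 := by rw [ha.2 0 rfl]; simp [hb1]
    have f0 : m.arr 0 (5 * k) = L[5 * k].1 := ha0 _ _
    have f1 : m.arr 0 (5 * k + 1) = L[5 * k + 1].1 := ha0 _ _
    have f2 : m.arr 0 (5 * k + 2) = L[5 * k + 2].1 := ha0 _ _
    have f3 : m.arr 0 (5 * k + 3) = L[5 * k + 3].1 := ha0 _ _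
    have f4 : m.arr 0 (5 * k + 4) = L[5 * k + 4].1 := ha0 _ _
    set X : List (ℝ × ℝ) := [(L[5 * k].1, 1), (L[5 * k + 1].1, 1), (L[5 * k + 2].1, 1),
      (L[5 * k + 3].1, 1), (L[5 * k + 4].1, 1)] with hX
    have hXg : GoodItems X := by
      simp [hX, GoodItems, (hL _ (List.getElem_mem _)).1]
    have hX1 : ∀ y ∈ X, y.2 = 1 := by simp [hX]
    -- the groups that have been treated are the first `5 * k` items
    have htake : L.take (5 * (k + 1)) = L.take (5 * k) ++
        [L[5 * k], L[5 * k + 1], L[5 * k + 2], L[5 * k + 3], L[5 * k + 4]] := by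
      rw [show 5 * (k + 1) = 5 * k + 1 + 1 + 1 + 1 + 1 by ring]
      simp only [List.take_succ_eq_append_getElem (by omega : 5 * k + 1 + 1 + 1 + 1 < L.length),
        List.take_succ_eq_append_getElem (by omega : 5 * k + 1 + 1 + 1 < L.length),
        List.take_succ_eq_append_getElem (by omega : 5 * k + 1 + 1 < L.length),
        List.take_succ_eq_append_getElem (by omega : 5 * k + 1 < L.length),
        List.take_succ_eq_append_getElem (by omega : 5 * k < L.length), List.append_assoc]
      rfl
    simp only [wp_const, wp_seq]
    refine wp_copyKey (5 * k) 0 (by simp [i6]) (by simp) (by simp [e2]) ?_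
    intro m3 x6 x13 xr xb x7
    refine wp_copyKey _ _ x6 x13 (by simp [xr, e2]) ?_
    intro m4 y6 y13 yr yb y7
    refine wp_copyKey _ _ y6 y13 (by simp [xr, yr, e2]) ?_
    intro m5 z6 z13 zr zb z7
    refine wp_copyKey _ _ z6 z13 (by simp [xr, yr, zr, e2]) ?_
    intro m6 u6 u13 ur ub u7
    refine wp_copyKey _ _ u6 u13 (by simp [xr, yr, zr, ur, e2]) ?_
    intro m7 v6 v13 vr vb v7
    have w7 : Holds (m7.arr 7) Prod.fst X := by
      rw [v7, u7, z7, y7, x7, ub 0 (by decide), zb 0 (by decide), yb 0 (by decide),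
        xb 0 (by decide)]
      intro i hi
      simp only [hX, List.length_cons, List.length_nil] at hi
      interval_cases i <;> simp [hX, ea, f0, f1, f2, f3, f4]
    have w6 : m7.arr 6 = m2.arr 6 := by
      rw [vb _ (by decide), ub _ (by decide), zb _ (by decide), yb _ (by decide), xb _ (by decide)]
      rfl
    have w8 : m7.arr 8 = m2.arr 8 := by
      rw [vb _ (by decide), ub _ (by decide), zb _ (by decide), yb _ (by decide), xb _ (by decide)]
      rfl
    have wr : ∀ x, x ≠ 6 → x ≠ 12 → x ≠ 13 → m7.reg x = m2.reg x := by
      intro x h1 h2 h3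
      rw [vr _ h1 h2 h3, ur _ h1 h2 h3, zr _ h1 h2 h3, yr _ h1 h2 h3, xr _ h1 h2 h3]
      simp [h3]
    refine (ih X (by simp [hX]; omega)).wp_self (T := 3) (by decide) hXg (by norm_num)
      (by simp [wr, e8, hX]) (by simp [wr, e9]) w7 ?_ ?_
    · intro i hi
      rw [w6, io i (by simp [hX] at hi; omega), hX1 _ (List.getElem_mem _)]
    intro t r hr ht ht'
    simp [wr, i7, e2, v6, w6, w8]
    refine ⟨⟨by ring, io, Md ++ [(r, 1)], by simp [hMl], ?_, ?_, ?_, ?_⟩, ?_⟩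
    · exact hMh.append hMl.symm rfl
    · intro y hy
      rcases List.mem_append.1 hy with hy | hy
      · exact hMg y hy
      · simp at hy; subst hy; exact ⟨hr.2.1, one_pos⟩
    · intro y z hy
      rcases List.mem_append.1 hy with hy | hy
      · exact hM1 _ hy
      · simp at hy; exact hy.2
    · intro p
      -- a median `r ≥ p` brings three keys `≥ p` with it, and a median `r ≤ p` three keys `≤ p`
      obtain ⟨c1, c2⟩ := hr.median_of_five hXg hX1 rfl
      have d1 : p ≤ r → (X.countP fun y => r ≤ y.1) ≤ X.countP fun y => p ≤ y.1 := fun h =>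
        List.countP_mono_left fun y _ hy => by simp at hy ⊢; exact h.trans hy
      have d2 : r ≤ p → (X.countP fun y => y.1 ≤ r) ≤ X.countP fun y => y.1 ≤ p := fun h =>
        List.countP_mono_left fun y _ hy => by simp at hy ⊢; exact hy.trans h
      have e1 : ((L.take (5 * (k + 1))).countP fun y => p ≤ y.1) =
          ((L.take (5 * k)).countP fun y => p ≤ y.1) + X.countP fun y => p ≤ y.1 := by
        rw [htake, List.countP_append]; simp [hX, List.countP_cons]
      have e2 : ((L.take (5 * (k + 1))).countP fun y => y.1 ≤ p) =
          ((L.take (5 * k)).countP fun y => y.1 ≤ p) + X.countP fun y => y.1 ≤ p := by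
        rw [htake, List.countP_append]; simp [hX, List.countP_cons]
      have := hMp p
      rw [e1, e2, List.countP_append, List.countP_append]
      simp only [List.countP_cons, List.countP_nil, decide_eq_true_eq]
      constructor
      · split_ifs with h <;> [have := d1 h; skip] <;> omega
      · split_ifs with h <;> [have := d2 h; skip] <;> omega
    · have := ht' (by simp [hX])
      simp [hX] at this
      omega
  · rintro k m2 ⟨i6, -⟩ ha
    have e0 : m2.reg 10 = L.length - 4 := by simp [ha.1 10 rfl, hr1, h0]
    rw [i6, e0, lt_sub_iff_add_lt]
    norm_cast
    omega
  · rintro m2 t2 ⟨i6, i7, io, Md, hMl, hMh, hMg, hM1, hMp⟩ ha ht2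
    simp
    refine (ih Md (by omega)).wp_self (T := ((L.length / 5 : ℕ) : ℝ) / 2) (by decide) hMg ?_
      (by simp [i7, hMl]) (by simp [i7]) (by simpa using hMh) ?_ ?_
    · have : 0 < L.length / 5 := by omega
      positivity
    · intro i hi
      have := hM1 _ (List.getElem_mem hi)
      simp [io i (by omega), this]
    intro t p hp ht _
    -- half of the medians are on either side of the pivot `p`, each with three keys of its group
    obtain ⟨c1, c2⟩ := hp.of_unit hMg hM1 (by
      rw [hMl]; linarith [Nat.cast_nonneg (α := ℝ) (L.length / 5)])
    have c1' : 2 * (Md.countP fun y => p < y.1) < L.length / 5 := by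
      have : (2 : ℝ) * (Md.countP fun y => p < y.1 : ℕ) < (L.length / 5 : ℕ) := by linarith
      exact_mod_cast this
    have c2' : L.length / 5 ≤ 2 * (Md.countP fun y => p ≤ y.1) := by
      have : ((L.length / 5 : ℕ) : ℝ) ≤ 2 * (Md.countP fun y => p ≤ y.1 : ℕ) := by linarith
      exact_mod_cast this
    have h1 := countP_le_add_countP_lt Md p
    have h2 := countP_le_add_countP_lt L p
    have h3 := countP_lt_add_countP_le L p
    have h4 : ∀ P : ℝ × ℝ → Bool, (L.take (5 * (L.length / 5))).countP P ≤ L.countP P :=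
      fun P => (List.take_sublist _ _).countP_le
    have h5 := h4 (fun y => p ≤ y.1)
    have h6 := h4 (fun y => y.1 ≤ p)
    have h7 := hMp p
    simp only [← List.countP_eq_length_filter]
    refine ⟨by omega, by simpa using hp.2.1, ?_, ?_⟩ <;> simp only [Mem.setReg_reg, if_true] <;>
      omega

theorem selectCorrect (L : List (ℝ × ℝ)) : SelectCorrect L := by
  induction h : L.length using Nat.strong_induction_on generalizing L with
  | _ N ih =>
  subst h
  replace ih : ∀ L' : List (ℝ × ℝ), L'.length < L.length → SelectCorrect L' :=
    fun L' h => ih _ h L' rfl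
  intro T m hL hT h0 h1 ha0 ha1
  unfold select
  simp only [wp_seq, wp_const]
  rw [wp_ite]
  rcases Nat.eq_zero_or_pos L.length with hz | hpos
  · have := List.length_eq_zero_iff.1 hz
    subst this
    simp [h0, IsWeightedRank, hT]
  have hposR : (0 : ℝ) < L.length := by exact_mod_cast hpos
  simp [h0, hposR]
  -- the pivot leaves enough of the time bound for the recursion on either side
  have key : Wp select (.ite 5 0 medianOfMedians .skip) (fun t m' => (∃ p, m'.reg 4 = p ∧ 0 ≤ p ∧
      (L.filter fun y => p < y.1).length < L.length ∧
      (L.filter fun y => y.1 < p).length < L.length ∧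
      t + 10000 * (L.filter fun y => p < y.1).length + 12 * L.length + 200 ≤ 10000 * L.length ∧
      t + 10000 * (L.filter fun y => y.1 < p).length + 12 * L.length + 200 ≤ 10000 * L.length ∧
      (L.length ≤ 40 → t = 2)))
      ((((m.setReg 2 1).setReg 3 0).setReg 4 (m.arr 0 0)).setReg 5 40) := by
    rw [wp_ite]
    split_ifs with h40
    · simp [h0] at h40
      refine (wp_medianOfMedians hL h40 ih (by simp [h0]) (by simp) (by simpa using ha0)).mono ?_
      rintro t m' ⟨ht, p, h4, hp, g1, g2⟩
      exact ⟨p, h4, hp, by omega, by omega, by omega, by omega, by omega⟩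
    · simp [h0] at h40
      have f0 := ha0 0 hpos
      have hmem := List.getElem_mem hpos
      have g1 : (L.filter fun y => L[0].1 < y.1).length < L.length :=
        List.length_filter_lt_length_iff_exists.2 ⟨_, hmem, by simp⟩
      have g2 : (L.filter fun y => y.1 < L[0].1).length < L.length :=
        List.length_filter_lt_length_iff_exists.2 ⟨_, hmem, by simp⟩
      simp [f0]
      refine ⟨(hL _ hmem).1, ?_, ?_, ?_, ?_⟩
      exacts [⟨_, ⟨_, hmem⟩, le_rfl⟩, ⟨_, ⟨_, hmem⟩, le_rfl⟩, by omega, by omega]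
  refine key.frame.mono ?_
  rintro t1 m1 ⟨⟨p, r4, hp, g1, g2, g3, g4, g5⟩, ha⟩
  refine wp_partitionItems (L := L) (p := p) (by simp [ha.1 0 rfl, h0]) (by simp [ha.1 2 rfl]) r4
    (by simpa [ha.2 0 rfl] using ha0) (by simpa [ha.2 1 rfl] using ha1) ?_
  intro t2 m2 ht2 k1 k4 k7 k8 k9 k10 j2 j3 j4 j5
  have k1' : m2.reg 1 = T := by simp [k1, ha.1 1 rfl, h1]
  rw [wp_ite, k9, k1']
  split_ifs with hc
  · rw [wp_ite, k10, k1']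
    split_ifs with hc'
    · simp
      refine (ih _ g2).wp_self (T := T - geWeight L p) (by decide) (hL.filter _) (by linarith)
        (by simp [k8]) (by simp [k1', k10]) (by simpa using j4) (by simpa using j5) ?_
      intro t r hr ht ht'
      refine ⟨?_, ?_, ?_⟩
      · simpa using hr.of_filter_lt hL hc'
      · omega
      · omega
    · simp
      refine ⟨?_, ?_, ?_⟩
      · rw [k4]; exact ⟨hc, hp, Or.inl (not_lt.1 hc')⟩
      · omega
      · omega
  · refine (ih _ g1).wp_self (T := T) (by decide) (hL.filter _) hT
        (by simp [k7]) (by simp [k1']) j2 j3 ?_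
    intro t r hr ht ht'
    refine ⟨?_, ?_, ?_⟩
    · simpa using hr.of_filter_gt hL (not_lt.1 hc)
    · omega
    · omega

/-! ### Taking the heaviest items -/

/-- The items `0, …, M - 1` with keys `key` and weights `wt`, as a list. -/
def itemList (M : ℕ) (key wt : ℕ → ℝ) : List (ℝ × ℝ) := (List.range M).map fun i => (key i, wt i)

@[simp] theorem length_itemList (M : ℕ) (key wt : ℕ → ℝ) : (itemList M key wt).length = M := by
  simp [itemList]

theorem holds_fst_itemList (M : ℕ) (key wt : ℕ → ℝ) : Holds key Prod.fst (itemList M key wt) := by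
  intro i hi
  simp [itemList]

theorem holds_snd_itemList (M : ℕ) (key wt : ℕ → ℝ) : Holds wt Prod.snd (itemList M key wt) := by
  intro i hi
  simp [itemList]

/-- The weight of the items before `M` whose key is greater than `x`. -/
noncomputable def aboveWeight (key wt : ℕ → ℝ) (x : ℝ) (M : ℕ) : ℝ :=
  ∑ i ∈ Finset.range M, if x < key i then wt i else 0

/-- The weight of the items before `M` whose key is `x`. -/
noncomputable def tieWeight (key wt : ℕ → ℝ) (x : ℝ) (M : ℕ) : ℝ :=
  ∑ i ∈ Finset.range M, if key i = x then wt i else 0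

theorem gtWeight_itemList (M : ℕ) (key wt : ℕ → ℝ) (x : ℝ) :
    gtWeight (itemList M key wt) x = aboveWeight key wt x M := by
  induction M with
  | zero => rfl
  | succ M ih =>
    rw [itemList, List.range_succ, List.map_append, gtWeight_append, ← itemList, ih, aboveWeight,
      aboveWeight, Finset.sum_range_succ]
    simp

theorem geWeight_itemList (M : ℕ) (key wt : ℕ → ℝ) (x : ℝ) :
    geWeight (itemList M key wt) x = aboveWeight key wt x M + tieWeight key wt x M := by
  induction M with
  | zero => simp [itemList, aboveWeight, tieWeight]
  | succ M ih =>
    rw [itemList, List.range_succ, List.map_append, geWeight_append, ← itemList, ih, aboveWeight,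
      aboveWeight, Finset.sum_range_succ, tieWeight, tieWeight, Finset.sum_range_succ]
    rcases lt_trichotomy x (key M) with h | h | h
    · simp [h, h.le, h.ne']; ring
    · simp [h]; ring
    · simp [h.not_gt, h.not_ge, h.ne]

/-- The items to be taken: those of key greater than `x`, and those of key `x` as long as the
total weight has not reached `T`. -/
def Taken (key wt : ℕ → ℝ) (T x : ℝ) (M i : ℕ) : Prop :=
  x < key i ∨ key i = x ∧ aboveWeight key wt x M + tieWeight key wt x i < T

open Classical in
/-- The list of the items to be taken, in increasing order. -/
noncomputable def takenList (key wt : ℕ → ℝ) (T x : ℝ) (M : ℕ) : List ℕ :=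
  (List.range M).filter fun i => Taken key wt T x M i

theorem mem_takenList {key wt : ℕ → ℝ} {T x : ℝ} {M i : ℕ} :
    i ∈ takenList key wt T x M ↔ i < M ∧ Taken key wt T x M i := by
  simp [takenList]

theorem takenList_pairwise (key wt : ℕ → ℝ) (T x : ℝ) (M : ℕ) :
    (takenList key wt T x M).Pairwise (· < ·) :=
  List.Pairwise.filter _ List.pairwise_lt_range

theorem tieWeight_mono {key wt : ℕ → ℝ} {x : ℝ} {i j : ℕ} (hij : i ≤ j)
    (hw : ∀ k < j, 0 ≤ wt k) : tieWeight key wt x i ≤ tieWeight key wt x j := by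
  refine Finset.sum_le_sum_of_subset_of_nonneg (Finset.range_mono hij) fun k hk _ => ?_
  have := hw k (Finset.mem_range.1 hk)
  split_ifs <;> simp [this]

/-- The weight of the taken items is at least `T` if there is enough to take, and it exceeds `T` by
less than the weight of an item. -/
theorem sum_takenList {key wt : ℕ → ℝ} {T x B : ℝ} {M : ℕ} (hw : ∀ i < M, 0 ≤ wt i)
    (hB : ∀ i < M, wt i ≤ B) (hB0 : 0 < B) (hT : aboveWeight key wt x M ≤ T) :
    min T (aboveWeight key wt x M + tieWeight key wt x M) ≤
        ((takenList key wt T x M).map wt).sum ∧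
      ((takenList key wt T x M).map wt).sum < T + B := by
  classical
  set A := aboveWeight key wt x M with hA
  -- `s` is the weight of the items of key `x` that are taken among the first `k`
  have hind : ∀ k ≤ M, ∃ s, (((List.range k).filter fun i => Taken key wt T x M i).map wt).sum =
      aboveWeight key wt x k + s ∧ (A + tieWeight key wt x k < T → s = tieWeight key wt x k) ∧
      (T ≤ A + tieWeight key wt x k → T ≤ A + s) ∧ A + s < T + B := by
    intro k hk
    induction k with
    | zero => exact ⟨0, by simp [aboveWeight], by simp [tieWeight], by simp [tieWeight],
        by linarith⟩
    | succ k ih =>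
      obtain ⟨s, h1, h2, h3, h4⟩ := ih (by omega)
      have hw' := hw k (by omega)
      have hB' := hB k (by omega)
      have e1 : aboveWeight key wt x (k + 1) = aboveWeight key wt x k +
        if x < key k then wt k else 0 := by simp [aboveWeight, Finset.sum_range_succ]
      have e2 : tieWeight key wt x (k + 1) = tieWeight key wt x k +
        if key k = x then wt k else 0 := by simp [tieWeight, Finset.sum_range_succ]
      rw [List.range_succ, List.filter_append, List.map_append, List.sum_append, h1, e1, e2]
      rcases lt_trichotomy x (key k) with h | h | h
      · exact ⟨s, by simp [Taken, h]; ring, by simpa [h.ne'] using h2,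
          by simpa [h.ne'] using h3, h4⟩
      · by_cases hc : A + tieWeight key wt x k < T
        · have := h2 hc
          refine ⟨s + wt k, by simp [Taken, ← h, ← hA, hc]; ring,
            fun _ => by simp [← h, this], ?_, ?_⟩
          · intro h5; simp [← h, ← this] at h5; linarith
          · linarith
        · have := h3 (not_lt.1 hc)
          refine ⟨s, by simp [Taken, ← h, ← hA, hc], ?_, fun _ => this, h4⟩
          intro h5; simp [← h] at h5; linarith
      · exact ⟨s, by simp [Taken, h.not_gt, h.ne], by simpa [h.ne] using h2,
          by simpa [h.ne] using h3, h4⟩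
  obtain ⟨s, h1, h2, h3, h4⟩ := hind M le_rfl
  rw [takenList, h1]
  refine ⟨?_, h4⟩
  rcases lt_or_ge (A + tieWeight key wt x M) T with h | h
  · rw [h2 h]; exact min_le_right _ _
  · exact (min_le_left _ _).trans (h3 h)

/-- The items are in the arrays `0` (keys) and `1` (weights), their number, `T` and `x` in the
registers `0`, `1`, `2`. The taken items are listed in array `2` and counted in register `0`. -/
def takeItems : Cmd :=
  .const 3 1 ;; .const 4 0 ;; .const 5 0 ;;
  .loop 4 0 (.load 6 0 4 ;; .load 7 1 4 ;; .ite 2 6 (.arith .add 5 5 7) .skip ;;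
    .arith .add 4 4 3) ;;
  .const 4 0 ;; .const 8 0 ;;
  .loop 4 0 (.load 6 0 4 ;; .load 7 1 4 ;;
    .ite 2 6 (.store 2 8 4 ;; .arith .add 8 8 3)
      (.ite 6 2 .skip
        (.ite 5 1 (.store 2 8 4 ;; .arith .add 8 8 3) .skip ;; .arith .add 5 5 7)) ;;
    .arith .add 4 4 3) ;;
  .move 0 8

theorem wp_takeItems {M : ℕ} {T x : ℝ} {m : Mem} (h0 : m.reg 0 = M) (h1 : m.reg 1 = T)
    (h2 : m.reg 2 = x) :
    Wp takeItems takeItems (fun t m' => t ≤ 16 * M + 10 ∧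
      m'.reg 0 = (((takenList (m.arr 0) (m.arr 1) T x M).length : ℕ) : ℝ) ∧
      Holds (m'.arr 2) (Nat.cast : ℕ → ℝ) (takenList (m.arr 0) (m.arr 1) T x M)) m := by
  classical
  unfold takeItems
  simp only [wp_seq, wp_const]
  refine wp_loop_count (fun k m' => m'.reg 4 = k ∧
    m'.reg 5 = aboveWeight (m.arr 0) (m.arr 1) x k) M 6 ?_ ?_ ?_ ?_
  · simp [aboveWeight]
  · rintro k m1 ⟨i4, i5⟩ ha hk -
    have e2 : m1.reg 2 = x := by simp [ha.1 2 rfl, h2]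
    have e3 : m1.reg 3 = 1 := by simp [ha.1 3 rfl]
    have ea : m1.arr 0 = m.arr 0 := ha.2 0 rfl
    have eb : m1.arr 1 = m.arr 1 := ha.2 1 rfl
    by_cases hc : x < m.arr 0 k <;>
      simp [wp_ite, i4, i5, e2, e3, aboveWeight, Finset.sum_range_succ, hc, ea, eb]
  · rintro k m1 ⟨i4, -⟩ ha
    have e0 : m1.reg 0 = M := by simp [ha.1 0 rfl, h0]
    simp [i4, e0]
  rintro m1 t1 ⟨-, j5⟩ ha ht1
  have f0 : m1.reg 0 = M := by simp [ha.1 0 rfl, h0]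
  have f1 : m1.reg 1 = T := by simp [ha.1 1 rfl, h1]
  have f2 : m1.reg 2 = x := by simp [ha.1 2 rfl, h2]
  have f3 : m1.reg 3 = 1 := by simp [ha.1 3 rfl]
  have fa : m1.arr 0 = m.arr 0 := ha.2 0 rfl
  have fb : m1.arr 1 = m.arr 1 := ha.2 1 rfl
  clear ha
  set l : ℕ → List ℕ := fun k =>
    (List.range k).filter fun i => Taken (m.arr 0) (m.arr 1) T x M i with hl
  have hl1 : ∀ k, l (k + 1) = l k ++ if Taken (m.arr 0) (m.arr 1) T x M k then [k] else [] := by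
    intro k
    simp only [hl, List.range_succ, List.filter_append]
    split_ifs with h <;> simp [h]
  refine wp_loop_count (fun k m' => m'.reg 4 = k ∧
    m'.reg 5 = aboveWeight (m.arr 0) (m.arr 1) x M + tieWeight (m.arr 0) (m.arr 1) x k ∧
    m'.reg 8 = (l k).length ∧ Holds (m'.arr 2) (Nat.cast : ℕ → ℝ) (l k)) M 10 ?_ ?_ ?_ ?_
  · simp [tieWeight, j5, hl, Holds.nil]
  · rintro k m2 ⟨i4, i5, i8, i2⟩ ha hk -
    have e1 : m2.reg 1 = T := by simp [ha.1 1 rfl, f1]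
    have e2 : m2.reg 2 = x := by simp [ha.1 2 rfl, f2]
    have e3 : m2.reg 3 = 1 := by simp [ha.1 3 rfl, f3]
    have ea : m2.arr 0 = m.arr 0 := by simp [ha.2 0 rfl, fa]
    have eb : m2.arr 1 = m.arr 1 := by simp [ha.2 1 rfl, fb]
    have et : tieWeight (m.arr 0) (m.arr 1) x (k + 1) = tieWeight (m.arr 0) (m.arr 1) x k +
        if m.arr 0 k = x then m.arr 1 k else 0 := by simp [tieWeight, Finset.sum_range_succ]
    rw [hl1, et]
    rcases lt_trichotomy x (m.arr 0 k) with h | h | h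
    · simp [wp_ite, i4, i5, i8, e1, e2, e3, ea, eb, h, h.ne', Taken]
      exact i2.append rfl rfl
    · by_cases hc : aboveWeight (m.arr 0) (m.arr 1) x M + tieWeight (m.arr 0) (m.arr 1) x k < T
      · simp [wp_ite, i4, i5, i8, e1, e2, e3, ea, eb, ← h, Taken, hc]
        exact ⟨by ring, i2.append rfl rfl⟩
      · simp [wp_ite, i4, i5, i8, e1, e2, e3, ea, eb, ← h, Taken, hc]
        exact ⟨by ring, i2⟩
    · simp [wp_ite, i4, i5, i8, e1, e2, e3, ea, eb, h, h.ne, h.not_gt, Taken]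
      exact ⟨h.le, i2⟩
  · rintro k m2 ⟨i4, -⟩ ha
    have e0 : m2.reg 0 = M := by simp [ha.1 0 rfl, f0]
    simp [i4, e0]
  rintro m2 t2 ⟨i4, i5, i8, i2⟩ ha ht2
  simp
  exact ⟨by omega, i8, i2⟩

/-- `x` is the weight of the entry of rank `k` among the entries in `A`, or `0` if there are fewer.
For nonnegative weights this says that `x = rankWeight A w k`. -/
def IsRank {E : Type*} (A : Finset E) (w : E → ℝ) (k : ℕ) (x : ℝ) : Prop :=
  (A.filter fun e => x < w e).card < k ∧ 0 ≤ x ∧ (k ≤ (A.filter fun e => x ≤ w e).card ∨ x = 0)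

theorem aboveWeight_one (key : ℕ → ℝ) (x : ℝ) (M : ℕ) :
    aboveWeight key (fun _ => 1) x M = (((Finset.range M).filter fun i => x < key i).card : ℕ) := by
  simp [aboveWeight]

theorem aboveWeight_add_tieWeight_one (key : ℕ → ℝ) (x : ℝ) (M : ℕ) :
    aboveWeight key (fun _ => 1) x M + tieWeight key (fun _ => 1) x M =
      (((Finset.range M).filter fun i => x ≤ key i).card : ℕ) := by
  rw [aboveWeight, tieWeight, ← Finset.sum_add_distrib, Finset.card_filter]
  push_cast
  refine Finset.sum_congr rfl fun i _ => ?_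
  rcases lt_trichotomy x (key i) with h | h | h
  · simp [h, h.le, h.ne']
  · simp [h]
  · simp [h.not_gt, h.not_ge, h.ne]

/-- The weights of `N` entries are in array `0`, and `N` and `b` in the registers `0` and `1`. The
`b` heaviest entries are listed in array `1` and counted in register `0`. Array `2` receives
their weights, decreased by the weight of rank `b + 1`. -/
def takeTop : Cmd :=
  .const 2 1 ;; .const 3 0 ;; fillOnes 2 3 0 3 ;; .arith .add 4 1 2 ;;
  .call select [0, 4] [0, 3] 5 ;;
  .call takeItems [0, 1, 5] [0, 3, 1] 6 ;;
  .const 3 0 ;;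
  .loop 3 6 (.load 7 1 3 ;; .load 7 0 7 ;; .arith .sub 7 7 5 ;; .store 2 3 7 ;;
    .arith .add 3 3 2) ;;
  .move 0 6

theorem wp_takeTop {N b : ℕ} {m : Mem} (h0 : m.reg 0 = N) (h1 : m.reg 1 = b)
    (hpos : ∀ i < N, 0 ≤ m.arr 0 i) :
    Wp takeTop takeTop (fun t m' => t ≤ 10100 * N + 200 ∧ m'.arr 0 = m.arr 0 ∧
      ∃ (x : ℝ) (js : List ℕ), IsRank (Finset.range N) (m.arr 0) (b + 1) x ∧
        js.Pairwise (· < ·) ∧ (∀ i ∈ js, i < N) ∧ js.length = min b N ∧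
        (∀ i ∈ js, x ≤ m.arr 0 i) ∧ (∀ i < N, i ∉ js → m.arr 0 i ≤ x) ∧
        m'.reg 0 = js.length ∧ Holds (m'.arr 1) (Nat.cast : ℕ → ℝ) js ∧
        Holds (m'.arr 2) (fun i => m.arr 0 i - x) js) m := by
  unfold takeTop
  simp only [wp_seq, wp_const]
  refine wp_fillOnes (N := N) (by decide) (by decide) (by simp) (by simp) (by simp [h0]) ?_
  intro t1 m1 ht1 hr1 hb1 ho1
  have r0 : m1.reg 0 = N := by simp [hr1, h0]
  have r1 : m1.reg 1 = b := by simp [hr1, h1]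
  have r2 : m1.reg 2 = 1 := by simp [hr1]
  have a0 : m1.arr 0 = m.arr 0 := by simp [hb1]
  clear hr1 hb1
  simp only [wp_add]
  set L := itemList N (m.arr 0) (fun _ => 1) with hL
  have hlen : L.length = N := by simp [hL]
  refine (selectCorrect L).wp_call (T := ((b + 1 : ℕ) : ℝ)) (by decide) ?_ (by positivity)
    (by simp [r0, hlen]) (by simp [r1, r2]) (by simpa [a0] using holds_fst_itemList _ _ _) ?_ ?_
  · intro y hy
    simp only [hL, itemList, List.mem_map, List.mem_range] at hy
    obtain ⟨i, hi, rfl⟩ := hy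
    exact ⟨hpos i hi, one_pos⟩
  · intro i hi
    simp [hL, itemList, ho1 i (hlen ▸ hi)]
  intro t2 x hx ht2
  have hrank : IsRank (Finset.range N) (m.arr 0) (b + 1) x := by
    obtain ⟨g1, g2, g3⟩ := hx
    rw [gtWeight_itemList, aboveWeight_one] at g1
    rw [geWeight_itemList, aboveWeight_add_tieWeight_one] at g3
    exact ⟨by exact_mod_cast g1, g2, g3.imp_left fun h => by exact_mod_cast h⟩
  have htaken : takenList (m.arr 0) (m1.arr 3) b x N = takenList (m.arr 0) (fun _ => 1) b x N := by
    classical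
    have hA : aboveWeight (m.arr 0) (m1.arr 3) x N = aboveWeight (m.arr 0) (fun _ => 1) x N :=
      Finset.sum_congr rfl fun i hi => by rw [ho1 i (Finset.mem_range.1 hi)]
    refine List.filter_congr fun i hi => ?_
    have hB : tieWeight (m.arr 0) (m1.arr 3) x i = tieWeight (m.arr 0) (fun _ => 1) x i :=
      Finset.sum_congr rfl fun j hj => by
        rw [ho1 j ((Finset.mem_range.1 hj).trans (List.mem_range.1 hi))]
    exact decide_eq_decide.2 (by simp only [Taken, hA, hB])
  set js := takenList (m.arr 0) (fun _ => 1) b x N with hjs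
  refine wp_call (by decide) ?_
  refine (wp_takeItems (M := N) (T := b) (x := x) (by simp [r0]) (by simp [r1])
    (by simp)).frame.mono ?_
  rintro t3 m3 ⟨⟨ht3, k0, k2⟩, ha3⟩
  have c0 := ha3.2 0 rfl
  simp [a0, htaken] at c0 k0 k2
  refine wp_loop_count (fun k m' => m'.reg 3 = k ∧
    Holds (m'.arr 2) (fun i => m.arr 0 i - x) (js.take k)) js.length 6 ?_ ?_ ?_ ?_
  · simp [Holds.nil]
  · rintro k m4 ⟨i3, i2⟩ ha hk -
    have e2 : m4.reg 2 = 1 := by simp [ha.1 2 rfl, r2]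
    have e5 : m4.reg 5 = x := by simp [ha.1 5 rfl]
    have e0 : m4.arr 0 = m.arr 0 := by simp [ha.2 0 rfl, c0]
    have e1 : m4.arr 1 k = js[k] := by simp [ha.2 1 rfl, k2 k hk]
    rw [List.take_succ_eq_append_getElem hk]
    simp [i3, e2, e5, e0, e1, -List.take_append_getElem]
    exact i2.append (by simp [hk.le]) rfl
  · rintro k m4 ⟨i3, -⟩ ha
    have e6 : m4.reg 6 = js.length := by simp [ha.1 6 rfl, k0]
    simp [i3, e6]
  rintro m4 t4 ⟨i3, i2⟩ ha ht4
  rw [List.take_length] at i2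
  have hmem : ∀ i ∈ js, i < N := fun i hi => (mem_takenList.1 hi).1
  have hsub : js.length ≤ N := by
    have : js.length ≤ (List.range N).length := List.length_filter_le _ _
    simpa using this
  have habove : ((Finset.range N).filter fun i => x < m.arr 0 i).card ≤ b :=
    Nat.lt_succ_iff.1 hrank.1
  have hlenjs : js.length = min b N := by
    obtain ⟨w1, w2⟩ := sum_takenList (key := m.arr 0) (wt := fun _ => 1) (T := b) (x := x) (B := 1)
      (M := N) (by simp) (by simp) one_pos (by rw [aboveWeight_one]; exact_mod_cast habove)
    rw [aboveWeight_add_tieWeight_one] at w1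
    simp only [← hjs, List.map_const', List.sum_replicate, nsmul_eq_mul, mul_one] at w1 w2
    norm_cast at w1 w2
    refine le_antisymm (le_min (by omega) hsub) (le_trans ?_ w1)
    rcases hrank.2.2 with h | h
    · omega
    · have : (Finset.range N).filter (fun i => x ≤ m.arr 0 i) = Finset.range N :=
        Finset.filter_true_of_mem fun i hi => h ▸ hpos i (Finset.mem_range.1 hi)
      rw [this, Finset.card_range]
  simp only [wp_move]
  refine ⟨?_, ?_, x, js, hrank, takenList_pairwise _ _ _ _ _, hmem, hlenjs, ?_, ?_, ?_, ?_, ?_⟩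
  · simp; omega
  · simp [ha.2 0 rfl, c0]
  · intro i hi
    rcases (mem_takenList.1 hi).2 with h | h
    · exact h.le
    · exact h.1.ge
  · intro i hi hn
    by_contra hc
    exact hn (mem_takenList.2 ⟨hi, Or.inl (not_le.1 hc)⟩)
  · simp [ha.1 6 rfl, k0]
  · simpa [ha.2 1 rfl] using k2
  · simpa using i2

/-! ### Bucket sort -/

/-- The list `l` sorted by the key `f`, with keys below `n`; equal keys keep their order. -/
def bucketList (f : ℕ → ℕ) (n : ℕ) (l : List ℕ) : List ℕ :=
  (List.range n).flatMap fun c => l.filter fun x => f x = c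

theorem bucketList_perm {f : ℕ → ℕ} {n : ℕ} {l : List ℕ} (h : ∀ x ∈ l, f x < n) :
    (bucketList f n l).Perm l := by
  have key : ∀ n, (bucketList f n l).Perm (l.filter fun x => f x < n) := by
    intro n
    induction n with
    | zero => simp [bucketList]
    | succ n ih =>
      rw [bucketList, List.range_succ, List.flatMap_append, ← bucketList]
      refine (ih.append_right _).trans ?_
      refine List.Perm.trans ?_ (List.filter_append_perm (fun x => f x < n)
        (l.filter fun x => f x < n + 1))
      rw [List.filter_filter, List.filter_filter]
      refine List.Perm.of_eq (congrArg₂ _ ?_ ?_)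
      · refine List.filter_congr fun x _ => ?_
        rw [← Bool.decide_and]
        exact decide_eq_decide.2 (by omega)
      · simp only [List.flatMap_cons, List.flatMap_nil, List.append_nil]
        refine List.filter_congr fun x _ => ?_
        rw [← decide_not, ← Bool.decide_and]
        exact decide_eq_decide.2 (by omega)
  have := key n
  rwa [List.filter_eq_self.2 fun x hx => by simpa using h x hx] at this

theorem bucketList_pairwise {f : ℕ → ℕ} {n : ℕ} {l : List ℕ} {R : ℕ → ℕ → Prop}
    (h : l.Pairwise R) :
    (bucketList f n l).Pairwise fun x y => f x < f y ∨ f x = f y ∧ R x y := by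
  rw [bucketList, List.pairwise_flatMap]
  refine ⟨fun c _ => ?_, ?_⟩
  · refine (List.pairwise_filter.2 (h.imp fun hR hx hy => ?_))
    simp only [decide_eq_true_eq] at hx hy
    exact Or.inr ⟨hx.trans hy.symm, hR⟩
  · refine List.pairwise_lt_range.imp fun hcd x hx y hy => ?_
    simp only [List.mem_filter, decide_eq_true_eq] at hx hy
    exact Or.inl (by rw [hx.2, hy.2]; exact hcd)

/-- Starting from the link `h`, the links in the array `next` run through the nodes in the list. A
link to the node `p` is stored as `p + 1`, and `0` ends the list. -/
def Linked (next : ℕ → ℝ) : ℝ → List ℕ → Prop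
  | h, [] => h = 0
  | h, p :: q => h = (p : ℝ) + 1 ∧ Linked next (next p) q

theorem Linked.update {next : ℕ → ℝ} {q : List ℕ} {h : ℝ} (hq : Linked next h q) {p : ℕ} {y : ℝ}
    (hp : p ∉ q) : Linked (Function.update next p y) h q := by
  induction q generalizing h with
  | nil => exact hq
  | cons a q ih =>
    simp only [List.mem_cons, not_or] at hp
    refine ⟨hq.1, ?_⟩
    rw [Function.update_of_ne (Ne.symm hp.1)]
    exact ih hq.2 hp.2

/-- One pass of radix sort. A list of items is in array `0`, its length in register `0`; their
keys, less than register `1`, are in array `1`. The items are put, from the last to the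
first, in front of linked lists, one for each key, and then listed in array `2`. -/
def bucketSort : Cmd :=
  .const 2 1 ;; .const 3 0 ;; .move 4 0 ;;
  .loop 3 4 (.arith .sub 4 4 2 ;; .load 5 0 4 ;; .load 5 1 5 ;; .load 6 3 5 ;; .store 4 4 6 ;;
    .arith .add 7 4 2 ;; .store 3 5 7) ;;
  .const 4 0 ;; .const 5 0 ;;
  .loop 4 1 (.load 6 3 4 ;;
    .loop 3 6 (.arith .sub 6 6 2 ;; .load 7 0 6 ;; .store 2 5 7 ;; .arith .add 5 5 2 ;;
      .load 6 4 6) ;;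
    .arith .add 4 4 2)

theorem wp_bucketSort {l : List ℕ} {f : ℕ → ℕ} {n : ℕ} {m : Mem} (h0 : m.reg 0 = l.length)
    (h1 : m.reg 1 = n) (ha0 : Holds (m.arr 0) (Nat.cast : ℕ → ℝ) l)
    (ha1 : ∀ x ∈ l, m.arr 1 x = f x) (hf : ∀ x ∈ l, f x < n) (ha3 : m.arr 3 = fun _ => 0) :
    Wp bucketSort bucketSort (fun t m' => t ≤ 14 * l.length + 5 * n + 10 ∧
      Holds (m'.arr 2) (Nat.cast : ℕ → ℝ) (bucketList f n l)) m := by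
  -- with the procedure body hidden behind `P`, only the command that is executed gets unfolded
  generalize hP : bucketSort = P
  nth_rewrite 2 [← hP]
  unfold bucketSort
  set N := l.length with hN
  set g : ℕ → ℕ := fun p => l.getD p 0 with hg
  have hgl : ∀ p < N, g p ∈ l := by
    intro p hp
    rw [hg]; simp only
    rw [List.getD_eq_getElem _ _ hp]
    exact List.getElem_mem _
  have ha0' : ∀ p < N, m.arr 0 p = g p := by
    intro p hp
    rw [ha0 p hp, hg]; simp only
    rw [List.getD_eq_getElem _ _ hp]
  have hmap : (List.range N).map g = l := by
    refine List.ext_getElem (by simp [hN]) fun i h1 h2 => ?_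
    simp [hg, h2]
  simp only [wp_seq, wp_const, wp_move]
  -- after `k` rounds the last `k` items are in the linked lists
  refine wp_loop_count (fun k m' => k ≤ N ∧ m'.reg 4 = ((N - k : ℕ) : ℝ) ∧ ∀ c < n,
    Linked (m'.arr 4) (m'.arr 3 c)
      ((List.range' (N - k) k).filter fun p => f (g p) = c)) N 8 ?_ ?_ ?_ ?_
  · simp [h0, ha3, Linked]
  · rintro k m1 ⟨-, i4, iL⟩ ha hk -
    have e2 : m1.reg 2 = 1 := by simp [ha.1 2 rfl]
    have e0 : m1.arr 0 = m.arr 0 := by simp [ha.2 0 rfl]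
    have e1 : m1.arr 1 = m.arr 1 := by simp [ha.2 1 rfl]
    obtain ⟨p, hp⟩ : ∃ p, N = p + 1 + k := ⟨N - k - 1, by omega⟩
    have hp1 : N - k = p + 1 := by omega
    have hp2 : N - (k + 1) = p := by omega
    have hpN : p < N := by omega
    rw [hp1] at i4 iL
    rw [hp2]
    have hfp := hf _ (hgl p hpN)
    simp [i4, e2, e0, e1, ha0' p hpN, ha1 _ (hgl p hpN)]
    refine ⟨hk, fun c hc => ?_⟩
    have hnot : p ∉ (List.range' (p + 1) k).filter fun p => f (g p) = c := by
      simp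
    rw [List.range'_succ, List.filter_cons]
    by_cases hpc : f (g p) = c
    · subst hpc
      simp only [decide_true, if_true, Function.update_self]
      refine ⟨rfl, ?_⟩
      rw [Function.update_self]
      exact (iL _ hc).update hnot
    · rw [Function.update_of_ne (Ne.symm hpc)]
      simpa [hpc] using (iL _ hc).update hnot
  · rintro k m1 ⟨hk, i4, -⟩ ha
    have e3 : m1.reg 3 = 0 := by simp [ha.1 3 rfl]
    simp [i4, e3]
  rintro m1 t1 ⟨-, -, iL⟩ ha ht1
  rw [Nat.sub_self, ← List.range_eq_range'] at iL
  have f0 : m1.arr 0 = m.arr 0 := by simp [ha.2 0 rfl]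
  have f1 : m1.reg 1 = n := by simp [ha.1 1 rfl, h1]
  have f2 : m1.reg 2 = 1 := by simp [ha.1 2 rfl]
  have f3 : m1.reg 3 = 0 := by simp [ha.1 3 rfl]
  clear ha
  set B : ℕ → List ℕ := fun c => l.filter fun x => f x = c with hB
  have hBmap : ∀ c, ((List.range N).filter fun p => f (g p) = c).map g = B c := by
    intro c
    conv_rhs => rw [hB]; simp only; rw [← hmap, List.filter_map]
    rfl
  refine wp_loop (fun c m' => c ≤ n ∧ m'.reg 4 = c ∧
      m'.reg 5 = (((List.range c).flatMap B).length : ℕ) ∧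
      Holds (m'.arr 2) (Nat.cast : ℕ → ℝ) ((List.range c).flatMap B))
    (fun c => 5 * (n - c) + 6 * ((List.range' c (n - c)).flatMap B).length) 0 ?_ ?_ ?_
  · simp [Holds.nil]
  · rintro c m2 ⟨-, i4, i5, i2⟩ ha hc
    have e0 : m2.arr 0 = m.arr 0 := by simp [ha.2 0 rfl, f0]
    have e1 : m2.reg 1 = n := by simp [ha.1 1 rfl, f1]
    have e2 : m2.reg 2 = 1 := by simp [ha.1 2 rfl, f2]
    have e3 : m2.reg 3 = 0 := by simp [ha.1 3 rfl, f3]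
    have e4 : m2.arr 4 = m1.arr 4 := by simp [ha.2 4 rfl]
    have e5 : m2.arr 3 = m1.arr 3 := by simp [ha.2 3 rfl]
    have hcn : c < n := by simpa [i4, e1] using hc
    simp only [wp_seq, wp_load, i4, exists_cast_eq_cast]
    refine wp_loop (fun (q : List ℕ) m' => Linked (m1.arr 4) (m'.reg 6) q ∧ (∀ p ∈ q, p < N) ∧
      ∃ done, done ++ q.map g = (List.range c).flatMap B ++ B c ∧ m'.reg 5 = (done.length : ℕ) ∧
        Holds (m'.arr 2) (Nat.cast : ℕ → ℝ) done) (fun q => 6 * q.length)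
      ((List.range N).filter fun p => f (g p) = c) ?_ ?_ ?_
    · refine ⟨by simpa [e5] using iL c hcn, fun p hp => ?_, _, by rw [hBmap], by simpa using i5,
        by simpa using i2⟩
      simp at hp
      exact hp.1
    · rintro q m3 ⟨j6, jN, done, jd, j5, j2⟩ ha' hq
      have e0' : m3.arr 0 = m.arr 0 := by simp [ha'.2 0 rfl, e0]
      have e2' : m3.reg 2 = 1 := by simp [ha'.1 2 rfl, e2]
      have e3' : m3.reg 3 = 0 := by simp [ha'.1 3 rfl, e3]
      have e4' : m3.arr 4 = m1.arr 4 := by simp [ha'.2 4 rfl, e4]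
      rcases q with _ | ⟨p, q⟩
      · rw [e3', show m3.reg 6 = 0 from j6] at hq
        exact absurd hq (lt_irrefl _)
      obtain ⟨j6, j6'⟩ := j6
      simp [j6, e2', e0', e4', ha0' p (jN p (by simp)), j5]
      refine ⟨q, ⟨j6', fun p hp => jN p (by simp [hp]), done ++ [g p], by simpa using jd, by simp,
        j2.append rfl rfl⟩, by omega⟩
    · rintro q m3 t3 ⟨j6, -, done, jd, j5, j2⟩ ha' hq ht3
      have e3' : m3.reg 3 = 0 := by simp [ha'.1 3 rfl, e3]
      have hq0 : q = [] := by
        rcases q with _ | ⟨p, q⟩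
        · rfl
        · refine absurd ?_ hq
          rw [e3', j6.1]
          positivity
      subst hq0
      have e2' : m3.reg 2 = 1 := by simp [ha'.1 2 rfl, e2]
      have e4' : m3.reg 4 = c := by simp [ha'.1 4 rfl, i4]
      have hlen : ((List.range N).filter fun p => f (g p) = c).length = (B c).length := by
        rw [← hBmap, List.length_map]
      rw [hlen] at ht3
      simp at jd ht3
      have hs : (List.range (c + 1)).flatMap B = done := by
        rw [jd, List.range_succ]; simp
      simp only [wp_add]
      refine ⟨c + 1, ⟨hcn, by simp [e2', e4'], ?_, ?_⟩, ?_⟩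
      · rw [hs]; simpa using j5
      · rw [hs]; simpa using j2
      · obtain ⟨d, hd⟩ : ∃ d, n - c = d + 1 := ⟨n - c - 1, by omega⟩
        rw [show n - (c + 1) = d by omega, hd, List.range'_succ]
        simp only [List.flatMap_cons, List.length_append]
        omega
  · rintro c m2 t2 ⟨hcn, i4, i5, i2⟩ ha hc ht2
    have e1 : m2.reg 1 = n := by simp [ha.1 1 rfl, f1]
    have hcn' : c = n := by
      refine le_antisymm hcn ?_
      simpa [i4, e1] using hc
    subst hcn'
    refine ⟨?_, i2⟩
    have hlen : ((List.range c).flatMap B).length = N := (bucketList_perm hf).length_eq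
    simp [← List.range_eq_range'] at ht2
    rw [← List.length_flatMap] at ht2
    omega

/-! ### Blocks of the sorted outer product -/

/-- The rows `i < n` with `(i + 1) * p ≤ F`, each paired with `p`. The pair `(i, p)` stands for the
block of the columns `j` with `p ≤ j + 1 < 2 * p` in row `i`. -/
def blockRows (n F p : ℕ) : List (ℕ × ℕ) := ((List.range (F / p)).filter (· < n)).map (·, p)

/-- The blocks `(i, p)` for the powers of two `p < 2 ^ K`, in the order of `p`. -/
def blockList (n F K : ℕ) : List (ℕ × ℕ) := (List.range K).flatMap fun k => blockRows n F (2 ^ k)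

theorem mem_blockList {n F K i p : ℕ} :
    (i, p) ∈ blockList n F K ↔ (∃ k < K, p = 2 ^ k) ∧ i < n ∧ (i + 1) * p ≤ F := by
  simp only [blockList, blockRows, List.mem_flatMap, List.mem_range, List.mem_map, List.mem_filter,
    decide_eq_true_eq, Prod.mk.injEq]
  constructor
  · rintro ⟨k, hk, a, ⟨h1, h2⟩, rfl, rfl⟩
    exact ⟨⟨k, hk, rfl⟩, h2, (Nat.le_div_iff_mul_le (by positivity)).1 h1⟩
  · rintro ⟨⟨k, hk, rfl⟩, h2, h1⟩
    exact ⟨k, hk, i, ⟨(Nat.le_div_iff_mul_le (by positivity)).2 h1, h2⟩, rfl, rfl⟩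

theorem length_blockRows_le (n F p : ℕ) : (blockRows n F p).length ≤ F / p := by
  rw [blockRows, List.length_map]
  exact (List.length_filter_le _ _).trans (by simp)

theorem blockList_succ (n F K : ℕ) :
    blockList n F (K + 1) = blockList n F K ++ blockRows n F (2 ^ K) := by
  simp [blockList, List.range_succ]

/-- The number of blocks is bounded by a geometric sum. -/
theorem length_blockList_le (n F K : ℕ) : (blockList n F K).length ≤ 2 * F := by
  suffices H : (blockList n F K).length + 2 * (F / 2 ^ K) ≤ 2 * F by omega
  induction K with
  | zero => simp [blockList]
  | succ K ih =>
    have h1 := length_blockRows_le n F (2 ^ K)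
    rw [blockList_succ, List.length_append, pow_succ, ← Nat.div_div_eq_div_mul]
    omega

theorem blockList_pairwise (n F K : ℕ) : (blockList n F K).Pairwise fun x y => x.2 ≤ y.2 := by
  rw [blockList, List.pairwise_flatMap]
  refine ⟨fun k _ => ?_, List.pairwise_lt_range.imp fun hkl x hx y hy => ?_⟩
  · rw [blockRows, List.pairwise_map]
    exact List.pairwise_of_forall fun _ _ => le_rfl
  · simp only [blockRows, List.mem_map] at hx hy
    obtain ⟨_, _, rfl⟩ := hx
    obtain ⟨_, _, rfl⟩ := hy
    exact Nat.pow_le_pow_right (by norm_num) hkl.le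

theorem blockList_nodup (n F K : ℕ) : (blockList n F K).Nodup := by
  rw [blockList, List.nodup_flatMap]
  refine ⟨fun k _ => ?_, List.pairwise_lt_range.imp fun {k l} hkl => ?_⟩
  · exact (List.nodup_range.filter _).map fun a b h => (Prod.mk.inj h).1
  · intro x hx hy
    simp only [blockRows, List.mem_map] at hx hy
    obtain ⟨_, _, rfl⟩ := hx
    obtain ⟨_, _, hy⟩ := hy
    have := Nat.pow_right_injective le_rfl (Prod.mk.inj hy).2
    omega

/-- List the blocks of the outer product of the decreasing vectors in the arrays `0` and `1`. The
registers `0` and `1` hold `n` and `B`, and the blocks `(i, p)` with `(i + 1) * p ≤ 4 * B` are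
listed in the arrays `4` and `5`, their greatest entries in array `2`, and the weights
`p - p / 2` in array `3`. Register `0` receives their number. -/
def listBlocks : Cmd :=
  .const 2 1 ;; .const 3 4 ;; .arith .mul 3 3 1 ;; .arith .add 3 3 2 ;; .arith .add 4 0 2 ;;
  .const 5 1 ;; .const 6 1 ;; .const 7 0 ;;
  .loop 5 4 (.const 8 0 ;; .move 9 5 ;; .arith .sub 10 5 2 ;; .load 10 1 10 ;;
    .loop 9 3
      (.ite 8 0
        (.load 11 0 8 ;; .arith .mul 11 11 10 ;; .store 2 7 11 ;; .store 3 7 6 ;; .store 4 7 8 ;;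
          .store 5 7 5 ;; .arith .add 7 7 2)
        .skip ;;
      .arith .add 8 8 2 ;; .arith .add 9 9 5) ;;
    .move 6 5 ;; .arith .add 5 5 5) ;;
  .move 0 7

theorem wp_listBlocks {n B : ℕ} {m : Mem} (h0 : m.reg 0 = n) (h1 : m.reg 1 = B) :
    Wp listBlocks listBlocks (fun t m' => t ≤ 100 * B + 10 * n + 20 ∧
      ∃ K, n < 2 ^ K ∧ (∀ k < K, 2 ^ k ≤ n) ∧ m'.reg 0 = (blockList n (4 * B) K).length ∧
        Holds (m'.arr 2) (fun x => m.arr 0 x.1 * m.arr 1 (x.2 - 1)) (blockList n (4 * B) K) ∧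
        Holds (m'.arr 3) (fun x => ((x.2 - x.2 / 2 : ℕ) : ℝ)) (blockList n (4 * B) K) ∧
        Holds (m'.arr 4) (fun x => (x.1 : ℝ)) (blockList n (4 * B) K) ∧
        Holds (m'.arr 5) (fun x => (x.2 : ℝ)) (blockList n (4 * B) K)) m := by
  generalize hP : listBlocks = P
  nth_rewrite 2 [← hP]
  unfold listBlocks
  set F := 4 * B with hF
  simp only [wp_seq, wp_const, wp_add, wp_mul]
  -- the outer loop runs through the powers of two `2 ^ K ≤ n`; a round costs a constant, paid for
  -- by `n + 1 - 2 ^ K`, and a constant for each of the `F / 2 ^ K` rows, paid for by the other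
  -- summand
  refine wp_loop (fun K m' => (∀ k < K, 2 ^ k ≤ n) ∧ m'.reg 5 = ((2 ^ K : ℕ) : ℝ) ∧
    m'.reg 6 = ((2 ^ K - 2 ^ K / 2 : ℕ) : ℝ) ∧ m'.reg 7 = (blockList n F K).length ∧
        Holds (m'.arr 2) (fun x => m.arr 0 x.1 * m.arr 1 (x.2 - 1)) (blockList n F K) ∧
        Holds (m'.arr 3) (fun x => ((x.2 - x.2 / 2 : ℕ) : ℝ)) (blockList n F K) ∧
        Holds (m'.arr 4) (fun x => (x.1 : ℝ)) (blockList n F K) ∧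
        Holds (m'.arr 5) (fun x => (x.2 : ℝ)) (blockList n F K))
    (fun K => 10 * (n + 1 - 2 ^ K) + 22 * (F / 2 ^ K)) 0 ?_ ?_ ?_
  · simp [blockList, Holds.nil]
  · rintro K m1 ⟨iK, i5, i6, i7, j2, j3, j4, j5⟩ ha hc
    have e0 : m1.reg 0 = n := by simp [ha.1 0 rfl, h0]
    have e2 : m1.reg 2 = 1 := by simp [ha.1 2 rfl]
    have e3 : m1.reg 3 = ((F + 1 : ℕ) : ℝ) := by simp [ha.1 3 rfl, h1, hF]
    have e4 : m1.reg 4 = ((n + 1 : ℕ) : ℝ) := by simp [ha.1 4 rfl, h0]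
    have ea : m1.arr 0 = m.arr 0 := ha.2 0 rfl
    have eb : m1.arr 1 = m.arr 1 := ha.2 1 rfl
    obtain ⟨p, hp⟩ : ∃ p, 2 ^ K = p := ⟨_, rfl⟩
    have hp1 : 1 ≤ p := hp ▸ Nat.one_le_two_pow
    rw [hp] at i5 i6
    have hpn : p ≤ n := by
      rw [i5, e4, Nat.cast_lt] at hc
      omega
    have hcast : (p : ℝ) - 1 = ((p - 1 : ℕ) : ℝ) := by push_cast [hp1]; ring
    simp only [wp_seq, wp_const, wp_move, wp_sub, wp_load]
    simp [i5, e2, hcast]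
    obtain ⟨l, hl0, hlk, hlK⟩ : ∃ l : ℕ → List (ℕ × ℕ), l 0 = blockList n F K ∧
        (∀ k, l (k + 1) = l k ++ if k < n then [(k, p)] else []) ∧
        l (F / p) = blockList n F (K + 1) := by
      refine ⟨fun k => blockList n F K ++ ((List.range k).filter (· < n)).map (·, p), by simp, ?_,
        by rw [blockList_succ, hp, blockRows]⟩
      intro k
      simp only [List.range_succ, List.filter_append, List.map_append, List.append_assoc]
      by_cases hkn : k < n <;> simp [hkn]
    refine wp_loop_count (fun k m' => m'.reg 8 = k ∧ m'.reg 9 = (((k + 1) * p : ℕ) : ℝ) ∧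
        m'.reg 7 = (l k).length ∧
        Holds (m'.arr 2) (fun x => m.arr 0 x.1 * m.arr 1 (x.2 - 1)) (l k) ∧
        Holds (m'.arr 3) (fun x => ((x.2 - x.2 / 2 : ℕ) : ℝ)) (l k) ∧
        Holds (m'.arr 4) (fun x => (x.1 : ℝ)) (l k) ∧
        Holds (m'.arr 5) (fun x => (x.2 : ℝ)) (l k)) (F / p) 11 ?_ ?_ ?_ ?_
    · rw [hl0]
      exact ⟨by simp, by simp, by simpa using i7, by simpa using j2, by simpa using j3,
        by simpa using j4, by simpa using j5⟩
    · rintro k m2 ⟨i8, i9, k7, k2, k3, k4, k5⟩ ha' hk -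
      have e0' : m2.reg 0 = n := by simp [ha'.1 0 rfl, e0]
      have e2' : m2.reg 2 = 1 := by simp [ha'.1 2 rfl, e2]
      have e5' : m2.reg 5 = p := by simp [ha'.1 5 rfl, i5]
      have e6' : m2.reg 6 = ((p - p / 2 : ℕ) : ℝ) := by rw [ha'.1 6 rfl]; simpa using i6
      have e10' : m2.reg 10 = m.arr 1 (p - 1) := by simp [ha'.1 10 rfl, eb]
      have ea' : m2.arr 0 = m.arr 0 := by simp [ha'.2 0 rfl, ea]
      have e9 : ((k + 1 : ℝ) * p + p) = ((k + 1 + 1) * p : ℝ) := by ring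
      rw [hlk]
      by_cases hkn : k < n
      · simp [wp_ite, i8, i9, e0', e2', e5', e6', e10', ea', hkn, k7, e9]
        exact ⟨k2.append rfl rfl, k3.append rfl rfl, k4.append rfl rfl, k5.append rfl rfl⟩
      · simp [wp_ite, i8, i9, e0', e2', e5', hkn, e9]
        exact ⟨k7, k2, k3, k4, k5⟩
    · rintro k m2 ⟨i8, i9, -⟩ ha'
      have e3' : m2.reg 3 = ((F + 1 : ℕ) : ℝ) := by simp [ha'.1 3 rfl, e3]
      rw [i9, e3', Nat.cast_lt, Nat.lt_succ_iff, ← Nat.le_div_iff_mul_le hp1]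
      rfl
    · rintro m2 t ⟨i8, i9, k7, k2, k3, k4, k5⟩ ha' ht
      have e5' : m2.reg 5 = p := by simp [ha'.1 5 rfl, i5]
      rw [hlK] at k7 k2 k3 k4 k5
      simp [e5']
      have hp2 : 2 ^ (K + 1) = 2 * p := by rw [pow_succ, hp, mul_comm]
      have hp2r : (2 : ℝ) ^ (K + 1) = 2 * p := by exact_mod_cast hp2
      refine ⟨K + 1, ⟨fun k hk => ?_, by rw [hp2r]; ring, ?_, k7, k2, k3, k4, k5⟩, ?_⟩
      · rcases Nat.lt_succ_iff_lt_or_eq.1 hk with hk | rfl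
        · exact iK k hk
        · omega
      · rw [hp2]
        omega
      · rw [hp2, hp, mul_comm 2 p, ← Nat.div_div_eq_div_mul]
        omega
  · rintro K m1 t ⟨iK, i5, i6, i7, j2, j3, j4, j5⟩ ha hc ht
    have e4 : m1.reg 4 = ((n + 1 : ℕ) : ℝ) := by simp [ha.1 4 rfl, h0]
    rw [i5, e4, Nat.cast_lt] at hc
    simp only [wp_move]
    refine ⟨?_, K, by omega, iK, by simpa using i7, j2, j3, j4, j5⟩
    simp at ht
    omega

/-- The positions in the block `x = (i, p)` of an `n × n` matrix: row `i`, and the columns `j < n`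
with `p ≤ j + 1 < 2 * p`. -/
def blockCells (n : ℕ) (x : ℕ × ℕ) : List (ℕ × ℕ) :=
  ((List.range' (x.2 - 1) x.2).filter (· < n)).map (x.1, ·)

/-- List the entries of some blocks. The vectors are in the arrays `0` and `1`, the blocks in the
arrays `2` and `3`, and array `4` lists those to be used; `n` and the number of blocks to be used
are in the registers `0` and `1`. Rows, columns and values of the entries are listed in
the arrays `5`, `6` and `7`, and register `0` receives their number. -/
def expandBlocks : Cmd :=
  .const 2 1 ;; .const 3 0 ;; .const 4 0 ;;
  .loop 3 1 (.load 5 4 3 ;; .load 6 2 5 ;; .load 7 3 5 ;; .load 8 0 6 ;; .arith .sub 9 7 2 ;;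
    .arith .add 10 9 7 ;;
    .loop 9 10
      (.ite 9 0
        (.load 11 1 9 ;; .arith .mul 11 8 11 ;; .store 5 4 6 ;; .store 6 4 9 ;; .store 7 4 11 ;;
          .arith .add 4 4 2)
        .skip ;;
      .arith .add 9 9 2) ;;
    .arith .add 3 3 2) ;;
  .move 0 4

theorem wp_expandBlocks {n : ℕ} {X : List (ℕ × ℕ)} {m : Mem} (h0 : m.reg 0 = n)
    (h1 : m.reg 1 = X.length) (hX : ∀ t (h : t < X.length), ∃ k : ℕ, m.arr 4 t = k ∧
      m.arr 2 k = X[t].1 ∧ m.arr 3 k = X[t].2) (hp : ∀ x ∈ X, 1 ≤ x.2) :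
    Wp expandBlocks expandBlocks (fun t m' => t ≤ 10 * (X.map Prod.snd).sum + 9 * X.length + 10 ∧
      m'.reg 0 = (X.flatMap (blockCells n)).length ∧
      Holds (m'.arr 5) (fun x => (x.1 : ℝ)) (X.flatMap (blockCells n)) ∧
      Holds (m'.arr 6) (fun x => (x.2 : ℝ)) (X.flatMap (blockCells n)) ∧
      Holds (m'.arr 7) (fun x => m.arr 0 x.1 * m.arr 1 x.2) (X.flatMap (blockCells n))) m := by
  generalize hP : expandBlocks = P
  nth_rewrite 2 [← hP]
  unfold expandBlocks
  simp only [wp_seq, wp_const]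
  refine wp_loop (fun t m' => t ≤ X.length ∧ m'.reg 3 = t ∧
      m'.reg 4 = ((X.take t).flatMap (blockCells n)).length ∧
      Holds (m'.arr 5) (fun x => (x.1 : ℝ)) ((X.take t).flatMap (blockCells n)) ∧
      Holds (m'.arr 6) (fun x => (x.2 : ℝ)) ((X.take t).flatMap (blockCells n)) ∧
      Holds (m'.arr 7) (fun x => m.arr 0 x.1 * m.arr 1 x.2) ((X.take t).flatMap (blockCells n)))
    (fun t => 10 * ((X.map Prod.snd).drop t).sum + 9 * (X.length - t)) 0 ?_ ?_ ?_
  · simp [Holds.nil]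
  · rintro t m1 ⟨-, i3, i4, j5, j6, j7⟩ ha hc
    have e0 : m1.reg 0 = n := by simp [ha.1 0 rfl, h0]
    have e1 : m1.reg 1 = X.length := by simp [ha.1 1 rfl, h1]
    have e2 : m1.reg 2 = 1 := by simp [ha.1 2 rfl]
    have ea : m1.arr 0 = m.arr 0 := ha.2 0 rfl
    have eb : m1.arr 1 = m.arr 1 := ha.2 1 rfl
    have ec : m1.arr 2 = m.arr 2 := ha.2 2 rfl
    have ed : m1.arr 3 = m.arr 3 := ha.2 3 rfl
    have ee : m1.arr 4 = m.arr 4 := ha.2 4 rfl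
    have ht : t < X.length := by simpa [i3, e1] using hc
    obtain ⟨k, hk, hk1, hk2⟩ := hX t ht
    obtain ⟨i, p, hip⟩ : ∃ i p, X[t] = (i, p) := ⟨_, _, rfl⟩
    have hp1 : 1 ≤ p := by simpa [hip] using hp _ (List.getElem_mem ht)
    rw [hip] at hk1 hk2
    have hcast : (p : ℝ) - 1 = ((p - 1 : ℕ) : ℝ) := by push_cast [hp1]; ring
    obtain ⟨l, hl0, hlk, hlp⟩ : ∃ l : ℕ → List (ℕ × ℕ),
        l 0 = (X.take t).flatMap (blockCells n) ∧
        (∀ k, l (k + 1) = l k ++ if p - 1 + k < n then [(i, p - 1 + k)] else []) ∧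
        l p = (X.take (t + 1)).flatMap (blockCells n) := by
      refine ⟨fun k => (X.take t).flatMap (blockCells n) ++
        ((List.range' (p - 1) k).filter (· < n)).map (i, ·), by simp, ?_, ?_⟩
      · intro k
        simp only [List.range'_concat, List.filter_append, List.map_append, List.append_assoc,
          one_mul]
        by_cases hkn : p - 1 + k < n <;> simp [hkn]
      · simp only [List.take_succ_eq_append_getElem ht, List.flatMap_append, hip]
        simp [blockCells]
    simp only [wp_seq, wp_load, i3, exists_cast_eq_cast]
    simp [ea, ec, ed, ee, hk, hk1, hk2, e2]
    refine wp_loop_count (fun k m' => m'.reg 9 = ((p - 1 + k : ℕ) : ℝ) ∧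
      m'.reg 4 = (l k).length ∧
      Holds (m'.arr 5) (fun x => (x.1 : ℝ)) (l k) ∧
      Holds (m'.arr 6) (fun x => (x.2 : ℝ)) (l k) ∧
      Holds (m'.arr 7) (fun x => m.arr 0 x.1 * m.arr 1 x.2) (l k)) p 9 ?_ ?_ ?_ ?_
    · rw [hl0]
      exact ⟨by simp [hcast], by simpa using i4, by simpa using j5, by simpa using j6,
        by simpa using j7⟩
    · rintro k m2 ⟨k9, k4, k5, k6, k7⟩ ha' hkp -
      have e0' : m2.reg 0 = n := by simp [ha'.1 0 rfl, e0]
      have e2' : m2.reg 2 = 1 := by simp [ha'.1 2 rfl, e2]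
      have e6' : m2.reg 6 = i := by simp [ha'.1 6 rfl]
      have e8' : m2.reg 8 = m.arr 0 i := by simp [ha'.1 8 rfl]
      have eb' : m2.arr 1 = m.arr 1 := by simp [ha'.2 1 rfl, eb]
      rw [hlk, ← add_assoc]
      generalize p - 1 + k = j at *
      by_cases hkn : j < n
      · simp [wp_ite, k9, k4, e0', e2', e6', e8', eb', hkn]
        exact ⟨k5.append rfl rfl, k6.append rfl rfl, k7.append rfl rfl⟩
      · simp [wp_ite, k9, k4, e0', e2', hkn]
        exact ⟨k5, k6, k7⟩
    · rintro k m2 ⟨k9, -⟩ ha'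
      have e10' : m2.reg 10 = ((p - 1 + p : ℕ) : ℝ) := by
        simp [ha'.1 10 rfl, ← hcast]
      rw [k9, e10', Nat.cast_lt]
      omega
    · rintro m2 t2 ⟨k9, k4, k5, k6, k7⟩ ha' ht2
      have e3' : m2.reg 3 = t := by simp [ha'.1 3 rfl, i3]
      have e2' : m2.reg 2 = 1 := by simp [ha'.1 2 rfl, e2]
      rw [hlp] at k4 k5 k6 k7
      refine ⟨t + 1, ⟨ht, by simp [e3', e2'], by simpa using k4, k5, k6, k7⟩, ?_⟩
      have hsum : ((X.map Prod.snd).drop t).sum = p + ((X.map Prod.snd).drop (t + 1)).sum := by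
        rw [List.drop_eq_getElem_cons (by simpa using ht)]
        simp [hip]
      rw [hsum]
      omega
  · rintro t m1 s ⟨htX, i3, i4, j5, j6, j7⟩ ha hc hs
    have e1 : m1.reg 1 = X.length := by simp [ha.1 1 rfl, h1]
    have : t = X.length := le_antisymm htX (by simpa [i3, e1] using hc)
    subst this
    rw [List.take_length] at i4 j5 j6 j7
    simp only [wp_move]
    refine ⟨?_, by simpa using i4, j5, j6, j7⟩
    simp at hs
    omega

/-! ### The candidates for the heaviest entries of the outer product -/

theorem mem_blockCells {n : ℕ} {x : ℕ × ℕ} {i j : ℕ} :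
    (i, j) ∈ blockCells n x ↔ i = x.1 ∧ j < n ∧ x.2 ≤ j + 1 ∧ j + 1 < 2 * x.2 := by
  simp only [blockCells, List.mem_map, List.mem_filter, List.mem_range'_1, decide_eq_true_eq,
    Prod.mk.injEq]
  constructor
  · rintro ⟨a, ⟨h1, h2⟩, rfl, rfl⟩
    omega
  · rintro ⟨rfl, h1, h2, h3⟩
    exact ⟨j, ⟨by omega, h1⟩, rfl, rfl⟩

theorem blockCells_nodup (n : ℕ) (x : ℕ × ℕ) : (blockCells n x).Nodup :=
  (List.Nodup.filter _ (List.nodup_range' (h := by norm_num))).map fun _ _ h => (Prod.mk.inj h).2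

/-- Every position lies in a block whose size is a power of two. -/
theorem exists_block {n j : ℕ} (hj : j < n) :
    ∃ k, 2 ^ k ≤ n ∧ 2 ^ k ≤ j + 1 ∧ j + 1 < 2 * 2 ^ k := by
  have h1 := Nat.pow_log_le_self 2 (x := j + 1) (Nat.succ_ne_zero j)
  have h2 := Nat.lt_pow_succ_log_self one_lt_two (j + 1)
  rw [pow_succ] at h2
  exact ⟨Nat.log 2 (j + 1), by omega, h1, by omega⟩

theorem two_pow_eq_of_between {k l j : ℕ} (h1 : 2 ^ k ≤ j) (h2 : j < 2 * 2 ^ k) (h3 : 2 ^ l ≤ j)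
    (h4 : j < 2 * 2 ^ l) : k = l := by
  have hj : j ≠ 0 := by have := Nat.one_le_two_pow (n := k); omega
  rw [← Nat.log_eq_of_pow_le_of_lt_pow h1 (by rw [pow_succ]; omega),
    ← Nat.log_eq_of_pow_le_of_lt_pow h3 (by rw [pow_succ]; omega)]

/-- If a block is not listed, because there are too many entries to the upper left of it, then the
listed blocks to the upper left of it have a total weight of at least `B`. -/
theorem exists_listed_blocks {n B K i k : ℕ} (hB : 1 ≤ B) (hK : n < 2 ^ K) (hi : i < n)
    (hk : 2 ^ k ≤ n) (h : (i, 2 ^ k) ∉ blockList n (4 * B) K) :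
    ∃ q r, q ≤ 2 ^ k ∧ r ≤ i + 1 ∧ B ≤ r * (q - q / 2) ∧
      ∀ i' < r, (i', q) ∈ blockList n (4 * B) K := by
  have hlt : ∀ l, 2 ^ l ≤ n → l < K := fun l hl =>
    (Nat.pow_lt_pow_iff_right one_lt_two).1 (hl.trans_lt hK)
  have hF : 4 * B < (i + 1) * 2 ^ k := by
    by_contra hc
    exact h (mem_blockList.2 ⟨⟨k, hlt k hk, rfl⟩, hi, not_lt.1 hc⟩)
  -- in the rows up to `i`, the blocks of the greatest size that is listed there are used, or `B`
  -- blocks of size one if there are too many rows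
  rcases lt_or_ge (4 * B) (i + 1) with h1 | h1
  · refine ⟨1, B, Nat.one_le_two_pow, by omega, by simp, fun i' hi' => ?_⟩
    exact mem_blockList.2 ⟨⟨0, hlt 0 (by simp; omega), rfl⟩, by omega, by omega⟩
  · set d := 4 * B / (i + 1) with hd
    have hd0 : d ≠ 0 := by
      have : 1 ≤ d := (Nat.le_div_iff_mul_le (by omega)).2 (by omega)
      omega
    set l := Nat.log 2 d with hl
    have h2 : (i + 1) * 2 ^ l ≤ 4 * B := by
      have := Nat.pow_log_le_self 2 hd0
      rw [mul_comm]
      exact (Nat.le_div_iff_mul_le (by omega)).1 this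
    have h3 : 4 * B < (i + 1) * 2 ^ (l + 1) := by
      have := Nat.lt_pow_succ_log_self one_lt_two d
      rw [Nat.div_lt_iff_lt_mul (by omega)] at this
      rwa [mul_comm (i + 1)]
    have hlk : l < k := by
      have := h2.trans_lt hF
      exact (Nat.pow_lt_pow_iff_right one_lt_two).1 (Nat.lt_of_mul_lt_mul_left this)
    have hle : 2 ^ l ≤ 2 ^ k := Nat.pow_le_pow_right (by norm_num) hlk.le
    refine ⟨2 ^ l, i + 1, hle, le_rfl, ?_, fun i' hi' => ?_⟩
    · have h4 : 2 ^ l ≤ 2 * (2 ^ l - 2 ^ l / 2) := by omega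
      have h5 := Nat.mul_le_mul_left (i + 1) h4
      rw [pow_succ] at h3
      nlinarith
    · refine mem_blockList.2 ⟨⟨l, hlt l (hle.trans hk), rfl⟩, by omega, ?_⟩
      exact (Nat.mul_le_mul_right _ (by omega)).trans h2

section Candidates

variable {n B K : ℕ} {A : ℕ → ℕ → ℝ} {key wt : ℕ → ℝ} {x : ℝ}

/-- The blocks that are taken, in the order of `blockList`; `x` is the key of weighted rank `B`. -/
noncomputable def takenBlocks (n B K : ℕ) (key wt : ℕ → ℝ) (x : ℝ) : List (ℕ × ℕ) :=
  (takenList key wt B x (blockList n (4 * B) K).length).map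
    fun t => (blockList n (4 * B) K).getD t (0, 0)

/-- The entries of the taken blocks. -/
noncomputable def candidateList (n B K : ℕ) (key wt : ℕ → ℝ) (x : ℝ) : List (ℕ × ℕ) :=
  (takenBlocks n B K key wt x).flatMap (blockCells n)

theorem mem_takenBlocks {y : ℕ × ℕ} : y ∈ takenBlocks n B K key wt x ↔
    ∃ t, ∃ h : t < (blockList n (4 * B) K).length,
      Taken key wt B x (blockList n (4 * B) K).length t ∧ (blockList n (4 * B) K)[t] = y := by
  simp only [takenBlocks, List.mem_map, mem_takenList]
  constructor
  · rintro ⟨t, ⟨h1, h2⟩, h3⟩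
    exact ⟨t, h1, h2, by rwa [List.getD_eq_getElem _ _ h1] at h3⟩
  · rintro ⟨t, h1, h2, h3⟩
    exact ⟨t, ⟨h1, h2⟩, by rwa [List.getD_eq_getElem _ _ h1]⟩

theorem mem_blockList_of_mem_takenBlocks {y : ℕ × ℕ} (h : y ∈ takenBlocks n B K key wt x) :
    y ∈ blockList n (4 * B) K := by
  obtain ⟨t, ht, -, rfl⟩ := mem_takenBlocks.1 h
  exact List.getElem_mem ht

theorem takenBlocks_nodup : (takenBlocks n B K key wt x).Nodup := by
  refine List.Nodup.map_on ?_ ((takenList_pairwise _ _ _ _ _).imp fun h => h.ne)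
  intro s hs t ht h
  have hs' := (mem_takenList.1 hs).1
  have ht' := (mem_takenList.1 ht).1
  rw [List.getD_eq_getElem _ _ hs', List.getD_eq_getElem _ _ ht'] at h
  exact (List.Nodup.getElem_inj_iff (blockList_nodup n (4 * B) K)).1 h

theorem mem_candidateList {i j : ℕ} : (i, j) ∈ candidateList n B K key wt x ↔
    ∃ p, (i, p) ∈ takenBlocks n B K key wt x ∧ j < n ∧ p ≤ j + 1 ∧ j + 1 < 2 * p := by
  simp only [candidateList, List.mem_flatMap, mem_blockCells]
  constructor
  · rintro ⟨⟨a, p⟩, h1, rfl, h2⟩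
    exact ⟨p, h1, h2⟩
  · rintro ⟨p, h1, h2⟩
    exact ⟨_, h1, rfl, h2⟩

theorem candidateList_nodup : (candidateList n B K key wt x).Nodup := by
  rw [candidateList, List.nodup_flatMap]
  refine ⟨fun y _ => blockCells_nodup n y, ?_⟩
  refine List.Pairwise.imp_of_mem ?_ takenBlocks_nodup
  rintro ⟨i, p⟩ ⟨i', p'⟩ hy hy' hne ⟨a, j⟩ h h'
  obtain ⟨⟨k, -, rfl⟩, -⟩ := mem_blockList.1 (mem_blockList_of_mem_takenBlocks hy)
  obtain ⟨⟨l, -, rfl⟩, -⟩ := mem_blockList.1 (mem_blockList_of_mem_takenBlocks hy')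
  obtain ⟨rfl, -, h1, h2⟩ := mem_blockCells.1 h
  obtain ⟨rfl, -, h3, h4⟩ := mem_blockCells.1 h'
  exact hne (by rw [two_pow_eq_of_between h1 h2 h3 h4])

theorem lt_of_mem_candidateList {c : ℕ × ℕ} (h : c ∈ candidateList n B K key wt x) :
    c.1 < n ∧ c.2 < n := by
  obtain ⟨p, h1, h2, -⟩ := mem_candidateList.1 h
  exact ⟨(mem_blockList.1 (mem_blockList_of_mem_takenBlocks h1)).2.1, h2⟩

/-- The weight of the blocks of key greater than `x` bounds any part of it. -/
theorem sum_le_aboveWeight {M : ℕ} (hw : ∀ t < M, 0 ≤ wt t) (s : Finset ℕ)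
    (hs : ∀ t ∈ s, t < M ∧ x < key t) : ∑ t ∈ s, wt t ≤ aboveWeight key wt x M := by
  rw [aboveWeight, ← Finset.sum_filter]
  refine Finset.sum_le_sum_of_subset_of_nonneg (fun t ht => ?_) fun t ht _ => ?_
  · simpa using hs t ht
  · exact hw t (by simp at ht; exact ht.1)

/-- The blocks `(i', q)` with `i' < r`, if they are listed and of key greater than `x`, contribute
their weight. -/
theorem mul_le_aboveWeight {L : List (ℕ × ℕ)} {q r : ℕ}
    (hwt : ∀ t (h : t < L.length), wt t = ((L[t].2 - L[t].2 / 2 : ℕ) : ℝ))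
    (hmem : ∀ i < r, (i, q) ∈ L)
    (hkey : ∀ t (h : t < L.length), ∀ i < r, L[t] = (i, q) → x < key t) :
    ((r * (q - q / 2) : ℕ) : ℝ) ≤ aboveWeight key wt x L.length := by
  have hex : ∀ i : ℕ, ∃ t, i < r → ∃ h : t < L.length, L[t] = (i, q) := by
    intro i
    by_cases hi : i < r
    · obtain ⟨t, ht, h⟩ := List.getElem_of_mem (hmem i hi)
      exact ⟨t, fun _ => ⟨ht, h⟩⟩
    · exact ⟨0, fun h => absurd h hi⟩
  choose τ hτ using hex
  have hinj : Set.InjOn τ (Finset.range r : Finset ℕ) := by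
    intro i hi j hj h
    simp only [Finset.coe_range, Set.mem_Iio] at hi hj
    obtain ⟨h1, h2⟩ := hτ i hi
    obtain ⟨h3, h4⟩ := hτ j hj
    simp only [h] at h2
    rw [h2] at h4
    exact (Prod.mk.inj h4).1
  refine le_trans (le_of_eq ?_) (sum_le_aboveWeight (fun t ht => ?_) ((Finset.range r).image τ) ?_)
  · rw [Finset.sum_image hinj, Finset.sum_congr rfl (g := fun _ => ((q - q / 2 : ℕ) : ℝ))]
    · simp
    · intro i hi
      obtain ⟨h1, h2⟩ := hτ i (Finset.mem_range.1 hi)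
      rw [hwt _ h1, h2]
  · rw [hwt t ht]; positivity
  · intro t ht
    simp only [Finset.mem_image, Finset.mem_range] at ht
    obtain ⟨i, hi, rfl⟩ := ht
    obtain ⟨h1, h2⟩ := hτ i hi
    exact ⟨h1, hkey _ h1 i hi h2⟩

end Candidates

/-- The blocks of a decreasing matrix `A` of nonnegative entries, with their greatest entries `key`
and their weights `wt`. -/
structure IsBlockData (n B K : ℕ) (A : ℕ → ℕ → ℝ) (key wt : ℕ → ℝ) : Prop where
  one_le : 1 ≤ B
  lt_pow : n < 2 ^ K
  pow_le : ∀ k < K, 2 ^ k ≤ n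
  anti : ∀ i j i' j', i' ≤ i → i < n → j' ≤ j → j < n → A i j ≤ A i' j'
  nonneg : ∀ i j, i < n → j < n → 0 ≤ A i j
  key_eq : ∀ t (h : t < (blockList n (4 * B) K).length), key t =
    A (blockList n (4 * B) K)[t].1 ((blockList n (4 * B) K)[t].2 - 1)
  wt_eq : ∀ t (h : t < (blockList n (4 * B) K).length), wt t =
    (((blockList n (4 * B) K)[t].2 - (blockList n (4 * B) K)[t].2 / 2 : ℕ) : ℝ)

namespace IsBlockData

variable {n B K : ℕ} {A : ℕ → ℕ → ℝ} {key wt : ℕ → ℝ} {x : ℝ} (hD : IsBlockData n B K A key wt)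

theorem bounds (hD : IsBlockData n B K A key wt) {i p : ℕ}
    (h : (i, p) ∈ blockList n (4 * B) K) : i < n ∧ 1 ≤ p ∧ p ≤ n ∧ p ≤ 4 * B := by
  obtain ⟨⟨k, hk, rfl⟩, h1, h2⟩ := mem_blockList.1 h
  refine ⟨h1, Nat.one_le_two_pow, hD.pow_le k hk, le_trans ?_ h2⟩
  exact Nat.le_mul_of_pos_left _ (by omega)

/-- A position whose block is not listed has an entry that is at most `x`, if the listed blocks of
key greater than `x` have a weight below `B`. -/
theorem le_of_not_mem_blockList (hD : IsBlockData n B K A key wt)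
    (hx : aboveWeight key wt x (blockList n (4 * B) K).length < B) {i j k : ℕ} (hi : i < n)
    (hj : j < n) (hk : 2 ^ k ≤ j + 1) (h : (i, 2 ^ k) ∉ blockList n (4 * B) K) : A i j ≤ x := by
  by_contra hc
  rw [not_le] at hc
  obtain ⟨q, r, hq, hr, hqr, hmem⟩ :=
    exists_listed_blocks hD.one_le hD.lt_pow hi (hk.trans hj) h
  have := mul_le_aboveWeight (key := key) (x := x) hD.wt_eq hmem fun t ht i' hi' hti => by
    rw [hD.key_eq t ht, hti]
    exact hc.trans_le (hD.anti _ _ _ _ (by omega) hi (by simp; omega) hj)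
  have hcast : (B : ℝ) ≤ ((r * (q - q / 2) : ℕ) : ℝ) := by exact_mod_cast hqr
  linarith

/-- The entries that are not candidates are at most `x`, since their block is either not listed or
of key at most `x`. -/
theorem le_of_not_mem_candidateList (hD : IsBlockData n B K A key wt)
    (hx : aboveWeight key wt x (blockList n (4 * B) K).length < B) {i j : ℕ} (hi : i < n)
    (hj : j < n) (h : (i, j) ∉ candidateList n B K key wt x) : A i j ≤ x := by
  obtain ⟨k, hkn, hk1, hk2⟩ := exists_block hj
  by_cases hmem : (i, 2 ^ k) ∈ blockList n (4 * B) K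
  · obtain ⟨t, ht, hti⟩ := List.getElem_of_mem hmem
    have hnt : ¬ x < key t := fun hlt =>
      h (mem_candidateList.2 ⟨2 ^ k, mem_takenBlocks.2 ⟨t, ht, Or.inl hlt, hti⟩, hj, hk1, hk2⟩)
    rw [hD.key_eq t ht, hti] at hnt
    exact (hD.anti _ _ _ _ le_rfl hi (by simp; omega) hj).trans (not_lt.1 hnt)
  · exact hD.le_of_not_mem_blockList hx hi hj hk1 hmem

theorem wt_nonneg (hD : IsBlockData n B K A key wt) :
    ∀ t < (blockList n (4 * B) K).length, 0 ≤ wt t := by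
  intro t ht
  rw [hD.wt_eq t ht]
  positivity

theorem wt_le (hD : IsBlockData n B K A key wt) :
    ∀ t < (blockList n (4 * B) K).length, wt t ≤ 2 * B := by
  intro t ht
  rw [hD.wt_eq t ht]
  have : (blockList n (4 * B) K)[t].2 ≤ 4 * B := (hD.bounds (List.getElem_mem ht)).2.2.2
  have h : (blockList n (4 * B) K)[t].2 - (blockList n (4 * B) K)[t].2 / 2 ≤ 2 * B := by omega
  exact_mod_cast h

theorem sum_wt_takenList (hD : IsBlockData n B K A key wt) :
    ((takenList key wt B x (blockList n (4 * B) K).length).map wt).sum =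
      (((takenBlocks n B K key wt x).map fun y => y.2 - y.2 / 2).sum : ℕ) := by
  rw [takenBlocks, List.map_map, Nat.cast_list_sum, List.map_map]
  congr 1
  refine List.map_congr_left fun t ht => ?_
  have ht' := (mem_takenList.1 ht).1
  simp only [Function.comp_apply]
  rw [List.getD_eq_getElem _ _ ht', hD.wt_eq t ht']

/-- The blocks that are taken have `O(B)` columns: their weight exceeds `B` by at most the weight of
one block, and a block has at most twice as many columns as its weight. -/
theorem sum_takenBlocks_le (hD : IsBlockData n B K A key wt)
    (hx : aboveWeight key wt x (blockList n (4 * B) K).length < B) :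
    ((takenBlocks n B K key wt x).map Prod.snd).sum ≤ 6 * B := by
  have h1 := hD.one_le
  have h2 := (sum_takenList hD.wt_nonneg hD.wt_le (by positivity) hx.le).2
  rw [hD.sum_wt_takenList] at h2
  have h3 : ((takenBlocks n B K key wt x).map fun y => y.2 - y.2 / 2).sum < B + 2 * B := by
    exact_mod_cast h2
  have h4 : ((takenBlocks n B K key wt x).map Prod.snd).sum ≤
      2 * ((takenBlocks n B K key wt x).map fun y => y.2 - y.2 / 2).sum := by
    rw [← List.sum_map_mul_left]
    exact List.sum_le_sum fun y _ => by omega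
  omega

/-- If a block is taken, then so is the preceding block of the same row: it is listed earlier and
its key is at least as great. -/
theorem half_mem_takenBlocks (hD : IsBlockData n B K A key wt) {i k : ℕ}
    (h : (i, 2 ^ (k + 1)) ∈ takenBlocks n B K key wt x) :
    (i, 2 ^ k) ∈ takenBlocks n B K key wt x := by
  obtain ⟨t, ht, hT, hti⟩ := mem_takenBlocks.1 h
  obtain ⟨⟨l, hl, hkl⟩, hi, hF⟩ := mem_blockList.1 (hti ▸ List.getElem_mem ht)
  have hkl' : k + 1 = l := Nat.pow_right_injective le_rfl hkl
  have hpn := hD.pow_le l hl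
  rw [← hkl] at hpn
  have hpow : 2 ^ (k + 1) = 2 * 2 ^ k := by rw [pow_succ, mul_comm]
  have hone := Nat.one_le_two_pow (n := k)
  have hmem : (i, 2 ^ k) ∈ blockList n (4 * B) K := by
    refine mem_blockList.2 ⟨⟨k, by omega, rfl⟩, hi, le_trans (Nat.mul_le_mul_left _ ?_) hF⟩
    omega
  obtain ⟨s, hs, hsi⟩ := List.getElem_of_mem hmem
  have hst : s < t := by
    rcases lt_trichotomy s t with h | h | h
    · exact h
    · subst h
      rw [hsi] at hti
      have := (Prod.mk.inj hti).2
      omega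
    · have := List.pairwise_iff_getElem.1 (blockList_pairwise n (4 * B) K) t s ht hs h
      rw [hsi, hti] at this
      simp only at this
      omega
  have hkey : key t ≤ key s := by
    rw [hD.key_eq t ht, hD.key_eq s hs, hti, hsi]
    exact hD.anti _ _ _ _ le_rfl hi (by simp only; omega) (by simp only; omega)
  refine mem_takenBlocks.2 ⟨s, hs, ?_, hsi⟩
  rcases hT with hT | ⟨hT1, hT2⟩
  · exact Or.inl (hT.trans_le hkey)
  · rcases (hT1.symm.le.trans hkey).lt_or_eq with h | h
    · exact Or.inl h
    · refine Or.inr ⟨h.symm, lt_of_le_of_lt ?_ hT2⟩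
      have := tieWeight_mono (key := key) (x := x) hst.le
        (fun u hu => hD.wt_nonneg u (hu.trans ht))
      linarith

/-- The weight of the taken blocks is a number of candidates that are at least `x`: in the row of
the block `(i, p)` these are the columns from `p / 2` to `p - 1`. -/
theorem sum_le_card (hD : IsBlockData n B K A key wt) :
    ((takenBlocks n B K key wt x).map fun y => y.2 - y.2 / 2).sum ≤
      ((candidateList n B K key wt x).toFinset.filter fun c => x ≤ A c.1 c.2).card := by
  classical
  rw [← List.sum_toFinset _ takenBlocks_nodup]
  have hcard : ∀ y : ℕ × ℕ, y.2 - y.2 / 2 =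
      (({y.1} : Finset ℕ) ×ˢ Finset.Ico (y.2 / 2) y.2).card := by
    intro y
    simp
  rw [Finset.sum_congr rfl fun y _ => hcard y, ← Finset.card_biUnion]
  · refine Finset.card_le_card ?_
    rintro ⟨i, j⟩ hij
    simp only [Finset.mem_biUnion, List.mem_toFinset, Finset.mem_product, Finset.mem_singleton,
      Finset.mem_Ico, Prod.exists] at hij
    obtain ⟨a, p, hy, rfl, h1, h2⟩ := hij
    obtain ⟨t, ht, hT, hti⟩ := mem_takenBlocks.1 hy
    have hmem := mem_blockList_of_mem_takenBlocks hy
    obtain ⟨b1, b2, b3, b4⟩ := hD.bounds hmem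
    obtain ⟨⟨k, -, rfl⟩, -⟩ := mem_blockList.1 hmem
    have hkx : x ≤ key t := by
      rcases hT with h | h
      · exact h.le
      · exact h.1.ge
    rw [hD.key_eq t ht, hti] at hkx
    simp only [Finset.mem_filter, List.mem_toFinset]
    refine ⟨mem_candidateList.2 ?_,
      hkx.trans (hD.anti _ _ _ _ le_rfl b1 (by simp only; omega) (by simp only; omega))⟩
    rcases Nat.lt_or_ge (j + 1) (2 ^ k) with h3 | h3
    · rcases k with _ | k
      · simp at h3
      · rw [pow_succ] at h1 h3 b3
        exact ⟨2 ^ k, hD.half_mem_takenBlocks hy, by omega, by omega, by omega⟩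
    · exact ⟨2 ^ k, hy, by omega, by omega, by omega⟩
  · rintro ⟨i, p⟩ hy ⟨i', p'⟩ hy' hne
    simp only [Finset.mem_coe, List.mem_toFinset] at hy hy'
    obtain ⟨⟨k, -, rfl⟩, -⟩ := mem_blockList.1 (mem_blockList_of_mem_takenBlocks hy)
    obtain ⟨⟨l, -, rfl⟩, -⟩ := mem_blockList.1 (mem_blockList_of_mem_takenBlocks hy')
    rw [Function.onFun, Finset.disjoint_left]
    rintro ⟨a, j⟩ h h'
    simp only [Finset.mem_product, Finset.mem_singleton, Finset.mem_Ico] at h h'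
    obtain ⟨rfl, h1, h2⟩ := h
    obtain ⟨rfl, h3, h4⟩ := h'
    apply hne
    have : k = l := by
      have hk := Nat.one_le_two_pow (n := k)
      have hl := Nat.one_le_two_pow (n := l)
      rcases k with _ | k <;> rcases l with _ | l
      · rfl
      · rw [pow_succ] at h3; have := Nat.one_le_two_pow (n := l); omega
      · rw [pow_succ] at h1; have := Nat.one_le_two_pow (n := k); omega
      · rw [pow_succ] at h1 h2 h3 h4
        rw [two_pow_eq_of_between (k := k) (l := l) (j := j) (by omega) (by omega) (by omega)
          (by omega)]
    rw [this]

/-- Either there are `B` candidates that are at least `x`, or all entries are candidates. The second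
case is that of a total weight of the blocks below `B`. Then `x = 0`, and all blocks are taken. -/
theorem enough_candidates (hD : IsBlockData n B K A key wt)
    (hx : IsWeightedRank (itemList (blockList n (4 * B) K).length key wt) B x) :
    B ≤ ((candidateList n B K key wt x).toFinset.filter fun c => x ≤ A c.1 c.2).card ∨
      ∀ i < n, ∀ j < n, (i, j) ∈ candidateList n B K key wt x := by
  obtain ⟨h1, h2, h3⟩ := hx
  rw [gtWeight_itemList] at h1
  rw [geWeight_itemList] at h3
  rcases le_or_gt (B : ℝ) (aboveWeight key wt x (blockList n (4 * B) K).length +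
    tieWeight key wt x (blockList n (4 * B) K).length) with h | h
  · left
    refine le_trans ?_ hD.sum_le_card
    have hB := hD.one_le
    have := (sum_takenList hD.wt_nonneg hD.wt_le (by positivity) h1.le).1
    rw [hD.sum_wt_takenList, min_eq_left h] at this
    exact_mod_cast this
  · right
    intro i hi j hj
    obtain rfl : x = 0 := h3.resolve_left (not_le.2 h)
    obtain ⟨k, hkn, hk1, hk2⟩ := exists_block hj
    have hmem : (i, 2 ^ k) ∈ blockList n (4 * B) K := by
      by_contra hc
      -- all keys are greater than `-1`, so that a block that is not listed would hold entries
      -- that are at most `-1`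
      have htot : aboveWeight key wt (-1) (blockList n (4 * B) K).length < B := by
        refine lt_of_le_of_lt ?_ h
        rw [aboveWeight, aboveWeight, tieWeight, ← Finset.sum_add_distrib]
        refine Finset.sum_le_sum fun t ht => ?_
        have ht' := Finset.mem_range.1 ht
        have hw := hD.wt_nonneg t ht'
        obtain ⟨b1, b2, b3, -⟩ := hD.bounds (i := (blockList n (4 * B) K)[t].1)
          (p := (blockList n (4 * B) K)[t].2) (List.getElem_mem ht')
        have hk0 : 0 ≤ key t := by
          rw [hD.key_eq t ht']
          exact hD.nonneg _ _ b1 (by omega)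
        rcases hk0.lt_or_eq with h0 | h0
        · simp [h0, h0.ne']; split_ifs <;> simp [hw]
        · simp [← h0]
      have := hD.le_of_not_mem_blockList htot hi hj hk1 hc
      linarith [hD.nonneg i j hi hj]
    obtain ⟨t, ht, hti⟩ := List.getElem_of_mem hmem
    refine mem_candidateList.2 ⟨2 ^ k, mem_takenBlocks.2 ⟨t, ht, ?_, hti⟩, hj, hk1, hk2⟩
    have hk0 : 0 ≤ key t := by
      rw [hD.key_eq t ht, hti]
      exact hD.nonneg _ _ hi (by simp only; omega)
    rcases hk0.lt_or_eq with h0 | h0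
    · exact Or.inl h0
    · refine Or.inr ⟨h0.symm, lt_of_le_of_lt ?_ h⟩
      have := tieWeight_mono (key := key) (x := 0) ht.le hD.wt_nonneg
      linarith

end IsBlockData

/-! ### Ranks in lists of entries -/

section Ranks

variable {E : Type*} {w : E → ℝ} {l : List E} {cw : ℕ → ℝ}

theorem card_filter_range_eq [DecidableEq E] (hl : l.Nodup)
    (hcw : ∀ t (h : t < l.length), cw t = w l[t]) (P : ℝ → Prop) [DecidablePred P] :
    ((Finset.range l.length).filter fun t => P (cw t)).card =
      (l.toFinset.filter fun e => P (w e)).card := by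
  refine Finset.card_bij (fun t ht => l[t]'(by simp at ht; exact ht.1)) ?_ ?_ ?_
  · intro t ht
    simp only [Finset.mem_filter, Finset.mem_range] at ht
    rw [hcw t ht.1] at ht
    simp [ht.2]
  · intro s hs t ht h
    exact (List.Nodup.getElem_inj_iff hl).1 h
  · intro e he
    simp only [Finset.mem_filter, List.mem_toFinset] at he
    obtain ⟨t, ht, rfl⟩ := List.getElem_of_mem he.1
    exact ⟨t, by simp [ht, hcw t ht, he.2], rfl⟩

theorem IsRank.of_range [DecidableEq E] (hl : l.Nodup)
    (hcw : ∀ t (h : t < l.length), cw t = w l[t]) {k : ℕ} {x : ℝ}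
    (h : IsRank (Finset.range l.length) cw k x) : IsRank l.toFinset w k x := by
  obtain ⟨h1, h2, h3⟩ := h
  rw [card_filter_range_eq hl hcw (fun y => x < y)] at h1
  rw [card_filter_range_eq hl hcw (fun y => x ≤ y)] at h3
  exact ⟨h1, h2, h3⟩

/-- A list of positions in the list `l` singles out a sublist. -/
theorem exists_list_of_positions {js : List ℕ} (hjs : ∀ i ∈ js, i < l.length) :
    ∃ O : List E, O.length = js.length ∧
      ∀ t (h : t < O.length), ∃ h' : t < js.length, ∃ h'' : js[t] < l.length, O[t] = l[js[t]] := by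
  refine ⟨js.pmap (fun i hi => l[i]'hi) hjs, by simp, fun t ht => ?_⟩
  simp only [List.length_pmap] at ht
  exact ⟨ht, hjs _ (List.getElem_mem ht), by simp⟩

/-- The entries found by `takeTop`. -/
theorem exists_heaviest [DecidableEq E] (hl : l.Nodup)
    (hcw : ∀ t (h : t < l.length), cw t = w l[t]) {x : ℝ} {js : List ℕ}
    (h1 : js.Pairwise (· < ·)) (h2 : ∀ i ∈ js, i < l.length)
    (h4 : ∀ i ∈ js, x ≤ cw i) (h5 : ∀ i < l.length, i ∉ js → cw i ≤ x) :
    ∃ O : List E, O.length = js.length ∧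
      (∀ t (h : t < O.length), ∃ h' : t < js.length, ∃ h'' : js[t] < l.length, O[t] = l[js[t]]) ∧
      O.Nodup ∧ (∀ R : E → E → Prop, l.Pairwise R → O.Pairwise R) ∧ (∀ e ∈ O, e ∈ l) ∧
      (∀ e ∈ O, x ≤ w e) ∧ ∀ e ∈ l, e ∉ O → w e ≤ x := by
  obtain ⟨O, hO, hOj⟩ := exists_list_of_positions h2
  have hpw : ∀ R : E → E → Prop, l.Pairwise R → O.Pairwise R := by
    intro R hR
    rw [List.pairwise_iff_getElem]
    intro s t hs ht hst
    obtain ⟨hs', hs'', hsO⟩ := hOj s hs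
    obtain ⟨ht', ht'', htO⟩ := hOj t ht
    rw [hsO, htO]
    exact List.pairwise_iff_getElem.1 hR _ _ _ _ (List.pairwise_iff_getElem.1 h1 _ _ hs' ht' hst)
  refine ⟨O, hO, hOj, hpw _ hl, hpw, ?_, ?_, ?_⟩
  · intro e he
    obtain ⟨t, ht, rfl⟩ := List.getElem_of_mem he
    obtain ⟨ht', ht'', htO⟩ := hOj t ht
    rw [htO]
    exact List.getElem_mem _
  · intro e he
    obtain ⟨t, ht, rfl⟩ := List.getElem_of_mem he
    obtain ⟨ht', ht'', htO⟩ := hOj t ht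
    rw [htO, ← hcw _ ht'']
    exact h4 _ (List.getElem_mem _)
  · intro e he hn
    obtain ⟨t, ht, rfl⟩ := List.getElem_of_mem he
    rw [← hcw _ ht]
    refine h5 t ht fun hmem => hn ?_
    obtain ⟨s, hs, rfl⟩ := List.getElem_of_mem hmem
    obtain ⟨hs', hs'', hsO⟩ := hOj s (hO ▸ hs)
    rw [← hsO]
    exact List.getElem_mem _

theorem IsRank.rankWeight_eq {A : Finset E} {k : ℕ} {x : ℝ} (hw : ∀ e ∈ A, 0 ≤ w e) (hk : 1 ≤ k)
    (h : IsRank A w k x) : rankWeight A w k = x := by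
  classical
  obtain ⟨h1, h2, h3⟩ := h
  rw [rankWeight]
  set s := (A.val.map w).sort (· ≥ ·) with hs
  have hsort : s.Pairwise (· ≥ ·) := Multiset.pairwise_sort _ _
  have hcoe : (s : Multiset ℝ) = A.val.map w := Multiset.sort_eq _ _
  have hcount : ∀ P : ℝ → Prop, ∀ [DecidablePred P],
      (A.filter fun e => P (w e)).card = s.countP fun y => P y := by
    intro P _
    rw [Finset.card_def, Finset.filter_val, ← Multiset.countP_eq_card_filter, ← Multiset.coe_countP,
      hcoe, Multiset.countP_map, ← Multiset.countP_eq_card_filter]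
  rw [hcount fun y => x < y] at h1
  rw [hcount fun y => x ≤ y] at h3
  rcases lt_or_ge (k - 1) s.length with hlt | hge
  · rw [List.getD_eq_getElem _ _ hlt]
    apply le_antisymm
    · by_contra hc
      rw [not_le] at hc
      have : k ≤ s.countP fun y => x < y := by
        have e1 : (s.take k).countP (fun y => x < y) = (s.take k).length := by
          rw [List.countP_eq_length]
          intro y hy
          obtain ⟨i, hi, rfl⟩ := List.getElem_of_mem hy
          simp only [List.length_take] at hi
          rw [List.getElem_take]
          have : s[k - 1] ≤ s[i] := by
            rcases (show i ≤ k - 1 by omega).lt_or_eq with h | h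
            · exact List.pairwise_iff_getElem.1 hsort i (k - 1) _ _ h
            · simp [h]
          simpa using hc.trans_le this
        have e2 := (List.take_sublist k s).countP_le (p := fun y => x < y)
        rw [e1, List.length_take] at e2
        omega
      omega
    · rcases h3 with h3 | rfl
      · by_contra hc
        rw [not_le] at hc
        have e1 : (s.drop (k - 1)).countP (fun y => x ≤ y) = 0 := by
          rw [List.countP_eq_zero]
          intro y hy
          obtain ⟨i, hi, rfl⟩ := List.getElem_of_mem hy
          simp only [List.length_drop] at hi
          rw [List.getElem_drop]
          have : s[k - 1 + i] ≤ s[k - 1] := by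
            rcases Nat.eq_zero_or_pos i with h | h
            · simp [h]
            · exact List.pairwise_iff_getElem.1 hsort (k - 1) (k - 1 + i) _ _ (by omega)
          simpa using this.trans_lt hc
        have e2 : s.countP (fun y => x ≤ y) = (s.take (k - 1)).countP (fun y => x ≤ y) +
            (s.drop (k - 1)).countP (fun y => x ≤ y) := by
          rw [← List.countP_append, List.take_append_drop]
        have e3 : (s.take (k - 1)).countP (fun y => x ≤ y) ≤ (s.take (k - 1)).length :=
          List.countP_le_length
        rw [List.length_take] at e3
        omega
      · have : s[k - 1] ∈ A.val.map w := by
          rw [← hcoe]; exact List.getElem_mem hlt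
        obtain ⟨e, he, h⟩ := Multiset.mem_map.1 this
        rw [← h]
        exact hw e he
  · rw [List.getD_eq_default _ _ hge]
    have e3 : s.countP (fun y => x ≤ y) ≤ s.length := List.countP_le_length
    exact (h3.resolve_left (by omega)).symm

end Ranks

/-! ### Merging entries at the same position -/

/-- The number by which positions are sorted. -/
def posCode {n : ℕ} (e : Fin n × Fin n) : ℕ := (e.1 : ℕ) * n + (e.2 : ℕ)

theorem posCode_injective {n : ℕ} : Function.Injective (posCode (n := n)) := by
  rintro ⟨i, j⟩ ⟨i', j'⟩ h
  simp only [posCode] at h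
  have hn : 0 < n := i.pos
  have h1 : (i : ℕ) = i' := by
    have := congrArg (· / n) h
    simpa [Nat.mul_comm _ n, Nat.mul_add_div hn, Nat.div_eq_of_lt i.2, Nat.div_eq_of_lt j.2,
      Nat.div_eq_of_lt j'.2] using this
  have h2 : (j : ℕ) = j' := by rw [h1] at h; omega
  exact Prod.ext (Fin.ext h1) (Fin.ext h2)

/-- The total weight of the entry `e` in a list of weighted entries. -/
noncomputable def totalWeight {n : ℕ} (T : List ((Fin n × Fin n) × ℝ)) (e : Fin n × Fin n) : ℝ :=
  (T.map fun y => if y.1 = e then y.2 else 0).sum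

theorem totalWeight_append {n : ℕ} (T T' : List ((Fin n × Fin n) × ℝ)) (e : Fin n × Fin n) :
    totalWeight (T ++ T') e = totalWeight T e + totalWeight T' e := by simp [totalWeight]

theorem totalWeight_eq_zero {n : ℕ} {T : List ((Fin n × Fin n) × ℝ)} {e : Fin n × Fin n}
    (h : ∀ y ∈ T, y.1 ≠ e) : totalWeight T e = 0 := by
  rw [totalWeight, List.map_congr_left (g := fun _ => 0) fun y hy => by simp [h y hy]]
  simp

/-- Merge the weighted entries that array `3` lists in the order of their positions: rows, columns
and weights are in the arrays `0`, `1` and `2`, the number of entries and `n` in the registers `0`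
and `1`. The merged entries go to the arrays `4`, `5` and `6`, and their number to register `0`.
Register `5` holds the number of the last position, at first `-1`. -/
def mergeDuplicates : Cmd :=
  .const 2 1 ;; .const 3 0 ;; .const 4 0 ;; .const 5 0 ;; .arith .sub 5 5 2 ;;
  .loop 3 0 (.load 6 3 3 ;; .load 7 0 6 ;; .load 8 1 6 ;; .load 9 2 6 ;; .arith .mul 10 7 1 ;;
    .arith .add 10 10 8 ;;
    .ite 5 10
      (.store 4 4 7 ;; .store 5 4 8 ;; .store 6 4 9 ;; .arith .add 4 4 2 ;; .move 5 10)
      (.arith .sub 11 4 2 ;; .load 10 6 11 ;; .arith .add 10 10 9 ;; .store 6 11 10) ;;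
    .arith .add 3 3 2) ;;
  .move 0 4

theorem wp_mergeDuplicates {n : ℕ} {T : List ((Fin n × Fin n) × ℝ)} {m : Mem}
    (h0 : m.reg 0 = T.length) (h1 : m.reg 1 = n)
    (hT : ∀ t (h : t < T.length), ∃ k : ℕ, m.arr 3 t = k ∧ m.arr 0 k = (T[t].1.1 : ℕ) ∧
      m.arr 1 k = (T[t].1.2 : ℕ) ∧ m.arr 2 k = T[t].2)
    (hs : T.Pairwise fun y z => posCode y.1 ≤ posCode z.1) :
    Wp mergeDuplicates mergeDuplicates (fun t m' => t ≤ 15 * T.length + 10 ∧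
      ∃ D : List (Fin n × Fin n), D.Pairwise (fun d e => posCode d < posCode e) ∧
        (∀ e, e ∈ D ↔ e ∈ T.map Prod.fst) ∧ m'.reg 0 = D.length ∧
        Holds (m'.arr 4) (fun e => ((e.1 : ℕ) : ℝ)) D ∧
        Holds (m'.arr 5) (fun e => ((e.2 : ℕ) : ℝ)) D ∧ Holds (m'.arr 6) (totalWeight T) D) m := by
  generalize hP : mergeDuplicates = P
  nth_rewrite 2 [← hP]
  unfold mergeDuplicates
  simp only [wp_seq, wp_const, wp_sub]
  refine wp_loop_count (fun k m' => m'.reg 3 = k ∧ ∃ D : List (Fin n × Fin n),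
      D.Pairwise (fun d e => posCode d < posCode e) ∧
      (∀ e, e ∈ D ↔ e ∈ (T.take k).map Prod.fst) ∧ m'.reg 4 = D.length ∧
      Holds (m'.arr 4) (fun e => ((e.1 : ℕ) : ℝ)) D ∧
      Holds (m'.arr 5) (fun e => ((e.2 : ℕ) : ℝ)) D ∧
      Holds (m'.arr 6) (totalWeight (T.take k)) D ∧
      ((D = [] ∧ m'.reg 5 = -1) ∨ ∃ D' e, D = D' ++ [e] ∧ m'.reg 5 = (posCode e : ℕ)))
    T.length 14 ?_ ?_ ?_ ?_
  · refine ⟨by simp, [], by simp, by simp, by simp, Holds.nil, Holds.nil, Holds.nil,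
      Or.inl ⟨rfl, by simp⟩⟩
  · rintro k m1 ⟨i3, D, hD, hDT, i4, j4, j5, j6, hlast⟩ ha hk -
    have e1 : m1.reg 1 = n := by simp [ha.1 1 rfl, h1]
    have e2 : m1.reg 2 = 1 := by simp [ha.1 2 rfl]
    have ea : m1.arr 0 = m.arr 0 := ha.2 0 rfl
    have eb : m1.arr 1 = m.arr 1 := ha.2 1 rfl
    have ec : m1.arr 2 = m.arr 2 := ha.2 2 rfl
    have ed : m1.arr 3 = m.arr 3 := ha.2 3 rfl
    obtain ⟨q, hq, hq1, hq2, hq3⟩ := hT k hk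
    obtain ⟨f, y, hfy⟩ : ∃ f y, T[k] = (f, y) := ⟨_, _, rfl⟩
    rw [hfy] at hq1 hq2 hq3
    simp only at hq1 hq2 hq3
    have hcode : ((f.1 : ℕ) : ℝ) * n + ((f.2 : ℕ) : ℝ) = (posCode f : ℕ) := by simp [posCode]
    have htake : T.take (k + 1) = T.take k ++ [(f, y)] := by
      rw [List.take_succ_eq_append_getElem hk, hfy]
    have hDle : ∀ d ∈ D, posCode d ≤ posCode f := by
      intro d hd
      obtain ⟨z, hz, rfl⟩ := List.mem_map.1 ((hDT d).1 hd)
      obtain ⟨i, hi, rfl⟩ := List.getElem_of_mem hz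
      simp only [List.length_take] at hi
      rw [List.getElem_take]
      have := List.pairwise_iff_getElem.1 hs i k (by omega) hk (by omega)
      rwa [hfy] at this
    rw [htake]
    have hT'1 : ∀ e, e ∈ (T.take k ++ [(f, y)]).map Prod.fst ↔ e ∈ D ∨ e = f := by
      intro e
      rw [List.map_append, List.mem_append, ← hDT]
      simp
    have hT'2 : ∀ e, totalWeight (T.take k ++ [(f, y)]) e =
        totalWeight (T.take k) e + if f = e then y else 0 := by
      intro e
      rw [totalWeight_append]
      simp [totalWeight]
    generalize T.take k ++ [(f, y)] = T' at hT'1 hT'2 ⊢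
    by_cases hlt : m1.reg 5 < (posCode f : ℕ)
    -- the entry is at a new position
    · have hnew : f ∉ D := by
        intro hf
        rcases hlast with ⟨rfl, -⟩ | ⟨D', e, rfl, h5⟩
        · simp at hf
        · rw [h5, Nat.cast_lt] at hlt
          rcases List.mem_append.1 hf with hf | hf
          · have := (List.pairwise_append.1 hD).2.2 f hf e (by simp)
            omega
          · simp at hf; subst hf; omega
      have hzero : totalWeight (T.take k) f = 0 := by
        refine totalWeight_eq_zero fun z hz h => hnew ?_
        rw [hDT, ← h]
        exact List.mem_map_of_mem hz
      simp [wp_ite, i3, i4, e1, e2, ea, eb, ec, ed, hq, hq1, hq2, hq3, hcode, hlt,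
        -List.mem_map, -Prod.forall, -Prod.exists]
      refine ⟨D ++ [f], ?_, ?_, by simp, j4.append rfl rfl, j5.append rfl rfl, ?_,
        Or.inr ⟨D, f, rfl, rfl⟩⟩
      · rw [List.pairwise_append]
        refine ⟨hD, by simp, fun d hd e he => ?_⟩
        simp only [List.mem_singleton] at he
        subst he
        refine lt_of_le_of_ne (hDle d hd) fun h => hnew ?_
        rwa [← posCode_injective h]
      · intro e
        rw [hT'1, List.mem_append, List.mem_singleton]
      · refine Holds.append (fun i hi => ?_) rfl (by simp [hT'2, hzero])
        rw [j6 i hi, hT'2, if_neg, add_zero]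
        rintro rfl
        exact hnew (List.getElem_mem hi)
    -- the entry is at the position of the last one, and its weight is added
    · obtain ⟨D', e, rfl, h5⟩ : ∃ D' e, D = D' ++ [e] ∧ m1.reg 5 = (posCode e : ℕ) := by
        refine hlast.resolve_left ?_
        rintro ⟨-, h⟩
        rw [h] at hlt
        have : (0 : ℝ) ≤ (posCode f : ℕ) := by positivity
        linarith
      have hef : e = f := by
        refine posCode_injective (le_antisymm (hDle e (by simp)) ?_)
        rw [h5, Nat.cast_lt] at hlt
        omega
      subst hef
      have h6 : m1.arr 6 D'.length = totalWeight (T.take k) e := by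
        have := j6 D'.length (by simp)
        simpa using this
      simp [wp_ite, i3, i4, e1, e2, ea, eb, ec, ed, hq, hq1, hq2, hq3, hcode, h5, h6,
        -List.mem_map, -Prod.forall, -Prod.exists]
      refine ⟨D' ++ [e], hD, ?_, by simp, j4, j5, ?_, Or.inr ⟨D', e, rfl, rfl⟩⟩
      · intro d
        rw [hT'1]
        constructor
        · exact Or.inl
        · rintro (h | rfl)
          · exact h
          · simp
      · refine Holds.append (fun i hi => ?_) rfl (by simp [hT'2])
        have hne : e ≠ D'[i] := by
          intro h
          have := (List.pairwise_append.1 hD).2.2 _ (List.getElem_mem hi) e (by simp)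
          rw [← h] at this
          exact lt_irrefl _ this
        have := j6 i (by simp; omega)
        rw [this, hT'2, List.getElem_append_left hi, if_neg hne, add_zero]
  · rintro k m1 ⟨i3, -⟩ ha
    have e0 : m1.reg 0 = T.length := by simp [ha.1 0 rfl, h0]
    simp [i3, e0]
  · rintro m1 t ⟨i3, D, hD, hDT, i4, j4, j5, j6, hlast⟩ ha ht
    rw [List.take_length] at hDT j6
    simp only [wp_move]
    exact ⟨by omega, D, hD, hDT, by simpa using i4, j4, j5, j6⟩

/-! ### The heaviest entries of the outer product -/

theorem length_candidateList_le {n B K : ℕ} {key wt : ℕ → ℝ} {x : ℝ} :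
    (candidateList n B K key wt x).length ≤
      ((takenBlocks n B K key wt x).map Prod.snd).sum := by
  rw [candidateList, List.length_flatMap]
  refine List.sum_le_sum fun y _ => ?_
  rw [blockCells, List.length_map]
  exact (List.length_filter_le _ _).trans (by simp)

/-- The rank `B` of the entries can be found among candidates, if the other entries are at most
`x`, and `B` candidates are at least `x`. -/
theorem IsRank.of_candidates {E : Type*} [DecidableEq E] {C U : Finset E} {w : E → ℝ} {B : ℕ}
    {x y : ℝ} (hCU : C ⊆ U) (hx : ∀ e ∈ U, e ∉ C → w e ≤ x)
    (hB : B ≤ (C.filter fun e => x ≤ w e).card ∨ C = U) (hy : IsRank C w B y) :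
    IsRank U w B y ∧ (x ≤ y ∨ C = U) := by
  rcases hB with hB | rfl
  · obtain ⟨h1, h2, h3⟩ := hy
    have hxy : x ≤ y := by
      by_contra hc
      rw [not_le] at hc
      have : (C.filter fun e => x ≤ w e).card ≤ (C.filter fun e => y < w e).card :=
        Finset.card_le_card (Finset.monotone_filter_right _ fun e _ h => hc.trans_le h)
      omega
    refine ⟨⟨?_, h2, h3.imp_left fun h => h.trans ?_⟩, Or.inl hxy⟩
    · have : (U.filter fun e => y < w e) = C.filter fun e => y < w e := by
        ext e
        simp only [Finset.mem_filter]
        refine ⟨fun ⟨he, hye⟩ => ⟨?_, hye⟩, fun ⟨he, hye⟩ => ⟨hCU he, hye⟩⟩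
        by_contra hn
        exact absurd (hxy.trans_lt hye) (not_lt.2 (hx e he hn))
      rwa [this]
    · exact Finset.card_le_card (Finset.filter_subset_filter _ hCU)
  · exact ⟨hy, Or.inr rfl⟩

/-- The heaviest of the candidates are the heaviest of all entries of the outer product. The
candidates are positions of the matrix whose rows and columns have been sorted by `σ` and `τ`. -/
theorem exists_heaviest_outer {n b K : ℕ} {u v : Fin n → ℝ} {σ τ : Equiv.Perm (Fin n)}
    {us vs key wt cw : ℕ → ℝ} {x y : ℝ} {js : List ℕ} (hus : ∀ i : Fin n, us i = u (σ i))
    (hvs : ∀ i : Fin n, vs i = v (τ i))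
    (hD : IsBlockData n (b + 1) K (fun i j => us i * vs j) key wt)
    (hx : IsWeightedRank (itemList (blockList n (4 * (b + 1)) K).length key wt)
      ((b + 1 : ℕ) : ℝ) x)
    (hcw : Holds cw (fun c => us c.1 * vs c.2) (candidateList n (b + 1) K key wt x))
    (hy : IsRank (Finset.range (candidateList n (b + 1) K key wt x).length) cw (b + 1) y)
    (h1 : js.Pairwise (· < ·)) (h2 : ∀ i ∈ js, i < (candidateList n (b + 1) K key wt x).length)
    (h3 : js.length = min b (candidateList n (b + 1) K key wt x).length)
    (h4 : ∀ i ∈ js, y ≤ cw i)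
    (h5 : ∀ i < (candidateList n (b + 1) K key wt x).length, i ∉ js → cw i ≤ y) :
    ∃ O : List (Fin n × Fin n), O.length = js.length ∧
      (∀ t (h : t < O.length), ∃ c : ℕ × ℕ, ∃ hc : c.1 < n ∧ c.2 < n,
        ∃ h' : t < js.length, ∃ h'' : js[t] < (candidateList n (b + 1) K key wt x).length,
        c = (candidateList n (b + 1) K key wt x)[js[t]] ∧
        O[t] = (σ ⟨c.1, hc.1⟩, τ ⟨c.2, hc.2⟩)) ∧
      O.Nodup ∧ IsRank Finset.univ (outer u v) (b + 1) y ∧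
      IsHeaviest b Finset.univ (outer u v) O.toFinset ∧ ∀ e ∈ O, y ≤ outer u v e := by
  classical
  set C := candidateList n (b + 1) K key wt x with hC
  have hlt : ∀ c ∈ C, c.1 < n ∧ c.2 < n := fun c hc => lt_of_mem_candidateList hc
  set Cf : List (Fin n × Fin n) :=
    C.pmap (fun c hc => (σ ⟨c.1, hc.1⟩, τ ⟨c.2, hc.2⟩)) hlt with hCf
  have hlen : Cf.length = C.length := by simp [hCf]
  have hget : ∀ t (h : t < Cf.length), ∃ h' : t < C.length,
      Cf[t] = (σ ⟨C[t].1, (hlt _ (List.getElem_mem h')).1⟩,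
        τ ⟨C[t].2, (hlt _ (List.getElem_mem h')).2⟩) := by
    intro t h
    exact ⟨hlen ▸ h, by simp [hCf]⟩
  have hnd : Cf.Nodup := by
    refine List.Nodup.pmap ?_ candidateList_nodup
    rintro ⟨i, j⟩ hi ⟨i', j'⟩ hi' h
    simpa using h
  have hcw' : ∀ t (h : t < Cf.length), cw t = outer u v Cf[t] := by
    intro t h
    obtain ⟨h', he⟩ := hget t h
    rw [he, hcw t h', outer, ← hus, ← hvs]
  rw [← hlen] at hy h3 h5
  have hrank := hy.of_range hnd hcw'
  have hout : ∀ e : Fin n × Fin n, e ∉ Cf.toFinset → outer u v e ≤ x := by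
    intro e he
    have := hD.le_of_not_mem_candidateList (x := x) (i := σ.symm e.1) (j := τ.symm e.2)
      (by have := hx.1; rwa [gtWeight_itemList] at this) (Fin.is_lt _) (Fin.is_lt _) ?_
    · simpa [hus, hvs, outer] using this
    · intro hmem
      apply he
      rw [List.mem_toFinset, hCf, List.mem_pmap]
      exact ⟨_, hmem, by simp⟩
  have hcount : b + 1 ≤ (Cf.toFinset.filter fun e => x ≤ outer u v e).card ∨
      Cf.toFinset = Finset.univ := by
    refine (hD.enough_candidates hx).imp (fun h => ?_) fun h => ?_
    · rw [← card_filter_range_eq hnd hcw' (fun r => x ≤ r), hlen,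
        card_filter_range_eq (w := fun c : ℕ × ℕ => us c.1 * vs c.2) candidateList_nodup hcw
          (fun r => x ≤ r)]
      exact h
    · rw [Finset.eq_univ_iff_forall]
      intro e
      rw [List.mem_toFinset, hCf, List.mem_pmap]
      exact ⟨_, h _ (σ.symm e.1).2 _ (τ.symm e.2).2, by simp⟩
  -- `y` is at least `x`, and therefore at least every entry that is not a candidate
  obtain ⟨hrank', hxy⟩ := hrank.of_candidates (Finset.subset_univ _) (fun e _ => hout e) hcount
  obtain ⟨O, hO, hOj, hOnd, -, hOC, hOy, hOn⟩ := exists_heaviest hnd hcw' h1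
    (by rwa [hlen]) h4 h5
  refine ⟨O, hO, ?_, hOnd, hrank', ⟨Finset.subset_univ _, ?_, ?_⟩, hOy⟩
  · intro t ht
    obtain ⟨h', h'', he⟩ := hOj t ht
    obtain ⟨g, ge⟩ := hget _ h''
    exact ⟨_, hlt _ (List.getElem_mem g), h', g, rfl, he.trans ge⟩
  · rw [List.toFinset_card_of_nodup hOnd, hO, h3, ← List.toFinset_card_of_nodup hnd]
    rcases hcount with h | h
    · have e1 := h.trans (Finset.card_le_card (Finset.filter_subset _ _))
      have e2 := Finset.card_le_card (Finset.subset_univ Cf.toFinset)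
      omega
    · rw [h]
  · intro e he f _ hf
    rw [List.mem_toFinset] at he hf
    refine le_trans ?_ (hOy e he)
    by_cases hfC : f ∈ Cf
    · exact hOn f hfC hf
    · rcases hxy with h | h
      · exact (hout f (by simpa using hfC)).trans h
      · rw [← List.mem_toFinset, h] at hfC
        exact absurd (Finset.mem_univ f) hfC

/-- The vectors are in the arrays `0` and `1`, and `n` and `b` in the registers `0` and `1`. List
the `b` heaviest entries of the outer product: rows, columns and weights, decreased by the weight
of rank `b + 1`, go to the arrays `2`, `3` and `4`, and their number to register `0`. The arrays
`5` and `7` hold the orders of the vectors, and `6` and `8` the sorted vectors; the blocks are in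
the arrays `9` to `13`, and the candidates in `14`, `15` and `16`. -/
def heavyEntries (sorter : Cmd) : Cmd :=
  .call (sortVector sorter) [0] [0, 5, 6] 2 ;;
  .call (sortVector sorter) [0] [1, 7, 8] 2 ;;
  .const 2 1 ;; .arith .add 3 1 2 ;;
  .call listBlocks [0, 3] [6, 8, 9, 10, 11, 12] 4 ;;
  .call select [4, 3] [9, 10] 5 ;;
  .call takeItems [4, 3, 5] [9, 10, 13] 6 ;;
  .call expandBlocks [0, 6] [6, 8, 11, 12, 13, 14, 15, 16] 7 ;;
  .call takeTop [7, 1] [16, 17, 4] 8 ;;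
  .const 9 0 ;;
  .loop 9 8 (.load 10 17 9 ;; .load 11 14 10 ;; .load 11 5 11 ;; .store 2 9 11 ;;
    .load 11 15 10 ;; .load 11 7 11 ;; .store 3 9 11 ;; .arith .add 9 9 2) ;;
  .move 0 8

theorem wp_heavyEntries {D : ℕ → Set ℝ} {sorter : Cmd} {T : ℕ → ℕ} (h : SortsInTime D sorter T)
    {n b : ℕ} (u v : Fin n → ℝ) (hu : ∀ i, 0 ≤ u i ∧ u i ∈ D n) (hv : ∀ i, 0 ≤ v i ∧ v i ∈ D n)
    {m : Mem} (h0 : m.reg 0 = n) (h1 : m.reg 1 = b) (ha0 : ∀ i : Fin n, m.arr 0 i = u i)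
    (ha1 : ∀ i : Fin n, m.arr 1 i = v i) (hz5 : m.arr 5 = fun _ => 0)
    (hz7 : m.arr 7 = fun _ => 0) :
    Wp (heavyEntries sorter) (heavyEntries sorter) (fun t m' => t ≤ 400000 * (b + T n) ∧
      ∃ (x : ℝ) (O : List (Fin n × Fin n)), O.Nodup ∧
        IsRank Finset.univ (outer u v) (b + 1) x ∧
        IsHeaviest b Finset.univ (outer u v) O.toFinset ∧ (∀ e ∈ O, x ≤ outer u v e) ∧
        m'.reg 0 = O.length ∧ Holds (m'.arr 2) (fun e => ((e.1 : ℕ) : ℝ)) O ∧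
        Holds (m'.arr 3) (fun e => ((e.2 : ℕ) : ℝ)) O ∧
        Holds (m'.arr 4) (fun e => outer u v e - x) O) m := by
  classical
  generalize hP : heavyEntries sorter = P
  nth_rewrite 2 [← hP]
  unfold heavyEntries
  obtain ⟨hT1, hTn⟩ := h.le_two_mul u fun i => (hu i).2
  rw [wp_seq]
  refine wp_call (by decide) ((wp_sortVector h u (fun i => (hu i).2) _ (by simpa using h0)
    (by simpa using ha0) (by simpa using hz5) (by simp)).frame.mono ?_)
  rintro t1 m1 ⟨⟨ht1, σ, hσ, p1, q1⟩, g1⟩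
  have c1 := g1.2 0 rfl
  obtain ⟨M1, hM1⟩ : ∃ M, M = m.leave m1 [0, 5, 6] 2 := ⟨_, rfl⟩
  rw [← hM1]
  have M1r0 : M1.reg 0 = n := by simp [hM1, h0]
  have M1r1 : M1.reg 1 = b := by simp [hM1, h1]
  have M1a1 : ∀ i : Fin n, M1.arr 1 i = v i := by simpa [hM1] using ha1
  have M1a5 : ∀ i : Fin n, M1.arr 5 i = (σ i : ℕ) := by simpa [hM1] using p1
  have M1a6 : ∀ i : Fin n, M1.arr 6 i = u (σ i) := by simpa [hM1] using q1
  have M1a7 : M1.arr 7 = fun _ => 0 := by simp [hM1, hz7]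
  clear hM1 g1 p1 q1 c1
  rw [wp_seq]
  refine wp_call (by decide) ((wp_sortVector h v (fun i => (hv i).2) _ (by simpa using M1r0)
    (by simpa using M1a1) (by simpa using M1a7) (by simp)).frame.mono ?_)
  rintro t2 m2 ⟨⟨ht2, τ, hτ, p1, q1⟩, g1⟩
  obtain ⟨M2, hM2⟩ : ∃ M, M = M1.leave m2 [1, 7, 8] 2 := ⟨_, rfl⟩
  rw [← hM2]
  have M2r0 : M2.reg 0 = n := by simp [hM2, M1r0]
  have M2r1 : M2.reg 1 = b := by simp [hM2, M1r1]
  have M2a5 : ∀ i : Fin n, M2.arr 5 i = (σ i : ℕ) := by simpa [hM2] using M1a5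
  have M2a6 : ∀ i : Fin n, M2.arr 6 i = u (σ i) := by simpa [hM2] using M1a6
  have M2a7 : ∀ i : Fin n, M2.arr 7 i = (τ i : ℕ) := by simpa [hM2] using p1
  have M2a8 : ∀ i : Fin n, M2.arr 8 i = v (τ i) := by simpa [hM2] using q1
  clear hM2 g1 p1 q1
  simp only [wp_seq, wp_const, wp_add]
  set M3 := (M2.setReg 2 ((1 : ℕ) : ℝ)).setReg 3
    ((M2.setReg 2 ((1 : ℕ) : ℝ)).reg 1 + (M2.setReg 2 ((1 : ℕ) : ℝ)).reg 2) with hM3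
  have M3r0 : M3.reg 0 = n := by simp [hM3, M2r0]
  have M3r1 : M3.reg 1 = b := by simp [hM3, M2r1]
  have M3r2 : M3.reg 2 = 1 := by simp [hM3]
  have M3r3 : M3.reg 3 = ((b + 1 : ℕ) : ℝ) := by simp [hM3, M2r1]
  have M3a5 : ∀ i : Fin n, M3.arr 5 i = (σ i : ℕ) := by simpa [hM3] using M2a5
  have M3a7 : ∀ i : Fin n, M3.arr 7 i = (τ i : ℕ) := by simpa [hM3] using M2a7
  obtain ⟨us, hus'⟩ : ∃ us, us = M3.arr 6 := ⟨_, rfl⟩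
  obtain ⟨vs, hvs'⟩ : ∃ vs, vs = M3.arr 8 := ⟨_, rfl⟩
  have hus : ∀ i : Fin n, us i = u (σ i) := by simpa [hM3, hus'] using M2a6
  have hvs : ∀ i : Fin n, vs i = v (τ i) := by simpa [hM3, hvs'] using M2a8
  have M3a6 := hus'.symm
  have M3a8 := hvs'.symm
  clear_value M3
  clear M2r0 M2r1 M2a5 M2a6 M2a7 M2a8 hM3 hus' hvs' M2
  set B := b + 1 with hB
  -- from here on, `us` and `vs` are the sorted vectors
  refine wp_call (by decide) ((wp_listBlocks (n := n) (B := B) (by simpa using M3r0)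
    (by simpa using M3r3)).frame.mono ?_)
  rintro t4 m4 ⟨⟨ht4, K, hK, hK', k0, k2, k3, k4, k5⟩, g1⟩
  obtain ⟨M4, hM4⟩ : ∃ M, M = M3.leave m4 [6, 8, 9, 10, 11, 12] 4 := ⟨_, rfl⟩
  rw [← hM4]
  set bl := blockList n (4 * B) K with hbl
  have c0 := g1.2 0 rfl
  have c1 := g1.2 1 rfl
  simp only [Mem.enter_arr, List.getElem?_cons_zero, List.getElem?_cons_succ, Option.elim_some,
    M3a6, M3a8] at k2 c0 c1
  have M4r0 : M4.reg 0 = n := by simp [hM4, M3r0]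
  have M4r1 : M4.reg 1 = b := by simp [hM4, M3r1]
  have M4r2 : M4.reg 2 = 1 := by simp [hM4, M3r2]
  have M4r3 : M4.reg 3 = (B : ℝ) := by simp [hM4, M3r3]
  have M4r4 : M4.reg 4 = bl.length := by simp [hM4, k0]
  have M4a5 : ∀ i : Fin n, M4.arr 5 i = (σ i : ℕ) := by simpa [hM4] using M3a5
  have M4a7 : ∀ i : Fin n, M4.arr 7 i = (τ i : ℕ) := by simpa [hM4] using M3a7
  have M4a6 : M4.arr 6 = us := by simpa [hM4] using c0
  have M4a8 : M4.arr 8 = vs := by simpa [hM4] using c1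
  have M4a11 : Holds (M4.arr 11) (fun x => (x.1 : ℝ)) bl := by simpa [hM4] using k4
  have M4a12 : Holds (M4.arr 12) (fun x => (x.2 : ℝ)) bl := by simpa [hM4] using k5
  obtain ⟨key, hkey'⟩ : ∃ a, a = M4.arr 9 := ⟨_, rfl⟩
  obtain ⟨wt, hwt'⟩ : ∃ a, a = M4.arr 10 := ⟨_, rfl⟩
  have hkey : Holds key (fun x => us x.1 * vs (x.2 - 1)) bl := by simpa [hkey', hM4] using k2
  have hwt : Holds wt (fun x => ((x.2 - x.2 / 2 : ℕ) : ℝ)) bl := by simpa [hwt', hM4] using k3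
  have M4a9 := hkey'.symm
  have M4a10 := hwt'.symm
  clear hM4 k0 k2 k3 k4 k5 c0 c1 g1 hkey' hwt'
  have husv : ∀ i : ℕ, i < n → 0 ≤ us i := fun i hi => (hus ⟨i, hi⟩).symm ▸ (hu _).1
  have hvsv : ∀ i : ℕ, i < n → 0 ≤ vs i := fun i hi => (hvs ⟨i, hi⟩).symm ▸ (hv _).1
  have hD : IsBlockData n B K (fun i j => us i * vs j) key wt := by
    refine ⟨by omega, hK, hK', ?_, ?_, hkey, hwt⟩
    · intro i j i' j' hi hin hj hjn
      have e1 : us i ≤ us i' := by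
        rw [hus ⟨i, hin⟩, hus ⟨i', by omega⟩]
        exact hσ (show (⟨i', by omega⟩ : Fin n) ≤ ⟨i, hin⟩ from hi)
      have e2 : vs j ≤ vs j' := by
        rw [hvs ⟨j, hjn⟩, hvs ⟨j', by omega⟩]
        exact hτ (show (⟨j', by omega⟩ : Fin n) ≤ ⟨j, hjn⟩ from hj)
      exact mul_le_mul e1 e2 (hvsv _ hjn) (husv _ (by omega))
    · intro i j hi hj
      exact mul_nonneg (husv _ hi) (hvsv _ hj)
  -- every further step costs time proportional to this length, or to that of the candidate list
  have hbl8 : bl.length ≤ 8 * B := (length_blockList_le n (4 * B) K).trans (by omega)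
  refine (selectCorrect (itemList bl.length key wt)).wp_call (T := B) (by decide) ?_
    (by positivity) (by simpa using M4r4) M4r3 (by simpa [M4a9] using holds_fst_itemList _ _ _)
    (by simpa [M4a10] using holds_snd_itemList _ _ _) ?_
  · intro y hy
    simp only [itemList, List.mem_map, List.mem_range] at hy
    obtain ⟨t, ht, rfl⟩ := hy
    obtain ⟨b1, b2, b3, -⟩ := hD.bounds (i := bl[t].1) (p := bl[t].2) (List.getElem_mem ht)
    refine ⟨?_, ?_⟩
    · rw [hkey t ht]
      exact mul_nonneg (husv _ b1) (hvsv _ (by omega))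
    · rw [hwt t ht]
      have : 0 < bl[t].2 - bl[t].2 / 2 := by omega
      show (0 : ℝ) < ((bl[t].2 - bl[t].2 / 2 : ℕ) : ℝ)
      exact_mod_cast this
  intro t5 x hx ht5
  have hxB : aboveWeight key wt x bl.length < B := by
    have := hx.1
    rwa [gtWeight_itemList] at this
  simp only [length_itemList] at ht5
  obtain ⟨M5, hM5⟩ : ∃ M, M = M4.setReg 5 x := ⟨_, rfl⟩
  rw [← hM5]
  have M5r0 : M5.reg 0 = n := by simp [hM5, M4r0]
  have M5r1 : M5.reg 1 = b := by simp [hM5, M4r1]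
  have M5r2 : M5.reg 2 = 1 := by simp [hM5, M4r2]
  have M5r3 : M5.reg 3 = (B : ℝ) := by simp [hM5, M4r3]
  have M5r4 : M5.reg 4 = bl.length := by simp [hM5, M4r4]
  have M5r5 : M5.reg 5 = x := by simp [hM5]
  have M5arr : M5.arr = M4.arr := by simp [hM5]
  rw [← M5arr] at M4a5 M4a6 M4a7 M4a8 M4a9 M4a10 M4a11 M4a12
  clear hM5 M5arr M4r0 M4r1 M4r2 M4r3 M4r4 M4
  refine wp_call (by decide) ((wp_takeItems (M := bl.length) (T := B) (x := x) (by simpa using M5r4)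
    (by simpa using M5r3) (by simpa using M5r5)).frame.mono ?_)
  rintro t6 m6 ⟨⟨ht6, p0, p2⟩, g1⟩
  obtain ⟨M6, hM6⟩ : ∃ M, M = M5.leave m6 [9, 10, 13] 6 := ⟨_, rfl⟩
  rw [← hM6]
  simp only [Mem.enter_arr, List.getElem?_cons_zero, List.getElem?_cons_succ, Option.elim_some,
    M4a9, M4a10] at p0 p2
  set tl := takenList key wt B x bl.length with htl
  have M6r0 : M6.reg 0 = n := by simp [hM6, M5r0]
  have M6r1 : M6.reg 1 = b := by simp [hM6, M5r1]
  have M6r2 : M6.reg 2 = 1 := by simp [hM6, M5r2]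
  have M6r6 : M6.reg 6 = tl.length := by simp [hM6, p0]
  have M6a5 : ∀ i : Fin n, M6.arr 5 i = (σ i : ℕ) := by simpa [hM6] using M4a5
  have M6a7 : ∀ i : Fin n, M6.arr 7 i = (τ i : ℕ) := by simpa [hM6] using M4a7
  have M6a6 : M6.arr 6 = us := by simpa [hM6] using M4a6
  have M6a8 : M6.arr 8 = vs := by simpa [hM6] using M4a8
  have M6a11 : Holds (M6.arr 11) (fun x => (x.1 : ℝ)) bl := by simpa [hM6] using M4a11
  have M6a12 : Holds (M6.arr 12) (fun x => (x.2 : ℝ)) bl := by simpa [hM6] using M4a12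
  have M6a13 : Holds (M6.arr 13) (Nat.cast : ℕ → ℝ) tl := by simpa [hM6] using p2
  clear hM6 p0 p2 g1 M4a5 M4a6 M4a7 M4a8 M4a9 M4a10 M4a11 M4a12
  have hX : (takenBlocks n B K key wt x).length = tl.length := by
    rw [takenBlocks, List.length_map]
  have htl8 : tl.length ≤ 8 * B :=
    ((List.length_filter_le _ _).trans (by simp)).trans hbl8
  refine wp_call (by decide) ((wp_expandBlocks (n := n) (X := takenBlocks n B K key wt x)
    (by simpa using M6r0) (by simpa [hX] using M6r6) ?_ ?_).frame.mono ?_)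
  · intro t ht
    have ht' : t < tl.length := hX ▸ ht
    have hlt : tl[t] < bl.length := (mem_takenList.1 (List.getElem_mem ht')).1
    have hget : (takenBlocks n B K key wt x)[t] = bl[tl[t]] := by
      simp only [takenBlocks, List.getElem_map]
      exact List.getD_eq_getElem _ _ hlt
    refine ⟨tl[t], ?_, ?_, ?_⟩
    · simpa using M6a13 t ht'
    · simpa [hget] using M6a11 _ hlt
    · simpa [hget] using M6a12 _ hlt
  · rintro ⟨i, p⟩ hy
    exact (hD.bounds (mem_blockList_of_mem_takenBlocks hy)).2.1
  rintro t7 m7 ⟨⟨ht7, p0, p5, p6, p7⟩, g1⟩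
  obtain ⟨M7, hM7⟩ : ∃ M, M = M6.leave m7 [6, 8, 11, 12, 13, 14, 15, 16] 7 := ⟨_, rfl⟩
  rw [← hM7]
  change m7.reg 0 = (candidateList n B K key wt x).length at p0
  change Holds _ _ (candidateList n B K key wt x) at p5 p6 p7
  have hCl : (candidateList n B K key wt x).length ≤ 6 * B :=
    length_candidateList_le.trans (hD.sum_takenBlocks_le hxB)
  have hsum := hD.sum_takenBlocks_le hxB
  set C := candidateList n B K key wt x with hC
  simp only [Mem.enter_arr, List.getElem?_cons_zero, List.getElem?_cons_succ, Option.elim_some,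
    M6a6, M6a8] at p7
  have M7r0 : M7.reg 0 = n := by simp [hM7, M6r0]
  have M7r1 : M7.reg 1 = b := by simp [hM7, M6r1]
  have M7r2 : M7.reg 2 = 1 := by simp [hM7, M6r2]
  have M7r7 : M7.reg 7 = C.length := by simp [hM7, p0]
  have M7a5 : ∀ i : Fin n, M7.arr 5 i = (σ i : ℕ) := by simpa [hM7] using M6a5
  have M7a7 : ∀ i : Fin n, M7.arr 7 i = (τ i : ℕ) := by simpa [hM7] using M6a7
  have M7a14 : Holds (M7.arr 14) (fun x => (x.1 : ℝ)) C := by simpa [hM7] using p5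
  have M7a15 : Holds (M7.arr 15) (fun x => (x.2 : ℝ)) C := by simpa [hM7] using p6
  have M7a16 : Holds (M7.arr 16) (fun c => us c.1 * vs c.2) C := by simpa [hM7] using p7
  clear hM7 p0 p5 p6 p7 g1 M6a5 M6a6 M6a7 M6a8 M6a11 M6a12 M6a13
  refine wp_call (by decide) ((wp_takeTop (N := C.length) (b := b) (by simpa using M7r7)
    (by simpa using M7r1) ?_).frame.mono ?_)
  · intro i hi
    have hlt := lt_of_mem_candidateList (List.getElem_mem (h := hi))
    simp only [Mem.enter_arr, List.getElem?_cons_zero, Option.elim_some, M7a16 i hi]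
    exact mul_nonneg (husv _ hlt.1) (hvsv _ hlt.2)
  rintro t8 m8 ⟨⟨ht8, -, y, js, hy, j1, j2, j3, j4, j5, p0, p1, p2⟩, g1⟩
  simp only [Mem.enter_arr, List.getElem?_cons_zero, Option.elim_some] at hy j4 j5 p2
  obtain ⟨O, hO, hOj, hOnd, hOr, hOh, hOy⟩ :=
    exists_heaviest_outer hus hvs hD hx M7a16 hy j1 j2 j3 j4 j5
  obtain ⟨M8, hM8⟩ : ∃ M, M = M7.leave m8 [16, 17, 4] 8 := ⟨_, rfl⟩
  rw [← hM8]
  have M8r2 : M8.reg 2 = 1 := by simp [hM8, M7r2]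
  have M8r8 : M8.reg 8 = O.length := by simp [hM8, p0, hO]
  have M8a5 : ∀ i : Fin n, M8.arr 5 i = (σ i : ℕ) := by simpa [hM8] using M7a5
  have M8a7 : ∀ i : Fin n, M8.arr 7 i = (τ i : ℕ) := by simpa [hM8] using M7a7
  have M8a14 : Holds (M8.arr 14) (fun x => (x.1 : ℝ)) C := by simpa [hM8] using M7a14
  have M8a15 : Holds (M8.arr 15) (fun x => (x.2 : ℝ)) C := by simpa [hM8] using M7a15
  have M8a17 : Holds (M8.arr 17) (Nat.cast : ℕ → ℝ) js := by simpa [hM8] using p1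
  have M8a4 : Holds (M8.arr 4) (fun e => outer u v e - y) O := by
    intro t ht
    obtain ⟨c, hc, h', h'', hcC, hOt⟩ := hOj t ht
    have e1 : M8.arr 4 t = M7.arr 16 js[t] - y := by simpa [hM8] using p2 t h'
    have e2 : outer u v O[t] = us c.1 * vs c.2 := by
      rw [hOt]
      simp only [outer]
      rw [← hus, ← hvs]
    rw [e1, M7a16 _ h'']
    simp only [e2]
    rw [hcC]
  clear hM8 p0 p1 p2 g1 M7a5 M7a7 M7a14 M7a15
  -- translate the positions in the sorted matrix to positions in the outer product
  refine wp_loop_count (fun k m' => m'.reg 9 = k ∧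
    Holds (m'.arr 2) (fun e => ((e.1 : ℕ) : ℝ)) (O.take k) ∧
    Holds (m'.arr 3) (fun e => ((e.2 : ℕ) : ℝ)) (O.take k)) O.length 9 ?_ ?_ ?_ ?_
  · simp [Holds.nil]
  · rintro k m1 ⟨i9, i2, i3⟩ ha hk -
    obtain ⟨c, hc, h', h'', hcC, hOt⟩ := hOj k hk
    have e2 : m1.reg 2 = 1 := by simp [ha.1 2 rfl, M8r2]
    have e17 : m1.arr 17 k = js[k] := by simpa [ha.2 17 rfl] using M8a17 k h'
    have e14 : m1.arr 14 js[k] = c.1 := by simpa [ha.2 14 rfl, hcC] using M8a14 _ h''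
    have e15 : m1.arr 15 js[k] = c.2 := by simpa [ha.2 15 rfl, hcC] using M8a15 _ h''
    have e5 : m1.arr 5 c.1 = (O[k].1 : ℕ) := by
      simpa [ha.2 5 rfl, hOt] using M8a5 ⟨c.1, hc.1⟩
    have e7 : m1.arr 7 c.2 = (O[k].2 : ℕ) := by
      simpa [ha.2 7 rfl, hOt] using M8a7 ⟨c.2, hc.2⟩
    have hl : k = (O.take k).length := by simp [hk.le]
    have n2 := i2.append (x := O[k]) hl rfl
    have n3 := i3.append (x := O[k]) hl rfl
    simp only [wp_seq, wp_load, wp_store, wp_add]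
    rw [← List.take_succ_eq_append_getElem hk] at n2 n3
    simp only [Mem.setReg_reg, Mem.setReg_arr, Mem.setArr_reg, Mem.setArr_arr]
    simp
    refine ⟨k, i9, js[k], e17, c.1, e14, k, i9, js[k], e17, c.2, e15, k, i9, by rw [i9, e2], ?_, ?_⟩
    · rwa [e5]
    · rwa [e7]
  · rintro k m1 ⟨i9, -⟩ ha
    have e8 : m1.reg 8 = O.length := by simp [ha.1 8 rfl, M8r8]
    rw [i9, e8, Nat.cast_lt]
  · rintro m1 t9 ⟨-, i2, i3⟩ ha ht9
    simp only [List.take_length] at i2 i3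
    have e8 : m1.reg 8 = O.length := by simp [ha.1 8 rfl, M8r8]
    have e4 : m1.arr 4 = M8.arr 4 := ha.2 4 rfl
    rw [wp_move]
    refine ⟨?_, y, O, hOnd, hOr, hOh, hOy, by simpa using e8, by simpa using i2, by simpa using i3,
      by simpa [e4] using M8a4⟩
    have hOb : O.length ≤ b := by omega
    simp only [List.length_cons, List.length_nil, hX] at *
    omega

/-! ### Updating the summary -/

theorem totalWeight_perm {n : ℕ} {T T' : List ((Fin n × Fin n) × ℝ)} (h : T.Perm T') :
    totalWeight T = totalWeight T' :=
  funext fun _ => (h.map _).sum_eq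

theorem totalWeight_nonneg {n : ℕ} {T : List ((Fin n × Fin n) × ℝ)} (h : ∀ y ∈ T, 0 ≤ y.2)
    (e : Fin n × Fin n) : 0 ≤ totalWeight T e := by
  refine List.sum_nonneg fun r hr => ?_
  obtain ⟨y, hy, rfl⟩ := List.mem_map.1 hr
  split_ifs
  exacts [h y hy, le_rfl]

/-- Sorting by the column and then, with a stable algorithm, by the row sorts the entries by their
position. -/
theorem exists_sorted {n : ℕ} (T : List ((Fin n × Fin n) × ℝ)) {f g : ℕ → ℕ}
    (hf : ∀ t (h : t < T.length), f t = (T[t].1.1 : ℕ))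
    (hg : ∀ t (h : t < T.length), g t = (T[t].1.2 : ℕ)) :
    (bucketList f n (bucketList g n (List.range T.length))).length = T.length ∧
    ∃ T' : List ((Fin n × Fin n) × ℝ), T'.Perm T ∧
      (T'.Pairwise fun y z => posCode y.1 ≤ posCode z.1) ∧
      ∀ t (h : t < T'.length),
        ∃ h' : t < (bucketList f n (bucketList g n (List.range T.length))).length,
        ∃ h'' : (bucketList f n (bucketList g n (List.range T.length)))[t] < T.length,
          T'[t] = T[(bucketList f n (bucketList g n (List.range T.length)))[t]] := by
  have hpg : (bucketList g n (List.range T.length)).Perm (List.range T.length) :=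
    bucketList_perm fun t ht => by
      have ht' := List.mem_range.1 ht
      rw [hg t ht']
      exact Fin.is_lt _
  have hp : (bucketList f n (bucketList g n (List.range T.length))).Perm (List.range T.length) := by
    refine (bucketList_perm fun t ht => ?_).trans hpg
    have ht' := List.mem_range.1 (hpg.mem_iff.1 ht)
    rw [hf t ht']
    exact Fin.is_lt _
  have hpw := bucketList_pairwise (f := f) (n := n)
    (bucketList_pairwise (f := g) (n := n) (List.pairwise_lt_range (n := T.length)))
  generalize bucketList f n (bucketList g n (List.range T.length)) = ord at hp hpw ⊢
  have hlt : ∀ t ∈ ord, t < T.length := fun t ht => List.mem_range.1 (hp.mem_iff.1 ht)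
  refine ⟨by simpa using hp.length_eq, ord.pmap (fun t h => T[t]'h) hlt, ?_, ?_, ?_⟩
  · refine (List.Perm.pmap _ hp (H₂ := fun t ht => List.mem_range.1 ht)).trans ?_
    refine List.Perm.of_eq (List.ext_getElem (by simp) fun t h1 h2 => ?_)
    simp
  · rw [List.pairwise_pmap]
    refine hpw.imp fun {s t} h hs ht => ?_
    rw [hf _ hs, hf _ ht, hg _ hs, hg _ ht] at h
    have h1 := T[s].1.2.2
    simp only [posCode]
    rcases h with h | ⟨h, h' | ⟨h', -⟩⟩
    · have := Nat.mul_le_mul_right n h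
      rw [Nat.succ_mul] at this
      omega
    · rw [h]; omega
    · rw [h, h']
  · intro t ht
    have ht' : t < ord.length := by simpa using ht
    exact ⟨ht', hlt _ (List.getElem_mem ht'), by simp⟩

/-- Two lists of weighted entries are in the arrays `0`, `1`, `2` and `3`, `4`, `5` (rows, columns,
weights). Their lengths are in the registers `2` and `3`, and `n` and `b` in the registers `0` and
`1`. The first list is replaced by the `b` heaviest entries of the union of the two lists, with
their weights decreased by the weight of rank `b + 1`; their number goes to register `0`. -/
def mergeSummary : Cmd :=
  .const 4 1 ;; .const 5 0 ;; .move 6 2 ;;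
  .loop 5 3 (.load 7 3 5 ;; .store 0 6 7 ;; .load 7 4 5 ;; .store 1 6 7 ;;
    .load 7 5 5 ;; .store 2 6 7 ;; .arith .add 5 5 4 ;; .arith .add 6 6 4) ;;
  .const 5 0 ;;
  .loop 5 6 (.store 6 5 5 ;; .arith .add 5 5 4) ;;
  .call bucketSort [6, 0] [6, 1, 7] 7 ;;
  .call bucketSort [6, 0] [7, 0, 8] 7 ;;
  .call mergeDuplicates [6, 0] [0, 1, 2, 8, 9, 10, 11] 8 ;;
  .call takeTop [8, 1] [11, 12, 13] 9 ;;
  .const 5 0 ;;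
  .loop 5 9 (.load 7 12 5 ;; .load 10 9 7 ;; .store 0 5 10 ;; .load 10 10 7 ;; .store 1 5 10 ;;
    .load 10 13 5 ;; .store 2 5 10 ;; .arith .add 5 5 4) ;;
  .move 0 9

theorem wp_mergeSummary {n b : ℕ} {T₁ T₂ : List ((Fin n × Fin n) × ℝ)} {m : Mem}
    (h0 : m.reg 0 = n) (h1 : m.reg 1 = b) (h2 : m.reg 2 = T₁.length) (h3 : m.reg 3 = T₂.length)
    (a0 : Holds (m.arr 0) (fun y => ((y.1.1 : ℕ) : ℝ)) T₁)
    (a1 : Holds (m.arr 1) (fun y => ((y.1.2 : ℕ) : ℝ)) T₁)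
    (a2 : Holds (m.arr 2) (fun y => y.2) T₁)
    (a3 : Holds (m.arr 3) (fun y => ((y.1.1 : ℕ) : ℝ)) T₂)
    (a4 : Holds (m.arr 4) (fun y => ((y.1.2 : ℕ) : ℝ)) T₂)
    (a5 : Holds (m.arr 5) (fun y => y.2) T₂)
    (hpos : ∀ y ∈ T₁ ++ T₂, 0 ≤ y.2) :
    Wp mergeSummary mergeSummary (fun t m' => t ≤ 11000 * (T₁ ++ T₂).length + 10 * n + 400 ∧
      ∃ (x : ℝ) (O : List (Fin n × Fin n)), O.Pairwise (fun d e => posCode d < posCode e) ∧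
        IsRank ((T₁ ++ T₂).map Prod.fst).toFinset (totalWeight (T₁ ++ T₂)) (b + 1) x ∧
        IsHeaviest b ((T₁ ++ T₂).map Prod.fst).toFinset (totalWeight (T₁ ++ T₂)) O.toFinset ∧
        (∀ e ∈ O, x ≤ totalWeight (T₁ ++ T₂) e) ∧ m'.reg 0 = O.length ∧
        Holds (m'.arr 0) (fun e => ((e.1 : ℕ) : ℝ)) O ∧
        Holds (m'.arr 1) (fun e => ((e.2 : ℕ) : ℝ)) O ∧
        Holds (m'.arr 2) (fun e => totalWeight (T₁ ++ T₂) e - x) O) m := by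
  classical
  generalize hP : mergeSummary = P
  nth_rewrite 2 [← hP]
  unfold mergeSummary
  simp only [wp_seq, wp_const, wp_move]
  refine wp_loop_count (fun k m' => m'.reg 5 = k ∧ m'.reg 6 = ((T₁.length + k : ℕ) : ℝ) ∧
    Holds (m'.arr 0) (fun y => ((y.1.1 : ℕ) : ℝ)) (T₁ ++ T₂.take k) ∧
    Holds (m'.arr 1) (fun y => ((y.1.2 : ℕ) : ℝ)) (T₁ ++ T₂.take k) ∧
    Holds (m'.arr 2) (fun y => y.2) (T₁ ++ T₂.take k)) T₂.length 9 ?_ ?_ ?_ ?_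
  · simp [h2, a0, a1, a2]
  · rintro k m1 ⟨i5, i6, i0, i1, i2⟩ ha hk -
    have e4 : m1.reg 4 = 1 := by simp [ha.1 4 rfl]
    have e3 : m1.arr 3 k = (T₂[k].1.1 : ℕ) := by simpa [ha.2 3 rfl] using a3 k hk
    have e4' : m1.arr 4 k = (T₂[k].1.2 : ℕ) := by simpa [ha.2 4 rfl] using a4 k hk
    have e5 : m1.arr 5 k = T₂[k].2 := by simpa [ha.2 5 rfl] using a5 k hk
    have hl : T₁.length + k = (T₁ ++ T₂.take k).length := by simp [hk.le]
    have n0 := i0.append (x := T₂[k]) hl rfl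
    have n1 := i1.append (x := T₂[k]) hl rfl
    have n2 := i2.append (x := T₂[k]) hl rfl
    rw [List.append_assoc, ← List.take_succ_eq_append_getElem hk] at n0 n1 n2
    simp only [wp_seq, wp_load, wp_store, wp_add]
    simp
    refine ⟨k, i5, _, i6, k, i5, _, i6, k, i5, _, i6, by rw [i5, e4], ?_, ?_, ?_, ?_⟩
    · rw [i6, e4]
      push_cast
      ring
    · rwa [e3]
    · rwa [e4']
    · rwa [e5]
  · rintro k m1 ⟨i5, -⟩ ha
    have e3 : m1.reg 3 = T₂.length := by simp [ha.1 3 rfl, h3]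
    rw [i5, e3, Nat.cast_lt]
  rintro m1 t1 ⟨-, i6, i0, i1, i2⟩ ha ht1
  rw [← List.length_append] at i6
  rw [List.take_length] at i0 i1 i2
  have r0 : m1.reg 0 = n := by simp [ha.1 0 rfl, h0]
  have r1 : m1.reg 1 = b := by simp [ha.1 1 rfl, h1]
  have r4 : m1.reg 4 = 1 := by simp [ha.1 4 rfl]
  have hlen : T₂.length ≤ (T₁ ++ T₂).length := by simp
  clear ha a0 a1 a2 a3 a4 a5 h2 h3 h0 h1
  -- from here on, only the concatenation of the two lists matters
  generalize T₂.length = N₂ at hlen ht1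
  generalize T₁ ++ T₂ = T at *
  clear T₁ T₂
  refine wp_loop_count (fun k m' => m'.reg 5 = k ∧
    Holds (m'.arr 6) (Nat.cast : ℕ → ℝ) (List.range k))
    T.length 3 ?_ ?_ ?_ ?_
  · simp [Holds.nil]
  · rintro k m2 ⟨i5, i6'⟩ ha hk -
    have e4 : m2.reg 4 = 1 := by simp [ha.1 4 rfl, r4]
    have n6 := i6'.append (x := k) (k := k) (by simp) rfl
    rw [← List.range_succ] at n6
    simp only [wp_seq, wp_store, wp_add]
    simp
    exact ⟨k, i5, by rw [i5, e4], by rwa [i5]⟩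
  · rintro k m2 ⟨i5, -⟩ ha
    have e6 : m2.reg 6 = T.length := by simp [ha.1 6 rfl, i6]
    rw [i5, e6, Nat.cast_lt]
  rintro M2 t2 ⟨-, M2a6⟩ ha ht2
  have M2r0 : M2.reg 0 = n := by simp [ha.1 0 rfl, r0]
  have M2r1 : M2.reg 1 = b := by simp [ha.1 1 rfl, r1]
  have M2r4 : M2.reg 4 = 1 := by simp [ha.1 4 rfl, r4]
  have M2r6 : M2.reg 6 = T.length := by simp [ha.1 6 rfl, i6]
  have M2a0 : Holds (M2.arr 0) (fun y => ((y.1.1 : ℕ) : ℝ)) T := by simpa [ha.2 0 rfl] using i0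
  have M2a1 : Holds (M2.arr 1) (fun y => ((y.1.2 : ℕ) : ℝ)) T := by simpa [ha.2 1 rfl] using i1
  have M2a2 : Holds (M2.arr 2) (fun y => y.2) T := by simpa [ha.2 2 rfl] using i2
  clear ha i0 i1 i2 i6 r0 r1 r4
  -- the keys of the two passes: rows and columns, with any value beyond the end of the list
  obtain ⟨f, hf⟩ : ∃ f : ℕ → ℕ, ∀ t (h : t < T.length), f t = (T[t].1.1 : ℕ) :=
    ⟨fun t => if h : t < T.length then (T[t].1.1 : ℕ) else 0, fun t h => by simp [h]⟩
  obtain ⟨g, hg⟩ : ∃ f : ℕ → ℕ, ∀ t (h : t < T.length), f t = (T[t].1.2 : ℕ) :=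
    ⟨fun t => if h : t < T.length then (T[t].1.2 : ℕ) else 0, fun t h => by simp [h]⟩
  have hgn : ∀ t ∈ List.range T.length, g t < n := fun t ht => by
    have ht' := List.mem_range.1 ht
    rw [hg t ht']
    exact Fin.is_lt _
  refine wp_call (by decide) ((wp_bucketSort (f := g) (n := n) (l := List.range T.length)
    (by simpa using M2r6) (by simpa using M2r0) (by simpa using M2a6) ?_ hgn
    (by simp)).frame.mono ?_)
  · intro t ht
    have ht' := List.mem_range.1 ht
    rw [hg t ht']
    simpa using M2a1 t ht'
  rintro t3 m3 ⟨⟨ht3, p2⟩, g1⟩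
  have c1 := g1.2 1 rfl
  obtain ⟨M3, hM3⟩ : ∃ M, M = M2.leave m3 [6, 1, 7] 7 := ⟨_, rfl⟩
  rw [← hM3]
  have M3r0 : M3.reg 0 = n := by simp [hM3, M2r0]
  have M3r1 : M3.reg 1 = b := by simp [hM3, M2r1]
  have M3r4 : M3.reg 4 = 1 := by simp [hM3, M2r4]
  have M3r6 : M3.reg 6 = T.length := by simp [hM3, M2r6]
  have M3a0 : Holds (M3.arr 0) (fun y => ((y.1.1 : ℕ) : ℝ)) T := by simpa [hM3] using M2a0
  have M3a1 : Holds (M3.arr 1) (fun y => ((y.1.2 : ℕ) : ℝ)) T := by simpa [hM3, c1] using M2a1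
  have M3a2 : Holds (M3.arr 2) (fun y => y.2) T := by simpa [hM3] using M2a2
  have M3a7 : Holds (M3.arr 7) (Nat.cast : ℕ → ℝ) (bucketList g n (List.range T.length)) := by
    simpa [hM3] using p2
  clear hM3 M2r0 M2r1 M2r4 M2r6 M2a0 M2a1 M2a2 M2a6 p2 c1 g1
  have hpg := bucketList_perm hgn
  obtain ⟨hol, T', hT', hTs, hord⟩ := exists_sorted T hf hg
  rw [List.length_range] at ht3
  refine wp_call (by decide) ((wp_bucketSort (f := f) (n := n)
    (l := bucketList g n (List.range T.length)) (by simpa [hpg.length_eq] using M3r6)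
    (by simpa using M3r0) (by simpa using M3a7) ?_ ?_ (by simp)).frame.mono ?_)
  · intro t ht
    have ht' := List.mem_range.1 (hpg.mem_iff.1 ht)
    rw [hf t ht']
    simpa using M3a0 t ht'
  · intro t ht
    have ht' := List.mem_range.1 (hpg.mem_iff.1 ht)
    rw [hf t ht']
    exact Fin.is_lt _
  rintro t4 m4 ⟨⟨ht4, p2⟩, g1⟩
  have c1 := g1.2 1 rfl
  rw [hpg.length_eq, List.length_range] at ht4
  obtain ⟨M4, hM4⟩ : ∃ M, M = M3.leave m4 [7, 0, 8] 7 := ⟨_, rfl⟩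
  rw [← hM4]
  have M4r0 : M4.reg 0 = n := by simp [hM4, M3r0]
  have M4r1 : M4.reg 1 = b := by simp [hM4, M3r1]
  have M4r4 : M4.reg 4 = 1 := by simp [hM4, M3r4]
  have M4r6 : M4.reg 6 = T.length := by simp [hM4, M3r6]
  have M4a0 : Holds (M4.arr 0) (fun y => ((y.1.1 : ℕ) : ℝ)) T := by simpa [hM4, c1] using M3a0
  have M4a1 : Holds (M4.arr 1) (fun y => ((y.1.2 : ℕ) : ℝ)) T := by simpa [hM4] using M3a1
  have M4a2 : Holds (M4.arr 2) (fun y => y.2) T := by simpa [hM4] using M3a2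
  have M4a8 : Holds (M4.arr 8) (Nat.cast : ℕ → ℝ)
      (bucketList f n (bucketList g n (List.range T.length))) := by simpa [hM4] using p2
  clear hM4 M3r0 M3r1 M3r4 M3r6 M3a0 M3a1 M3a2 M3a7 p2 c1 g1
  refine wp_call (by decide) ((wp_mergeDuplicates (n := n) (T := T')
    (by simpa [hT'.length_eq] using M4r6) (by simpa using M4r0) ?_ hTs).frame.mono ?_)
  · intro t ht
    obtain ⟨h', h'', he⟩ := hord t ht
    exact ⟨_, by simpa using M4a8 t h', by simpa [he] using M4a0 _ h'',
      by simpa [he] using M4a1 _ h'', by simpa [he] using M4a2 _ h''⟩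
  rintro t5 m5 ⟨⟨ht5, E, hE, hET, p0, p4, p5, p6⟩, g1⟩
  rw [totalWeight_perm hT'] at p6
  rw [hT'.length_eq] at ht5
  have hEnd : E.Nodup := hE.imp fun h heq => absurd h (by simp [heq])
  have hEf : E.toFinset = (T.map Prod.fst).toFinset := by
    ext e
    rw [List.mem_toFinset, hET, List.mem_toFinset, (hT'.map _).mem_iff]
  have hEl : E.length ≤ T.length := by
    rw [← List.toFinset_card_of_nodup hEnd, hEf]
    exact (List.toFinset_card_le _).trans (by simp)
  obtain ⟨M5, hM5⟩ : ∃ M, M = M4.leave m5 [0, 1, 2, 8, 9, 10, 11] 8 := ⟨_, rfl⟩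
  rw [← hM5]
  have M5r1 : M5.reg 1 = b := by simp [hM5, M4r1]
  have M5r4 : M5.reg 4 = 1 := by simp [hM5, M4r4]
  have M5r8 : M5.reg 8 = E.length := by simp [hM5, p0]
  have M5a9 : Holds (M5.arr 9) (fun e => ((e.1 : ℕ) : ℝ)) E := by simpa [hM5] using p4
  have M5a10 : Holds (M5.arr 10) (fun e => ((e.2 : ℕ) : ℝ)) E := by simpa [hM5] using p5
  have M5a11 : Holds (M5.arr 11) (totalWeight T) E := by simpa [hM5] using p6
  clear hM5 M4r0 M4r1 M4r4 M4r6 M4a0 M4a1 M4a2 M4a8 p0 p4 p5 p6 g1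
  refine wp_call (by decide) ((wp_takeTop (N := E.length) (b := b) (by simpa using M5r8)
    (by simpa using M5r1) ?_).frame.mono ?_)
  · intro i hi
    simp only [Mem.enter_arr, List.getElem?_cons_zero, Option.elim_some, M5a11 i hi]
    exact totalWeight_nonneg hpos _
  rintro t6 m6 ⟨⟨ht6, -, x, js, hx, j1, j2, j3, j4, j5, p0, p1, p2⟩, g1⟩
  simp only [Mem.enter_arr, List.getElem?_cons_zero, Option.elim_some] at hx j4 j5 p2
  obtain ⟨O, hO, hOj, hOnd, hOpw, hOE, hOx, hOn⟩ := exists_heaviest hEnd M5a11 j1 j2 j4 j5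
  have hrank := hx.of_range hEnd M5a11
  obtain ⟨M6, hM6⟩ : ∃ M, M = M5.leave m6 [11, 12, 13] 9 := ⟨_, rfl⟩
  rw [← hM6]
  have M6r4 : M6.reg 4 = 1 := by simp [hM6, M5r4]
  have M6r9 : M6.reg 9 = O.length := by simp [hM6, p0, hO]
  have M6a9 : Holds (M6.arr 9) (fun e => ((e.1 : ℕ) : ℝ)) E := by simpa [hM6] using M5a9
  have M6a10 : Holds (M6.arr 10) (fun e => ((e.2 : ℕ) : ℝ)) E := by simpa [hM6] using M5a10
  have M6a12 : Holds (M6.arr 12) (Nat.cast : ℕ → ℝ) js := by simpa [hM6] using p1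
  have M6a13 : Holds (M6.arr 13) (fun e => totalWeight T e - x) O := by
    intro t ht
    obtain ⟨h', h'', he⟩ := hOj t ht
    have e1 : M6.arr 13 t = M5.arr 11 js[t] - x := by simpa [hM6] using p2 t h'
    rw [e1, M5a11 _ h'', he]
  clear hM6 M5r1 M5r4 M5r8 M5a9 M5a10 p0 p1 p2 g1
  refine wp_loop_count (fun k m' => m'.reg 5 = k ∧
    Holds (m'.arr 0) (fun e => ((e.1 : ℕ) : ℝ)) (O.take k) ∧
    Holds (m'.arr 1) (fun e => ((e.2 : ℕ) : ℝ)) (O.take k) ∧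
    Holds (m'.arr 2) (fun e => totalWeight T e - x) (O.take k)) O.length 9 ?_ ?_ ?_ ?_
  · simp [Holds.nil]
  · rintro k m1 ⟨i5, i0, i1, i2⟩ ha hk -
    obtain ⟨h', h'', he⟩ := hOj k hk
    have e4 : m1.reg 4 = 1 := by simp [ha.1 4 rfl, M6r4]
    have e12 : m1.arr 12 k = js[k] := by simpa [ha.2 12 rfl] using M6a12 k h'
    have e9 : m1.arr 9 js[k] = (O[k].1 : ℕ) := by simpa [ha.2 9 rfl, he] using M6a9 _ h''
    have e10 : m1.arr 10 js[k] = (O[k].2 : ℕ) := by simpa [ha.2 10 rfl, he] using M6a10 _ h''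
    have e13 : m1.arr 13 k = totalWeight T O[k] - x := by
      simpa [ha.2 13 rfl] using M6a13 k hk
    have hl : k = (O.take k).length := by simp [hk.le]
    have n0 := i0.append (x := O[k]) hl rfl
    have n1 := i1.append (x := O[k]) hl rfl
    have n2 := i2.append (x := O[k]) hl rfl
    rw [← List.take_succ_eq_append_getElem hk] at n0 n1 n2
    simp only [wp_seq, wp_load, wp_store, wp_add]
    simp
    refine ⟨k, i5, js[k], e12, k, i5, js[k], e12, k, i5, k, i5, k, i5, by rw [i5, e4], ?_, ?_, ?_⟩
    · rwa [e9]
    · rwa [e10]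
    · rwa [e13]
  · rintro k m1 ⟨i5, -⟩ ha
    have e9 : m1.reg 9 = O.length := by simp [ha.1 9 rfl, M6r9]
    rw [i5, e9, Nat.cast_lt]
  rintro m7 t7 ⟨-, i0, i1, i2⟩ ha ht7
  rw [List.take_length] at i0 i1 i2
  have e9 : m7.reg 9 = O.length := by simp [ha.1 9 rfl, M6r9]
  refine ⟨?_, x, O, hOpw _ hE, hEf ▸ hrank, ⟨?_, ?_, ?_⟩, hOx, by simpa using e9, by simpa using i0,
    by simpa using i1, by simpa using i2⟩
  · have : O.length ≤ T.length := by omega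
    simp only [List.length_cons, List.length_nil] at *
    omega
  · rw [← hEf]
    exact fun e he => by simpa using hOE e (by simpa using he)
  · rw [← hEf, List.toFinset_card_of_nodup hOnd, List.toFinset_card_of_nodup hEnd, hO, j3]
  · intro e he d hd hn
    rw [← hEf, List.mem_toFinset] at hd
    rw [List.mem_toFinset] at he hn
    exact (hOn d hd hn).trans (hOx e he)

theorem totalWeight_map {n : ℕ} {l : List (Fin n × Fin n)} (hl : l.Nodup)
    (w : Fin n × Fin n → ℝ) (e : Fin n × Fin n) :
    totalWeight (l.map fun d => (d, w d)) e = if e ∈ l then w e else 0 := by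
  classical
  rw [totalWeight, List.map_map, ← List.sum_toFinset _ hl]
  simp [Finset.sum_ite_eq']

/-- The entries of a stored summary as a list. -/
theorem StoresSummary.exists_list {n : ℕ} {m : Mem} {S : Summary n} (h : StoresSummary m S) :
    ∃ l : List (Fin n × Fin n), l.Nodup ∧ l.toFinset = S.entries ∧ m.reg 2 = l.length ∧
      Holds (m.arr 2) (fun e => ((e.1 : ℕ) : ℝ)) l ∧
      Holds (m.arr 3) (fun e => ((e.2 : ℕ) : ℝ)) l ∧ Holds (m.arr 4) S.weight l := by
  obtain ⟨hr, e, he, hmono, ha⟩ := h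
  have hinj : Function.Injective e := fun i j hij => hmono.injective (by simp only [hij])
  have hnd : (List.ofFn e).Nodup := List.nodup_ofFn.2 hinj
  refine ⟨List.ofFn e, hnd, ?_, by simpa using hr, ?_, ?_, ?_⟩
  · refine Finset.eq_of_subset_of_card_le (fun d hd => ?_) ?_
    · obtain ⟨i, rfl⟩ := (List.mem_ofFn' _ _).1 (List.mem_toFinset.1 hd)
      exact he i
    · rw [List.toFinset_card_of_nodup hnd, List.length_ofFn]
  · intro i hi
    simpa using (ha ⟨i, by simpa using hi⟩).1
  · intro i hi
    simpa using (ha ⟨i, by simpa using hi⟩).2.1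
  · intro i hi
    simpa using (ha ⟨i, by simpa using hi⟩).2.2

theorem storesSummary_of_list {n : ℕ} {m : Mem} {w : Fin n × Fin n → ℝ}
    {l : List (Fin n × Fin n)} (hl : l.Pairwise fun d e => posCode d < posCode e)
    (hr : m.reg 2 = l.length) (h2 : Holds (m.arr 2) (fun e => ((e.1 : ℕ) : ℝ)) l)
    (h3 : Holds (m.arr 3) (fun e => ((e.2 : ℕ) : ℝ)) l) (h4 : Holds (m.arr 4) w l) :
    StoresSummary m ⟨l.toFinset, w⟩ := by
  have hnd : l.Nodup := hl.imp fun h heq => absurd h (by simp [heq])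
  have hcard : l.toFinset.card = l.length := List.toFinset_card_of_nodup hnd
  refine ⟨by rw [hr]; exact_mod_cast hcard.symm, fun k => l[k]'(hcard ▸ k.2), ?_, ?_, ?_⟩
  · intro k
    simp
  · intro i j hij
    exact List.pairwise_iff_getElem.1 hl _ _ _ _ hij
  · intro k
    exact ⟨h2 k _, h3 k _, h4 k _⟩

/-- The program that updates a summary. The arrays `5`, `6` and `7` are used for the heaviest
entries of the outer product, and register `3` for their number. -/
def updateSummary (sorter : Cmd) : Cmd :=
  .call (heavyEntries sorter) [0, 1] [0, 1, 5, 6, 7] 3 ;;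
  .call mergeSummary [0, 1, 2, 3] [2, 3, 4, 5, 6, 7] 2

theorem mainTheorem4 :
    ∃ C : ℕ, ∀ sorter : Cmd, ∃ P : Cmd,
      ∀ (D : ℕ → Set ℝ) (sortTime : ℕ → ℕ), SortsInTime D sorter sortTime →
      ∀ (n b : ℕ) (u v : Fin n → ℝ) (S : Summary n) (m : Mem),
        (∀ i, 0 ≤ u i ∧ u i ∈ D n) → (∀ i, 0 ≤ v i ∧ v i ∈ D n) →
        S.HasSize b → StoresInput m b u v S →
        ∃ (t : ℕ) (m' : Mem) (S' : Summary n),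
          Runs P m t m' ∧ t ≤ C * (b + sortTime n) ∧
          S'.HasSize b ∧ IsUpdate b (outer u v) S S' ∧ StoresSummary m' S' := by
  classical
  -- `400000 * (b + T n)` for the heaviest entries, `22000 * b + 10 * n + 400` for the merging, and
  -- the two calls; `n ≤ 2 * T n` and `1 ≤ T n`
  refine ⟨500000, fun sorter => ⟨updateSummary sorter, ?_⟩⟩
  rintro D T h n b u v S m hu hv ⟨hSb, hSw⟩ ⟨h0, h1, ha0, ha1, hS⟩
  obtain ⟨l, hl, hlS, h2, a2, a3, a4⟩ := hS.exists_list
  obtain ⟨hT1, hTn⟩ := h.le_two_mul u fun i => (hu i).2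
  suffices hW : Wp (updateSummary sorter) (updateSummary sorter) (fun t m' => ∃ S' : Summary n,
      t ≤ 500000 * (b + T n) ∧ S'.HasSize b ∧ IsUpdate b (outer u v) S S' ∧
        StoresSummary m' S') m by
    obtain ⟨t, m', hrun, S', hS'⟩ := hW
    exact ⟨t, m', S', hrun, hS'⟩
  generalize hP : updateSummary sorter = P
  nth_rewrite 2 [← hP]
  unfold updateSummary
  rw [wp_seq]
  refine wp_call (by decide) ((wp_heavyEntries h (b := b) u v hu hv (by simpa using h0)
    (by simpa using h1) (by simpa using ha0) (by simpa using ha1) (by simp) (by simp)).mono ?_)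
  rintro t1 m1 ⟨ht1, x, O, hO, hx, hOh, hOx, p0, p2, p3, p4⟩
  obtain ⟨M, hM⟩ : ∃ M, M = m.leave m1 [0, 1, 5, 6, 7] 3 := ⟨_, rfl⟩
  rw [← hM]
  have hxw : rankWeight Finset.univ (outer u v) (b + 1) = x :=
    hx.rankWeight_eq (fun e _ => mul_nonneg (hu _).1 (hv _).1) (by omega)
  set T₁ := l.map fun e => (e, S.weight e) with hT₁
  set T₂ := O.map fun e => (e, outer u v e - x) with hT₂
  have hpos : ∀ y ∈ T₁ ++ T₂, 0 ≤ y.2 := by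
    intro y hy
    rcases List.mem_append.1 hy with hy | hy
    · obtain ⟨e, he, rfl⟩ := List.mem_map.1 hy
      exact hSw e (hlS ▸ List.mem_toFinset.2 he)
    · obtain ⟨e, he, rfl⟩ := List.mem_map.1 hy
      exact sub_nonneg.2 (hOx e he)
  have hE : ((T₁ ++ T₂).map Prod.fst).toFinset = S.entries ∪ O.toFinset := by
    rw [← hlS]
    ext e
    simp [hT₁, hT₂]
  have hW : mergedWeight b (outer u v) O.toFinset S = totalWeight (T₁ ++ T₂) := by
    funext e
    rw [totalWeight_append, totalWeight_map hl, totalWeight_map hO, mergedWeight, hxw,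
      Summary.estimate, ← hlS]
    simp only [List.mem_toFinset]
  have hlen : (T₁ ++ T₂).length ≤ 2 * b := by
    have e1 : l.length ≤ b := by
      rwa [← List.toFinset_card_of_nodup hl, hlS]
    have e2 : O.length ≤ b := by
      rw [← List.toFinset_card_of_nodup hO, hOh.2.1]
      exact min_le_left _ _
    rw [List.length_append, hT₁, hT₂, List.length_map, List.length_map]
    omega
  refine wp_call (by decide) ((wp_mergeSummary (n := n) (b := b) (T₁ := T₁) (T₂ := T₂)
    (by simp [hM, h0]) (by simp [hM, h1]) (by simp [hM, h2, hT₁]) (by simp [hM, p0, hT₂])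
    ?_ ?_ ?_ ?_ ?_ ?_ hpos).mono ?_)
  · intro i hi
    simpa [hM, hT₁] using a2 i (by simpa [hT₁] using hi)
  · intro i hi
    simpa [hM, hT₁] using a3 i (by simpa [hT₁] using hi)
  · intro i hi
    simpa [hM, hT₁] using a4 i (by simpa [hT₁] using hi)
  · intro i hi
    simpa [hM, hT₂] using p2 i (by simpa [hT₂] using hi)
  · intro i hi
    simpa [hM, hT₂] using p3 i (by simpa [hT₂] using hi)
  · intro i hi
    simpa [hM, hT₂] using p4 i (by simpa [hT₂] using hi)
  rintro t2 m2 ⟨ht2, x', O', hO', hx', hOh', hOx', q0, q2, q3, q4⟩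
  rw [hE] at hx' hOh'
  have hxw' : rankWeight (S.entries ∪ O.toFinset) (totalWeight (T₁ ++ T₂)) (b + 1) = x' :=
    hx'.rankWeight_eq (fun e _ => totalWeight_nonneg hpos e) (by omega)
  refine ⟨⟨O'.toFinset, fun e => totalWeight (T₁ ++ T₂) e - x'⟩, ?_, ⟨?_, ?_⟩,
    ⟨O.toFinset, hOh, hW ▸ hOh', fun e _ => ?_⟩, ?_⟩
  · simp only [List.length_cons, List.length_nil]
    omega
  · exact hOh'.2.1.trans_le (min_le_left _ _)
  · exact fun e he => sub_nonneg.2 (hOx' e (List.mem_toFinset.1 he))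
  · rw [hW, hxw']
  · exact storesSummary_of_list hO' (by simp [q0]) (by simpa using q2) (by simpa using q3)
      (by simpa using q4)
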